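/- **Setting.** Let $\mathcal P_2(\mathbb R)$ be the set of Borel probability measures on $\mathbb R$ with finite second moment, with the 2-Wasserstein distance $\mathbb W_2$. Let $f,a,h:\mathbb R\times\mathbb R\times\mathcal P_2(\mathbb R)\to\mathbb R$, $(x,y,\mu)\mapsto f,a,h(x,y,\mu)$, be such that $f,a$ are continuous in $y$, $a>0$, $h$ is jointly continuous in $(x,y,\mu)$, and $f,a,h$ grow at most polynomially in $y$ uniformly in $(x,\mu)$. Put $\mathcal L_{x,\mu}\phi(y)=f(x,y,\mu)\phi'(y)+a(x,y,\mu)\phi''(y)$. A probability measure $\rho$ is *invariant* for $\mathcal L_{x,\mu}$ if $\int\mathcal L_{x,\mu}\phi\,d\rho=0$ for all $\phi\in C_c^\infty(\mathbb R)$. For every $(x,\mu)$ let $\pi(dy;x,\mu)$ be an invariant probability measure of $\mathcal L_{x,\mu}$, with $\sup_{x,\mu}\int|y|^k\pi(dy;x,\mu)<\infty$ for every $k\in\mathbb N$. Put $\bar h(x,\mu)=\int h(x,y,\mu)\,\pi(dy;x,\mu)$, and let $v$ be, for every $(x,\mu)$, a $C^2$ solution in $y$ of $$\mathcal L_{x,\mu}v(x,y,\mu)=h(x,y,\mu)-\bar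 h(x,\mu)$$ whose derivatives $v_y,v_{yy}$ grow at most polynomially in $y$. *Multi-indices.* A multi-index is $(n,l,\beta)$ with $n,l\in\mathbb N$, $\beta\in\mathbb N^n$, and $$D^{(n,l,\beta)}G(x,\mu)[z_1,\dots,z_n]=\partial_{z_1}^{\beta_1}\cdots\partial_{z_n}^{\beta_n}\partial_x^l\partial_\mu^nG(x,\mu)[z_1,\dots,z_n],$$ where $\partial_\mu$ is the Lions derivative and all derivatives involved are required to be jointly continuous in $(x,\mu,z_1,\dots,z_n)$. A set $\boldsymbol\zeta$ of multi-indices is *complete* if $(n,l,\beta)\in\boldsymbol\zeta$ implies $(k,j,\alpha)\in\boldsymbol\zeta$ whenever $k\le n$, $j\le l$ and $\alpha\in\mathbb N^k$ is bounded componentwise by a vector obtained from $\beta$ by deleting $n-k$ entries. $G(x,y,\mu)$ is in $\mathcal M_p^{\boldsymbol\zeta}$ if for all $(n,l,\beta)\in\boldsymbol\zeta$ and all $y$ the derivative $D^{(n,l,\beta)}G(x,y,\mu)[z_1,\dots,z_n]$ exists and grows at most polynomially in $y$ uniformly in $(x,\mu,z_1,\dots,z_n)$ (no Hölder continuity is required).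 $\boldsymbol\zeta'$ is $\boldsymbol\zeta$ without the multi-indices that contain both the maximal first and the maximal second value in $\boldsymbol\zeta$. **Statement.** (A) All integrals below converge absolutely. For all $x,x_1,x_2\in\mathbb R$ and $\mu,\mu_1,\mu_2\in\mathcal P_2(\mathbb R)$, $$\bar h(x,\mu_1)-\bar h(x,\mu_2)=\int_{\mathbb R}\bigl(h(x,y,\mu_1)-h(x,y,\mu_2)-[\mathcal L_{x,\mu_1}-\mathcal L_{x,\mu_2}]v(x,y,\mu_2)\bigr)\pi(dy;x,\mu_1),$$ $$\bar h(x_1,\mu)-\bar h(x_2,\mu)=\int_{\mathbb R}\bigl(h(x_1,y,\mu)-h(x_2,y,\mu)-[\mathcal L_{x_1,\mu}-\mathcal L_{x_2,\mu}]v(x_2,y,\mu)\bigr)\pi(dy;x_1,\mu).$$ If moreover $f,a$ are jointly continuous in $(x,y,\mu)$, $\boldsymbol\zeta$ is complete, $h,a,f\in\mathcal M_p^{\boldsymbol\zeta}$ and $v_y,v_{yy}\in\mathcal M_p^{\boldsymbol\zeta'}$, then for every $(n,l,\beta)\in\boldsymbol\zeta$ the derivative $D^{(n,l,\beta)}\bar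 h$ exists, is jointly continuous, and $$D^{(n,l,\beta)}\bar h(x,\mu)[z_1,\dots,z_n]=\int_{\mathbb R}\Bigl(D^{(n,l,\beta)}h(x,y,\mu)[z_1,\dots,z_n]-\sum_{k=0}^n\sum_{j=0}^l\sum_{p}C_{k,j,l}\,T_{p,j}(x,y,\mu)\Bigr)\pi(dy;x,\mu).$$ Here $p=\{p_1<\dots<p_k\}$ runs over the $k$-element subsets of $\{1,\dots,n\}$, $p'$ is its complement, $z_p=(z_{p_1},\dots,z_{p_k})$, $\beta_p=(\beta_{p_1},\dots,\beta_{p_k})$, $$T_{p,j}=D^{(k,j,\beta_p)}f[z_p]\;D^{(n-k,l-j,\beta_{p'})}v_y[z_{p'}]+D^{(k,j,\beta_p)}a[z_p]\;D^{(n-k,l-j,\beta_{p'})}v_{yy}[z_{p'}],$$ and $C_{0,0,l}=0$, $C_{k,j,l}=\binom lj>0$ for $(k,j)\ne(0,0)$. (B) If there are $0<\lambda_-\le\lambda_+$, $b>0$ and $C$ with $\lambda_-\le a(x,y,\mu)\le\lambda_+$ and $f(x,y,\mu)\,y\le-b|y|^2+C$ for all $(x,y,\mu)$, then $\pi(\cdot;x,\mu)$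 exists and is unique for all $(x,\mu)$, its moments are bounded uniformly in $(x,\mu)$, and a solution $v$ as above exists. -/

import Mathlib

open MeasureTheory Filter Topology
open scoped ENNReal

noncomputable section

namespace DerivTransfer

/-! ### The Wasserstein space over the real line -/

/-- Borel probability measures on the real line with finite second moment. -/
def P2 : Type := {μ : Measure ℝ // IsProbabilityMeasure μ ∧ MemLp (fun x : ℝ => x) 2 μ}

/-- The 2-Wasserstein distance: the infimum, over all couplings, of the root of the
quadratic transport cost. -/
def W2 (μ ν : P2) : ℝ≥0∞ :=
  (⨅ γ ∈ {γ : Measure (ℝ × ℝ) | γ.map Prod.fst = μ.1 ∧ γ.map Prod.snd = ν.1},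
    ∫⁻ p, ENNReal.ofReal ((p.1 - p.2) ^ 2) ∂γ) ^ (1 / 2 : ℝ)

/-- The neighbourhood filter of `μ` for the 2-Wasserstein distance, generated by the balls
`{ν | W2 ν μ < ε}` with `ε > 0`. -/
def nhdsW2 (μ : P2) : Filter P2 := comap (fun ν => W2 ν μ) (𝓝 0)

/-- Joint continuity in a parameter `e` and in the measure argument, the latter with respect to
the 2-Wasserstein distance. -/
def ContinuousW2 {E : Type} [TopologicalSpace E] (F : E → P2 → ℝ) : Prop :=
  ∀ (e : E) (μ : P2),
    Tendsto (fun q : E × P2 => F q.1 q.2) (𝓝 e ×ˢ nhdsW2 μ) (𝓝 (F e μ))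

/-! ### Lions derivatives -/

/-- The law of a square integrable random variable, as an element of the Wasserstein space. -/
def law {Ω : Type} [MeasurableSpace Ω] {P : Measure Ω} [IsProbabilityMeasure P]
    (X : Lp ℝ 2 P) : P2 :=
  ⟨P.map X, Measure.isProbabilityMeasure_map (Lp.aestronglyMeasurable X).aemeasurable,
    (memLp_map_measure_iff (by fun_prop) (Lp.aestronglyMeasurable X).aemeasurable).2 (Lp.memLp X)⟩

/-- `u : P2 → ℝ` is everywhere differentiable in the sense of Lions, and `(μ, z) ↦ U μ z` is a
version of its Lions derivative: on every atomless standard Borel probability space, the lifting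
`X ↦ u (law X)` is Fréchet differentiable at every `X` in `L²`, and its gradient at `X` is the
random variable `U (law X) (X ·)`. -/
def HasLionsDeriv (u : P2 → ℝ) (U : P2 → ℝ → ℝ) : Prop :=
  ∀ (Ω : Type) [MeasurableSpace Ω] [StandardBorelSpace Ω] (P : Measure Ω)
    [IsProbabilityMeasure P] [NullSingletonClass P] (X : Lp ℝ 2 P),
    ∃ g : Lp ℝ 2 P, (∀ᵐ ω ∂P, g ω = U (law X) (X ω)) ∧
      HasFDerivAt (fun X' : Lp ℝ 2 P => u (law X')) (innerSL ℝ g) X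

/-! ### Multi-indices and mixed derivatives -/

/-- A multi-index `(n, l, β)`: `n` derivatives in the measure, `l` derivatives in `x`, and
`β i` derivatives in the `i`-th auxiliary variable `z i` that the measure derivatives create. -/
structure MultiIndex where
  n : ℕ
  l : ℕ
  β : Fin n → ℕ

/-- A collection of multi-indices is complete if with `(n, l, β)` it contains every `(k, j, α)`
with `j ≤ l` and `α` bounded componentwise by a vector obtained from `β` by deleting entries. -/
def IsCompleteCollection (ζ : Set MultiIndex) : Prop :=
  ∀ m ∈ ζ, ∀ (k j : ℕ) (e : Fin k ↪o Fin m.n) (α : Fin k → ℕ),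
    j ≤ m.l → (∀ p, α p ≤ m.β (e p)) → (⟨k, j, α⟩ : MultiIndex) ∈ ζ

/-- The collection obtained by removing the multi-indices which contain both the maximal first
value and the maximal second value occurring in `ζ`. -/
def removeMax (ζ : Set MultiIndex) : Set MultiIndex :=
  {m ∈ ζ | ¬ ((∀ m' ∈ ζ, m'.n ≤ m.n) ∧ (∀ m' ∈ ζ, m'.l ≤ m.l))}

/-- For a complete collection `ζ`: for all `(n, l, β) ∈ ζ` the mixed derivative
`∂_{z_1}^{β_1} ⋯ ∂_{z_n}^{β_n} ∂_x^l ∂_μ^n G (x, μ)[z_1, …, z_n]` exists, is jointly continuous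
in `(x, μ, z_1, …, z_n)`, and is equal to `D (n, l, β) x μ z`. The derivatives are taken one at a
time, first those in `μ`, then those in `x`, then those in `z_n`, …, `z_1`. -/
structure IsDerivFamily (ζ : Set MultiIndex) (G : ℝ → P2 → ℝ)
    (D : (m : MultiIndex) → ℝ → P2 → (Fin m.n → ℝ) → ℝ) : Prop where
  base : (⟨0, 0, 0⟩ : MultiIndex) ∈ ζ → ∀ x μ z, D ⟨0, 0, 0⟩ x μ z = G x μ
  deriv_mu : ∀ n : ℕ, (⟨n + 1, 0, 0⟩ : MultiIndex) ∈ ζ → ∀ (x : ℝ) (z : Fin n → ℝ),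
    HasLionsDeriv (fun μ => D ⟨n, 0, 0⟩ x μ z)
      (fun μ z' => D ⟨n + 1, 0, 0⟩ x μ (Fin.snoc z z'))
  deriv_x : ∀ n l : ℕ, (⟨n, l + 1, 0⟩ : MultiIndex) ∈ ζ → ∀ (x : ℝ) (μ : P2) (z : Fin n → ℝ),
    HasDerivAt (fun s => D ⟨n, l, 0⟩ s μ z) (D ⟨n, l + 1, 0⟩ x μ z) x
  deriv_z : ∀ (n l : ℕ) (β : Fin n → ℕ) (i : Fin n), (∀ j < i, β j = 0) →
    (⟨n, l, β + Pi.single i 1⟩ : MultiIndex) ∈ ζ → ∀ (x : ℝ) (μ : P2) (z : Fin n → ℝ),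
    HasDerivAt (fun s => D ⟨n, l, β⟩ x μ (Function.update z i s))
      (D ⟨n, l, β + Pi.single i 1⟩ x μ z) (z i)
  cont : ∀ m ∈ ζ, ContinuousW2 (fun (q : ℝ × (Fin m.n → ℝ)) μ => D m q.1 μ q.2)

/-- At most polynomial growth in `y`, uniformly in `(x, μ)`. -/
def PolyGrowth (G : ℝ → ℝ → P2 → ℝ) : Prop :=
  ∃ (C : ℝ) (k : ℕ), ∀ x y μ, |G x y μ| ≤ C * (1 + |y| ^ k)

/-- `G = G(x, y, μ)` has, for every `(n, l, β) ∈ ζ` and every `y`, the mixed derivative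
`D (n, l, β) x y μ z` in `(x, μ, z)`, and this derivative grows at most polynomially in `y`,
uniformly in `(x, μ, z)`. No Hölder continuity is required (only that the derivatives are Borel
functions of `y`). -/
structure MemMp (ζ : Set MultiIndex) (G : ℝ → ℝ → P2 → ℝ)
    (D : (m : MultiIndex) → ℝ → ℝ → P2 → (Fin m.n → ℝ) → ℝ) : Prop where
  family : ∀ y, IsDerivFamily ζ (fun x μ => G x y μ) (fun m x μ z => D m x y μ z)
  growth : ∀ m ∈ ζ, ∃ (C : ℝ) (k : ℕ), ∀ x y μ z, |D m x y μ z| ≤ C * (1 + |y| ^ k)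
  meas : ∀ m ∈ ζ, ∀ x μ z, Measurable (fun y => D m x y μ z)

/-! ### The frozen generator, its invariant measure and its Poisson equation -/

/-- The frozen generator `L_{x,μ} φ (y) = f(x,y,μ) φ'(y) + a(x,y,μ) φ''(y)`. -/
def gen (f a : ℝ → ℝ → P2 → ℝ) (x : ℝ) (μ : P2) (φ : ℝ → ℝ) (y : ℝ) : ℝ :=
  f x y μ * deriv φ y + a x y μ * deriv (deriv φ) y

/-- `ρ` is a probability measure with `L_{x,μ}^* ρ = 0` in the sense of distributions. -/
def IsInvariantProb (f a : ℝ → ℝ → P2 → ℝ) (x : ℝ) (μ : P2) (ρ : Measure ℝ) : Prop :=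
  IsProbabilityMeasure ρ ∧
    ∀ φ : ℝ → ℝ, ContDiff ℝ (⊤ : ℕ∞) φ → HasCompactSupport φ → ∫ y, gen f a x μ φ y ∂ρ = 0

/-- All moments of `π(·; x, μ)` are finite, uniformly in `(x, μ)`. -/
def UniformMoments (π : ℝ → P2 → Measure ℝ) : Prop :=
  ∀ k : ℕ, ∃ C : ℝ, ∀ x μ, Integrable (fun y => |y| ^ k) (π x μ) ∧ ∫ y, |y| ^ k ∂(π x μ) ≤ C

/-- The average of `h` against `π`. -/
def avg (h : ℝ → ℝ → P2 → ℝ) (π : ℝ → P2 → Measure ℝ) (x : ℝ) (μ : P2) : ℝ :=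
  ∫ y, h x y μ ∂(π x μ)

/-- `v` is a classical solution of the Poisson equation
`L_{x,μ} v(x, ·, μ) = h(x, ·, μ) - ∫ h(x, y', μ) π(dy'; x, μ)`
whose first two derivatives in `y` (and hence also `v`) grow at most polynomially in `y`. -/
def IsPoissonSol (f a h : ℝ → ℝ → P2 → ℝ) (π : ℝ → P2 → Measure ℝ) (v : ℝ → ℝ → P2 → ℝ) :
    Prop :=
  ∀ (x : ℝ) (μ : P2), ContDiff ℝ 2 (fun y => v x y μ) ∧
    (∃ (C : ℝ) (k : ℕ), ∀ y, |deriv (fun s => v x s μ) y| ≤ C * (1 + |y| ^ k) ∧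
      |deriv (deriv (fun s => v x s μ)) y| ≤ C * (1 + |y| ^ k)) ∧
    ∀ y, gen f a x μ (fun s => v x s μ) y = h x y μ - avg h π x μ

/-- `v_y`. -/
def dy (v : ℝ → ℝ → P2 → ℝ) (x y : ℝ) (μ : P2) : ℝ := deriv (fun s => v x s μ) y

/-- `v_yy`. -/
def dyy (v : ℝ → ℝ → P2 → ℝ) (x y : ℝ) (μ : P2) : ℝ := deriv (deriv (fun s => v x s μ)) y

/-- There are `0 < c₁ ≤ c₂` with `c₁ ≤ a ≤ c₂`. -/
def UniformlyElliptic (a : ℝ → ℝ → P2 → ℝ) : Prop :=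
  ∃ c₁ c₂ : ℝ, 0 < c₁ ∧ ∀ x y μ, c₁ ≤ a x y μ ∧ a x y μ ≤ c₂

/-- `f(x,y,μ) y ≤ -β y² + C` with `β > 0` and `C` independent of `(x, y, μ)`. -/
def Dissipative (f : ℝ → ℝ → P2 → ℝ) : Prop :=
  ∃ β C : ℝ, 0 < β ∧ ∀ x y μ, f x y μ * y ≤ -β * y ^ 2 + C

/-! ### The right-hand side of the transfer formula -/

/-- For `p = {p_1 < ⋯ < p_k}`, the multi-index `(k, j, (β_{p_1}, …, β_{p_k}))`. -/
def MultiIndex.sub (m : MultiIndex) (p : Finset (Fin m.n)) (j : ℕ) : MultiIndex :=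
  ⟨p.card, j, fun i => m.β (p.orderEmbOfFin rfl i)⟩

/-- For `p = {p_1 < ⋯ < p_k}`, the vector `(z_{p_1}, …, z_{p_k})`. -/
def restr {n : ℕ} (z : Fin n → ℝ) (p : Finset (Fin n)) : Fin p.card → ℝ :=
  fun i => z (p.orderEmbOfFin rfl i)

/-- The constants `C_{(p_k, j, n, l)}`: zero if `k = j = 0`, and the (positive) binomial
coefficient `l choose j` otherwise. -/
def transferCoeff (k j l : ℕ) : ℕ := if k = 0 ∧ j = 0 then 0 else l.choose j

/-- The integrand
`D^m h [z] - ∑_{p ⊆ {1,…,n}} ∑_{j ≤ l} C_{p,j} (D^{(|p|,j,β_p)} f [z_p] D^{(n-|p|,l-j,β_{p'})} v_y [z_{p'}]`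
`+ D^{(|p|,j,β_p)} a [z_p] D^{(n-|p|,l-j,β_{p'})} v_yy [z_{p'}])`, where `m = (n, l, β)` and `p'`
is the complement of `p`. -/
def transferIntegrand
    (Dh Df Da Dv₁ Dv₂ : (m : MultiIndex) → ℝ → ℝ → P2 → (Fin m.n → ℝ) → ℝ)
    (m : MultiIndex) (x y : ℝ) (μ : P2) (z : Fin m.n → ℝ) : ℝ :=
  Dh m x y μ z -
    ∑ p : Finset (Fin m.n), ∑ j ∈ Finset.range (m.l + 1),
      (transferCoeff p.card j m.l : ℝ) *
        (Df (m.sub p j) x y μ (restr z p) * Dv₁ (m.sub pᶜ (m.l - j)) x y μ (restr z pᶜ) +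
         Da (m.sub p j) x y μ (restr z p) * Dv₂ (m.sub pᶜ (m.l - j)) x y μ (restr z pᶜ))

end DerivTransfer

end

open MeasureTheory DerivTransfer

noncomputable section

namespace DerivTransfer

/-! ### One-dimensional invariant measures -/

/-! In one dimension the adjoint equation `L^* ρ = 0` can be integrated. Testing it with primitives
shows that the flux `ψ ↦ ∫ (f ψ + a ψ') dρ` is a constant multiple of `∫ ψ` (`exists_flux`). Very
wide bumps force the constant to vanish, either because `f` and `a` are `ρ`-integrable or because
the drift points inwards. An integrating factor then identifies `ρ` with a multiple of `exp (∫₀^y f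
/ a) / a` (`exists_eq_densMeasure`).

Two consequences of this formula carry part (A). First, `∫ (f W + a w) dπ = 0` whenever `W` is a
primitive of `w` and both grow polynomially (`integral_weak_eq_zero`). Second, since the densities
depend continuously on the coefficients and all moments are uniformly bounded, `π` is continuous in
`(x, μ)` in total variation with polynomial weights (`tvConv_densMeasure`). The difference formulas
are the first consequence for `W = v_y(x₂, ·, μ₂)` under `π(·; x₁, μ₁)`, combined with the Poisson
equation at `(x₂, μ₂)`.

For derivatives, let `e` be the parameter that moves and `e₀` the base point. From the integrand of
order `(n, l, 0)` subtract `f_e W + a_e w`, with `W, w` the derivatives of `v_y, v_yy` of that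
order, frozen at `e₀`. The integral against `π_e` does not change, and at `e = e₀` the new integrand
is constant in `y` by the differentiated Poisson equation. The variation of `π_e` therefore
contributes nothing to first order, and mere continuity of `π` lets the derivative fall on the
integrand (`hasFDerivAt_integral_of_tvConv`). The derivative of the frozen term cancels the
contribution that the truncation of the Leibniz sum leaves over, so the integrand of the next order
remains. The next Poisson equation follows by differentiating both sides of the previous one and
using uniqueness of derivatives; for Lions derivatives this is `HasLionsDeriv.unique`. Derivatives
in the auxiliary variables `z` do not touch `π`.

For part (B), ellipticity and dissipativity bound the explicit density by a Gaussian with constants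
independent of `(x, μ)`. This gives existence and uniform moments, and the inward drift gives
uniqueness. The Poisson equation is a linear first order equation for `v_y`, solved by an
integrating factor; the Gaussian tail keeps the solution polynomially bounded (`tail_growth`). -/

open scoped ContDiff in
/-- A `C¹` function supported in `[-R, R]` is uniformly approximated, together with its derivative,
by smooth functions supported in `[-R - 1, R + 1]`. -/
theorem exists_smooth_approx {ψ : ℝ → ℝ} (hψ : ContDiff ℝ 1 ψ) {R : ℝ}
    (hR : ∀ y, R < |y| → ψ y = 0) {δ : ℝ} (hδ : 0 < δ) :
    ∃ χ : ℝ → ℝ, ContDiff ℝ (⊤ : ℕ∞) χ ∧ (∀ y, |χ y - ψ y| ≤ δ) ∧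
      (∀ y, |deriv χ y - deriv ψ y| ≤ δ) ∧ ∀ y, R + 1 < |y| → χ y = 0 := by
  have hcs : HasCompactSupport ψ := by
    refine HasCompactSupport.intro (K := Set.Icc (-R) R) isCompact_Icc fun y hy => hR y ?_
    by_contra h
    exact hy (abs_le.1 (not_lt.1 h))
  have hdc : Continuous (deriv ψ) := hψ.continuous_deriv le_rfl
  have u1 := hcs.uniformContinuous_of_continuous hψ.continuous
  have u2 := hcs.deriv.uniformContinuous_of_continuous hdc
  obtain ⟨ε₁, he₁, h₁⟩ := Metric.uniformContinuous_iff.1 u1 δ hδ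
  obtain ⟨ε₂, he₂, h₂⟩ := Metric.uniformContinuous_iff.1 u2 δ hδ
  -- The cap `1` on the mollification radius confines the support to `[-R - 1, R + 1]`; the other
  -- two bounds are the moduli of uniform continuity of `ψ` and of its derivative.
  have hε : 0 < min 1 (min ε₁ ε₂) := by positivity
  set ε := min 1 (min ε₁ ε₂) with hεdef
  let φ : ContDiffBump (0 : ℝ) := ⟨ε / 2, ε, half_pos hε, half_lt_self hε⟩
  have hout : φ.rOut = ε := rfl
  refine ⟨_, (φ.hasCompactSupport_normed (μ := volume)).contDiff_convolution_left
    (μ := volume) (ContinuousLinearMap.lsmul ℝ ℝ) φ.contDiff_normed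
    hψ.continuous.locallyIntegrable, fun y => ?_, fun y => ?_, fun y hy => ?_⟩
  · refine φ.dist_normed_convolution_le hψ.continuous.aestronglyMeasurable fun x hx => ?_
    rw [hout, Metric.mem_ball] at hx
    exact (h₁ (hx.trans_le ((min_le_right _ _).trans (min_le_left _ _)))).le
  · have := hcs.hasDerivAt_convolution_right (ContinuousLinearMap.lsmul ℝ ℝ)
      (f₀ := φ.normed volume) (μ := volume)
      (φ.continuous_normed.locallyIntegrable) hψ y
    rw [this.deriv]
    refine φ.dist_normed_convolution_le hdc.aestronglyMeasurable fun x hx => ?_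
    rw [hout, Metric.mem_ball] at hx
    exact (h₂ (hx.trans_le ((min_le_right _ _).trans (min_le_right _ _)))).le
  · have h0 : ψ y = 0 := hR y (by linarith)
    -- Error `0` is admissible here, because `ψ` vanishes on the whole ball over which it is
    -- averaged.
    have := φ.dist_normed_convolution_le (μ := volume) (g := ψ) (x₀ := y) (ε := 0)
      hψ.continuous.aestronglyMeasurable fun x hx => by
        rw [hout, Metric.mem_ball, Real.dist_eq] at hx
        have : |y| ≤ |x| + |x - y| := by
          have := abs_sub_abs_le_abs_sub y x
          rw [abs_sub_comm] at this; linarith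
        rw [h0, hR x (by linarith [min_le_left (1 : ℝ) (min ε₁ ε₂)]), dist_self]
    rw [h0] at this
    exact dist_le_zero.1 this

/-- A function vanishing outside `[-R, R]` has compact support. -/
theorem hasCompactSupport_of_abs {g : ℝ → ℝ} {R : ℝ} (hR : ∀ y, R < |y| → g y = 0) :
    HasCompactSupport g := by
  refine HasCompactSupport.intro (K := Set.Icc (-R) R) isCompact_Icc fun y hy => hR y ?_
  by_contra h
  exact hy (abs_le.1 (not_lt.1 h))

theorem exists_abs_bound {g : ℝ → ℝ} (hg : HasCompactSupport g) :
    ∃ R : ℝ, 0 < R ∧ ∀ y, R < |y| → g y = 0 := by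
  obtain ⟨R, h0, hR⟩ := hg.isCompact.isBounded.exists_pos_norm_le
  refine ⟨R, h0, fun y hy => ?_⟩
  by_contra h
  exact absurd (hR y (subset_tsupport _ h)) (not_le.2 hy)

theorem deriv_eq_zero_of_abs {g : ℝ → ℝ} {R : ℝ} (hR : ∀ y, R < |y| → g y = 0) {y : ℝ}
    (hy : R < |y|) : deriv g y = 0 := by
  have : g =ᶠ[𝓝 y] fun _ => 0 := by
    filter_upwards [(continuous_abs.isOpen_preimage _ isOpen_Ioi).mem_nhds hy] with z hz
    exact hR z hz
  rw [this.deriv_eq, deriv_const]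

/-! ### Constancy of the flux and the explicit invariant density -/

section OneDim

variable {f a : ℝ → ℝ} {ρ : Measure ℝ}

/-- The primitive of a smooth compactly supported function of zero mean is compactly supported. -/
theorem exists_primitive {g : ℝ → ℝ} {n : ℕ∞} (hg : ContDiff ℝ n g) {R : ℝ} (h0 : 0 ≤ R)
    (hR : ∀ y, R < |y| → g y = 0) (hint : ∫ y, g y = 0) :
    ∃ φ : ℝ → ℝ, ContDiff ℝ (n + 1) φ ∧ (∀ y, R < |y| → φ y = 0) ∧ ∀ y, deriv φ y = g y := by
  have hd : ∀ y, HasDerivAt (fun y => ∫ s in (-R)..y, g s) (g y) y := fun y =>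
    (hg.continuous.integral_hasStrictDerivAt (-R) y).hasDerivAt
  have hgi : Integrable g := hg.continuous.integrable_of_hasCompactSupport
    (hasCompactSupport_of_abs hR)
  refine ⟨fun y => ∫ s in (-R)..y, g s, ?_, fun y hy => ?_, fun y => (hd y).deriv⟩
  · rw [contDiff_succ_iff_deriv]
    refine ⟨fun y => (hd y).differentiableAt, by simp, ?_⟩
    rwa [show deriv (fun y => ∫ s in (-R)..y, g s) = g from funext fun y => (hd y).deriv]
  · show ∫ s in (-R)..y, g s = 0
    rcases lt_abs.1 hy with h | h
    · rw [intervalIntegral.integral_of_le (by linarith),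
        setIntegral_eq_integral_of_ae_compl_eq_zero, hint]
      filter_upwards [Measure.ae_ne volume (-R)] with s h1 hs
      refine hR s ?_
      rw [Set.mem_Ioc, not_and_or, not_lt, not_le] at hs
      rcases hs with h2 | h2
      · exact lt_abs.2 (Or.inr (by linarith [lt_of_le_of_ne h2 h1]))
      · exact lt_abs.2 (Or.inl (by linarith))
    · rw [intervalIntegral.integral_of_ge (by linarith), neg_eq_zero]
      refine setIntegral_eq_zero_of_ae_eq_zero ?_
      filter_upwards [Measure.ae_ne volume (-R)] with s h1 hs
      exact hR s (lt_abs.2 (Or.inr (by linarith [lt_of_le_of_ne hs.2 h1])))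

/-- The flux of an invariant measure is constant. -/
theorem exists_flux [IsProbabilityMeasure ρ] (hf : Continuous f) (ha : Continuous a)
    (hinv : ∀ φ : ℝ → ℝ, ContDiff ℝ (⊤ : ℕ∞) φ → HasCompactSupport φ →
      ∫ y, (f y * deriv φ y + a y * deriv (deriv φ) y) ∂ρ = 0) :
    ∃ c : ℝ, ∀ ψ : ℝ → ℝ, ContDiff ℝ (⊤ : ℕ∞) ψ → HasCompactSupport ψ →
      ∫ y, (f y * ψ y + a y * deriv ψ y) ∂ρ = c * ∫ y, ψ y := by
  let b : ContDiffBump (0 : ℝ) := ⟨1, 2, one_pos, one_lt_two⟩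
  set η := b.normed volume with hη
  have hηs : ContDiff ℝ (⊤ : ℕ∞) η := b.contDiff_normed
  have hηc : HasCompactSupport η := b.hasCompactSupport_normed
  have hη1 : ∫ y, η y = 1 := b.integral_normed
  refine ⟨∫ y, (f y * η y + a y * deriv η y) ∂ρ, fun ψ hψ hc => ?_⟩
  have hint : ∀ χ : ℝ → ℝ, ContDiff ℝ (⊤ : ℕ∞) χ → HasCompactSupport χ →
      Integrable (fun y => f y * χ y + a y * deriv χ y) ρ := by
    intro χ hχ hχc
    have : Continuous (deriv χ) := hχ.continuous_deriv (by simp)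
    have := hχ.continuous
    exact (Continuous.integrable_of_hasCompactSupport (by fun_prop) hχc.mul_left).add
      (Continuous.integrable_of_hasCompactSupport (by fun_prop) hχc.deriv.mul_left)
  -- Removing the mass of `ψ` by a multiple of the fixed bump `η` leaves the derivative of an
  -- admissible test function, which the flux annihilates.
  set g : ℝ → ℝ := fun y => ψ y - (∫ y, ψ y) * η y with hg
  have hgs : ContDiff ℝ (⊤ : ℕ∞) g := hψ.sub (contDiff_const.mul hηs)
  have hgc : HasCompactSupport g := hc.sub hηc.mul_left
  obtain ⟨R, h0, hR⟩ := exists_abs_bound hgc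
  obtain ⟨φ, h1, h2, h3⟩ := exists_primitive hgs h0.le hR (by
    rw [hg, integral_sub, integral_const_mul, hη1, mul_one, sub_self]
    · exact hψ.continuous.integrable_of_hasCompactSupport hc
    · exact (hηs.continuous.integrable_of_hasCompactSupport hηc).const_mul _)
  have key := hinv φ (by simpa using h1) (hasCompactSupport_of_abs h2)
  rw [funext h3] at key
  have hdg : ∀ y, deriv g y = deriv ψ y - (∫ y, ψ y) * deriv η y := fun y => by
    have := (hψ.differentiable (by simp) y).hasDerivAt.sub
      ((hηs.differentiable (by simp) y).hasDerivAt.const_mul (∫ y, ψ y))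
    exact this.deriv
  have e : (fun y => f y * g y + a y * deriv g y) = fun y => (f y * ψ y + a y * deriv ψ y) -
      (∫ y, ψ y) * (f y * η y + a y * deriv η y) := by
    ext y; rw [hdg, hg]; ring
  rw [e, integral_sub (hint ψ hψ hc) ((hint η hηs hηc).const_mul _), integral_const_mul] at key
  linarith

/-- Vanishing of the flux extends from smooth to `C¹` test functions. -/
theorem weak_eq_of_contDiff_one [IsProbabilityMeasure ρ] (hf : Continuous f) (ha : Continuous a)
    (hinv : ∀ ψ : ℝ → ℝ, ContDiff ℝ (⊤ : ℕ∞) ψ → HasCompactSupport ψ →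
      ∫ y, (f y * ψ y + a y * deriv ψ y) ∂ρ = 0)
    {ψ : ℝ → ℝ} (hψ : ContDiff ℝ 1 ψ) (hc : HasCompactSupport ψ) :
    ∫ y, (f y * ψ y + a y * deriv ψ y) ∂ρ = 0 := by
  obtain ⟨R, h0, hR⟩ := exists_abs_bound hc
  obtain ⟨B, hB⟩ := (isCompact_Icc (a := -(R + 1)) (b := R + 1)).exists_bound_of_continuousOn
    (f := fun y => |f y| + |a y|) (by fun_prop)
  have hB0 : 0 ≤ B := (norm_nonneg _).trans (hB 0 ⟨by linarith, by linarith⟩)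
  have hint : ∀ χ : ℝ → ℝ, ContDiff ℝ 1 χ → HasCompactSupport χ →
      Integrable (fun y => f y * χ y + a y * deriv χ y) ρ := by
    intro χ hχ hχc
    have : Continuous (deriv χ) := hχ.continuous_deriv le_rfl
    have := hχ.continuous
    exact (Continuous.integrable_of_hasCompactSupport (by fun_prop) hχc.mul_left).add
      (Continuous.integrable_of_hasCompactSupport (by fun_prop) hχc.deriv.mul_left)
  have key : ∀ δ > 0, |∫ y, (f y * ψ y + a y * deriv ψ y) ∂ρ| ≤ B * δ := by
    intro δ hδ
    obtain ⟨χ, c1, c2, c3, c4⟩ := exists_smooth_approx hψ hR hδ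
    have hχc := hasCompactSupport_of_abs c4
    have e := hinv χ c1 hχc
    have e2 : ∫ y, (f y * ψ y + a y * deriv ψ y) ∂ρ =
        ∫ y, ((f y * ψ y + a y * deriv ψ y) - (f y * χ y + a y * deriv χ y)) ∂ρ := by
      rw [integral_sub (hint ψ hψ hc) (hint χ (c1.of_le (by simp)) hχc), e, sub_zero]
    rw [e2, ← Real.norm_eq_abs]
    refine (norm_integral_le_of_norm_le_const (C := B * δ) (ae_of_all _ fun y => ?_)).trans
      (by simp)
    rw [Real.norm_eq_abs]
    rcases lt_or_ge (R + 1) |y| with hy | hy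
    · rw [c4 y hy, deriv_eq_zero_of_abs c4 hy, hR y (by linarith),
        deriv_eq_zero_of_abs hR (by linarith)]
      simp; positivity
    · have hb := hB y (abs_le.1 hy)
      rw [Real.norm_of_nonneg (by positivity)] at hb
      calc |(f y * ψ y + a y * deriv ψ y) - (f y * χ y + a y * deriv χ y)|
          = |f y * -(χ y - ψ y) + a y * -(deriv χ y - deriv ψ y)| := by ring_nf
        _ ≤ |f y| * |χ y - ψ y| + |a y| * |deriv χ y - deriv ψ y| := by
          refine (abs_add_le _ _).trans ?_
          rw [abs_mul, abs_mul, abs_neg, abs_neg]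
        _ ≤ |f y| * δ + |a y| * δ := by gcongr <;> [exact c2 y; exact c3 y]
        _ ≤ B * δ := by rw [← add_mul]; gcongr
  have : |∫ y, (f y * ψ y + a y * deriv ψ y) ∂ρ| ≤ 0 := by
    refine le_of_forall_pos_le_add fun ε hε => ?_
    refine (key (ε / (B + 1)) (by positivity)).trans ?_
    rw [zero_add, mul_div_assoc', div_le_iff₀ (by positivity)]
    nlinarith
  exact abs_nonpos_iff.1 this

/-- The potential `∫₀^y f / a`. -/
def pot (f a : ℝ → ℝ) (y : ℝ) : ℝ := ∫ s in (0 : ℝ)..y, f s / a s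

/-- The unnormalised invariant density `exp (∫₀^y f / a) / a`. -/
def dens (f a : ℝ → ℝ) (y : ℝ) : ℝ := Real.exp (pot f a y) / a y

theorem hasDerivAt_pot (hf : Continuous f) (ha : Continuous a) (hpos : ∀ y, 0 < a y) (y : ℝ) :
    HasDerivAt (pot f a) (f y / a y) y :=
  ((hf.div₀ ha fun y => (hpos y).ne').integral_hasStrictDerivAt 0 y).hasDerivAt

theorem continuous_pot (hf : Continuous f) (ha : Continuous a) (hpos : ∀ y, 0 < a y) :
    Continuous (pot f a) :=
  continuous_iff_continuousAt.2 fun y => (hasDerivAt_pot hf ha hpos y).continuousAt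

theorem hasDerivAt_exp_pot (hf : Continuous f) (ha : Continuous a) (hpos : ∀ y, 0 < a y) (y : ℝ) :
    HasDerivAt (fun y => Real.exp (pot f a y)) (f y * dens f a y) y := by
  convert (hasDerivAt_pot hf ha hpos y).exp using 1
  rw [dens]; ring

theorem continuous_dens (hf : Continuous f) (ha : Continuous a) (hpos : ∀ y, 0 < a y) :
    Continuous (dens f a) :=
  (Real.continuous_exp.comp (continuous_pot hf ha hpos)).div₀ ha fun y => (hpos y).ne'

theorem dens_pos (hpos : ∀ y, 0 < a y) (y : ℝ) : 0 < dens f a y :=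
  div_pos (Real.exp_pos _) (hpos y)

theorem mul_dens (hpos : ∀ y, 0 < a y) (y : ℝ) : a y * dens f a y = Real.exp (pot f a y) :=
  mul_div_cancel₀ _ (hpos y).ne'

/-- An invariant measure without flux annihilates every test function that `dens f a`
annihilates. -/
theorem integral_eq_zero_of_dens [IsProbabilityMeasure ρ] (hf : Continuous f) (ha : Continuous a)
    (hpos : ∀ y, 0 < a y)
    (hinv : ∀ ψ : ℝ → ℝ, ContDiff ℝ (⊤ : ℕ∞) ψ → HasCompactSupport ψ →
      ∫ y, (f y * ψ y + a y * deriv ψ y) ∂ρ = 0)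
    {g : ℝ → ℝ} (hg : Continuous g) (hc : HasCompactSupport g)
    (h0 : ∫ y, g y * dens f a y = 0) : ∫ y, g y ∂ρ = 0 := by
  obtain ⟨R, hR0, hR⟩ := exists_abs_bound hc
  have hq := continuous_dens hf ha hpos
  obtain ⟨φ, h1, h2, h3⟩ := exists_primitive (n := 0) (g := fun y => g y * dens f a y)
    (contDiff_zero.2 (hg.mul hq)) hR0.le (fun y hy => by simp [hR y hy]) h0
  have hφd : ∀ y, HasDerivAt φ (g y * dens f a y) y := fun y => by
    rw [← h3]; exact (h1.differentiable (by simp) y).hasDerivAt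
  -- The integrating factor solves `f ψ + a ψ' = g`. The support stays compact since `φ` is the
  -- primitive of a function of zero mean. As `f` and `a` are only continuous, `ψ` is no better than
  -- `C¹`.
  set ψ : ℝ → ℝ := fun y => Real.exp (-pot f a y) * φ y with hψ
  have hd : ∀ y, HasDerivAt ψ ((g y - f y * ψ y) / a y) y := fun y => by
    refine HasDerivAt.congr_deriv (f := ψ)
      (((hasDerivAt_pot hf ha hpos y).neg.exp).mul (hφd y)) ?_
    simp only [dens, hψ, Pi.neg_apply]
    have := (hpos y).ne'
    have e : Real.exp (-pot f a y) * Real.exp (pot f a y) = 1 := by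
      rw [← Real.exp_add]; simp
    field_simp
    linear_combination (g y) * e
  have hψc : Continuous ψ := continuous_iff_continuousAt.2 fun y => (hd y).continuousAt
  have hψ1 : ContDiff ℝ 1 ψ := by
    rw [show (1 : WithTop ℕ∞) = 0 + 1 by simp, contDiff_succ_iff_deriv]
    refine ⟨fun y => (hd y).differentiableAt, by simp, contDiff_zero.2 ?_⟩
    rw [funext fun y => (hd y).deriv]
    exact (hg.sub (hf.mul hψc)).div₀ ha fun y => (hpos y).ne'
  have hψs : HasCompactSupport ψ :=
    hasCompactSupport_of_abs (R := R) fun y hy => by simp [hψ, h2 y hy]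
  have hw := weak_eq_of_contDiff_one hf ha hinv hψ1 hψs
  rw [← hw]
  congr 1; ext y
  rw [(hd y).deriv]
  have := (hpos y).ne'
  field_simp; ring

/-- The measure with density `c * exp (∫₀^y f / a) / a`. -/
def densMeasure (f a : ℝ → ℝ) (c : ℝ) : Measure ℝ :=
  volume.withDensity fun y => ENNReal.ofReal (c * dens f a y)

theorem integral_densMeasure (hf : Continuous f) (ha : Continuous a) (hpos : ∀ y, 0 < a y)
    {c : ℝ} (hc : 0 ≤ c) (g : ℝ → ℝ) :
    ∫ y, g y ∂(densMeasure f a c) = ∫ y, g y * (c * dens f a y) := by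
  rw [densMeasure, integral_withDensity_eq_integral_toReal_smul
    (by have := continuous_dens hf ha hpos; fun_prop) (by simp)]
  congr 1; ext y
  rw [ENNReal.toReal_ofReal (mul_nonneg hc (dens_pos hpos y).le), smul_eq_mul, mul_comm]

theorem integrable_densMeasure (hf : Continuous f) (ha : Continuous a) (hpos : ∀ y, 0 < a y)
    {c : ℝ} (hc : 0 ≤ c) (g : ℝ → ℝ) :
    Integrable g (densMeasure f a c) ↔ Integrable fun y => g y * (c * dens f a y) := by
  rw [densMeasure, integrable_withDensity_iff
    (by have := continuous_dens hf ha hpos; fun_prop) (by simp)]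
  refine integrable_congr (ae_of_all _ fun y => ?_)
  dsimp only
  rw [ENNReal.toReal_ofReal (mul_nonneg hc (dens_pos hpos y).le)]

/-- An invariant measure without flux has the explicit density. -/
theorem exists_eq_densMeasure [IsProbabilityMeasure ρ] (hf : Continuous f) (ha : Continuous a)
    (hpos : ∀ y, 0 < a y)
    (hinv : ∀ ψ : ℝ → ℝ, ContDiff ℝ (⊤ : ℕ∞) ψ → HasCompactSupport ψ →
      ∫ y, (f y * ψ y + a y * deriv ψ y) ∂ρ = 0) :
    ∃ c : ℝ, 0 < c ∧ ρ = densMeasure f a c ∧ Integrable (dens f a) ∧ c * ∫ y, dens f a y = 1 := by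
  have hq := continuous_dens hf ha hpos
  let b : ContDiffBump (0 : ℝ) := ⟨1, 2, one_pos, one_lt_two⟩
  have hbc : Continuous b := b.continuous
  have hbs : HasCompactSupport b := b.hasCompactSupport
  have hI : 0 < ∫ y, b y * dens f a y := by
    refine Continuous.integral_pos_of_hasCompactSupport_nonneg_nonzero (x := 0) (by fun_prop)
      hbs.mul_right (fun y => mul_nonneg b.nonneg (dens_pos hpos y).le) ?_
    have : b 0 = 1 := b.one_of_mem_closedBall (by simp [b])
    rw [this, one_mul]; exact (dens_pos hpos 0).ne'
  -- The constant is read off from one bump; any other test function differs from a multiple of that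
  -- bump by a function that `dens f a` annihilates.
  set c : ℝ := (∫ y, b y ∂ρ) / ∫ y, b y * dens f a y with hcdef
  have hc0 : 0 ≤ c := div_nonneg (integral_nonneg fun y => b.nonneg) hI.le
  have hall : ∀ g : ℝ → ℝ, Continuous g → HasCompactSupport g →
      ∫ y, g y ∂ρ = c * ∫ y, g y * dens f a y := by
    intro g hg hgc
    have i1 : ∀ g : ℝ → ℝ, Continuous g → HasCompactSupport g →
        Integrable fun y => g y * dens f a y := fun g hg hgc =>
      Continuous.integrable_of_hasCompactSupport (by fun_prop) hgc.mul_right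
    have := integral_eq_zero_of_dens hf ha hpos hinv
      (g := fun y => (∫ s, b s * dens f a s) * g y - (∫ s, g s * dens f a s) * b y)
      (by fun_prop) (hgc.mul_left.sub hbs.mul_left) (by
        simp_rw [sub_mul, mul_assoc]
        rw [integral_sub ((i1 g hg hgc).const_mul _) ((i1 b hbc hbs).const_mul _),
          integral_const_mul, integral_const_mul]; ring)
    rw [integral_sub ((hg.integrable_of_hasCompactSupport hgc).const_mul _)
      ((hbc.integrable_of_hasCompactSupport hbs).const_mul _),
      integral_const_mul, integral_const_mul] at this
    rw [hcdef, div_mul_eq_mul_div, eq_div_iff hI.ne']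
    linarith
  have hρ : ρ = densMeasure f a c := by
    have : IsLocallyFiniteMeasure (densMeasure f a c) := by
      refine IsLocallyFiniteMeasure.withDensity_ofReal (by fun_prop)
    refine Measure.ext_of_integral_eq_on_compactlySupported fun g => ?_
    rw [integral_densMeasure hf ha hpos hc0, hall g g.continuous g.hasCompactSupport,
      ← integral_const_mul]
    congr 1; ext y; ring
  -- Integrability of the density is an output: it expresses that `ρ` has finite mass.
  have h1 : Integrable fun y => (1 : ℝ) * (c * dens f a y) := by
    rw [← integrable_densMeasure hf ha hpos hc0, ← hρ]; exact integrable_const _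
  have h2 : ∫ y, (1 : ℝ) * (c * dens f a y) = 1 := by
    rw [← integral_densMeasure hf ha hpos hc0, ← hρ]; simp
  have hcp : 0 < c := by
    refine lt_of_le_of_ne hc0 fun h => ?_
    simp [← h] at h2
  simp_rw [one_mul] at h1 h2
  rw [integral_const_mul] at h2
  exact ⟨c, hcp, hρ, (integrable_const_mul_iff (isUnit_iff_ne_zero.2 hcp.ne') _).1 h1, h2⟩

end OneDim

/-- Translated and dilated smooth bumps. -/
theorem exists_bump : ∃ I K : ℝ, 0 < I ∧ 0 ≤ K ∧ ∀ m R : ℝ, 0 < R → ∃ ψ : ℝ → ℝ,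
    ContDiff ℝ (⊤ : ℕ∞) ψ ∧ HasCompactSupport ψ ∧ (∀ y, 0 ≤ ψ y) ∧ (∀ y, ψ y ≤ 1) ∧
    (∀ y, |deriv ψ y| ≤ K / R) ∧ ∫ y, ψ y = R * I ∧ ∀ y, 2 * R ≤ |y - m| → ψ y = 0 := by
  let b : ContDiffBump (0 : ℝ) := ⟨1, 2, one_pos, one_lt_two⟩
  have hb : ContDiff ℝ (⊤ : ℕ∞) b := b.contDiff
  have hbs : HasCompactSupport b := b.hasCompactSupport
  obtain ⟨K, hK⟩ := hbs.deriv.exists_bound_of_continuous (hb.continuous_deriv (by simp))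
  refine ⟨∫ y, b y, K, b.integral_pos, (norm_nonneg _).trans (hK 0), fun m R hR => ?_⟩
  have hz : ∀ y, 2 * R ≤ |y - m| → b ((y - m) / R) = 0 := fun y hy => by
    refine b.zero_of_le_dist ?_
    rw [dist_zero_right, Real.norm_eq_abs, abs_div, abs_of_pos hR, le_div_iff₀ hR]
    exact hy
  refine ⟨fun y => b ((y - m) / R), hb.comp (by fun_prop), ?_, fun y => b.nonneg,
    fun y => b.le_one, fun y => ?_, ?_, hz⟩
  · refine hasCompactSupport_of_abs (R := 2 * R + |m|) fun y hy => hz y ?_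
    linarith [abs_sub_abs_le_abs_sub y m]
  · have h1 : HasDerivAt (fun y => (y - m) / R) (1 / R) y :=
      ((hasDerivAt_id y).sub_const m).div_const R
    have := ((hb.differentiable (by simp) ((y - m) / R)).hasDerivAt.comp y h1).deriv
    rw [Function.comp_def] at this
    rw [this, abs_mul, abs_of_pos (one_div_pos.2 hR), mul_one_div]
    gcongr
    exact hK _
  · rw [integral_sub_right_eq_self (fun y => b (y / R)) m, Measure.integral_comp_div,
      abs_of_pos hR, smul_eq_mul]

/-! ### Vanishing of the flux, and test functions of polynomial growth -/

section OneDim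

variable {f a : ℝ → ℝ} {ρ : Measure ℝ}

/-- A bump of width `R` has mass proportional to `R`; a flux constant whose action on all wide bumps
is bounded above can therefore not be positive. -/
theorem le_zero_of_forall_mul_le {c I B : ℝ} (hI : 0 < I) (h : ∀ R ≥ (1 : ℝ), c * (R * I) ≤ B) :
    c ≤ 0 := by
  by_contra hc
  push Not at hc
  have := h (max 1 ((B + 1) / (c * I))) (le_max_left _ _)
  have h2 : (B + 1) / (c * I) ≤ max 1 ((B + 1) / (c * I)) := le_max_right _ _
  rw [div_le_iff₀ (by positivity)] at h2
  linarith

theorem integrable_flux [IsProbabilityMeasure ρ] (hf : Continuous f) (ha : Continuous a)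
    {ψ : ℝ → ℝ} (hψ : ContDiff ℝ (⊤ : ℕ∞) ψ) (hc : HasCompactSupport ψ) :
    Integrable (fun y => f y * ψ y) ρ ∧ Integrable (fun y => a y * deriv ψ y) ρ := by
  have : Continuous (deriv ψ) := hψ.continuous_deriv (by simp)
  have := hψ.continuous
  exact ⟨Continuous.integrable_of_hasCompactSupport (by fun_prop) hc.mul_left,
    Continuous.integrable_of_hasCompactSupport (by fun_prop) hc.deriv.mul_left⟩

/-- The flux vanishes if the coefficients are integrable. -/
theorem flux_eq_zero_of_integrable [IsProbabilityMeasure ρ] (hf : Continuous f) (ha : Continuous a)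
    (hfi : Integrable f ρ) (hai : Integrable a ρ)
    (hinv : ∀ φ : ℝ → ℝ, ContDiff ℝ (⊤ : ℕ∞) φ → HasCompactSupport φ →
      ∫ y, (f y * deriv φ y + a y * deriv (deriv φ) y) ∂ρ = 0)
    {ψ : ℝ → ℝ} (hψ : ContDiff ℝ (⊤ : ℕ∞) ψ) (hψc : HasCompactSupport ψ) :
    ∫ y, (f y * ψ y + a y * deriv ψ y) ∂ρ = 0 := by
  obtain ⟨c, hc⟩ := exists_flux hf ha hinv
  obtain ⟨I, K, hI, hK, hb⟩ := exists_bump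
  -- Bumps of width `R ≥ 1` are bounded by `1` with derivative at most `K`, so integrability of `f`
  -- and `a` bounds the left side uniformly in `R`.
  have key : ∀ R ≥ (1 : ℝ), |c| * (R * I) ≤ ∫ y, (|f y| + |a y| * K) ∂ρ := by
    intro R hR
    obtain ⟨χ, h1, h2, h3, h4, h5, h6, -⟩ := hb 0 R (by linarith)
    have := hc χ h1 h2
    rw [h6] at this
    rw [← abs_of_pos (show 0 < R * I by positivity), ← abs_mul, ← this, ← Real.norm_eq_abs]
    refine norm_integral_le_of_norm_le (hfi.abs.add (hai.abs.mul_const K))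
      (ae_of_all _ fun y => ?_)
    refine (norm_add_le _ _).trans (add_le_add ?_ ?_)
    · rw [norm_mul, Real.norm_eq_abs, Real.norm_of_nonneg (h3 y)]
      exact mul_le_of_le_one_right (abs_nonneg _) (h4 y)
    · rw [norm_mul, Real.norm_eq_abs, Real.norm_eq_abs]
      exact mul_le_mul_of_nonneg_left ((h5 y).trans (div_le_self hK hR)) (abs_nonneg _)
  have : c = 0 := abs_nonpos_iff.1 (le_zero_of_forall_mul_le hI key)
  rw [hc ψ hψ hψc, this, zero_mul]

/-- The flux vanishes if the drift points inwards and the diffusivity is bounded. -/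
theorem flux_eq_zero_of_inward [IsProbabilityMeasure ρ] (hf : Continuous f) (ha : Continuous a)
    {A R₀ : ℝ} (haA : ∀ y, |a y| ≤ A) (hright : ∀ y, R₀ ≤ y → f y ≤ 0)
    (hleft : ∀ y, y ≤ -R₀ → 0 ≤ f y)
    (hinv : ∀ φ : ℝ → ℝ, ContDiff ℝ (⊤ : ℕ∞) φ → HasCompactSupport φ →
      ∫ y, (f y * deriv φ y + a y * deriv (deriv φ) y) ∂ρ = 0)
    {ψ : ℝ → ℝ} (hψ : ContDiff ℝ (⊤ : ℕ∞) ψ) (hψc : HasCompactSupport ψ) :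
    ∫ y, (f y * ψ y + a y * deriv ψ y) ∂ρ = 0 := by
  obtain ⟨c, hc⟩ := exists_flux hf ha hinv
  obtain ⟨I, K, hI, hK, hb⟩ := exists_bump
  have hA : 0 ≤ A := (abs_nonneg _).trans (haA 0)
  have hsnd : ∀ R ≥ (1 : ℝ), ∀ χ : ℝ → ℝ, (∀ y, |deriv χ y| ≤ K / R) →
      |∫ y, a y * deriv χ y ∂ρ| ≤ A * K := by
    intro R hR χ hχ
    rw [← Real.norm_eq_abs]
    refine (norm_integral_le_of_norm_le_const (C := A * K) (ae_of_all _ fun y => ?_)).trans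
      (by simp)
    rw [norm_mul]
    exact mul_le_mul (haA y) ((hχ y).trans (div_le_self hK hR)) (norm_nonneg _) hA
  have hle : c ≤ 0 := by
    refine le_zero_of_forall_mul_le (B := A * K) hI fun R hR => ?_
    -- The bump sits entirely to the right of `R₀`, where the drift is nonpositive. The drift term
    -- then has a sign and need not be integrable; each half-line yields one of the two inequalities
    -- for `c`.
    obtain ⟨χ, h1, h2, h3, h4, h5, h6, h7⟩ := hb (2 * R + R₀) R (by linarith)
    obtain ⟨i1, i2⟩ := integrable_flux (ρ := ρ) hf ha h1 h2
    rw [← h6, ← hc χ h1 h2, integral_add i1 i2]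
    have : ∫ y, f y * χ y ∂ρ ≤ 0 := integral_nonpos fun y => by
      rcases le_or_gt R₀ y with hy | hy
      · exact mul_nonpos_of_nonpos_of_nonneg (hright y hy) (h3 y)
      · rw [h7 y (le_abs.2 (Or.inr (by linarith))), mul_zero, Pi.zero_apply]
    linarith [le_of_abs_le (hsnd R hR χ h5)]
  have hge : -c ≤ 0 := by
    refine le_zero_of_forall_mul_le (B := A * K) hI fun R hR => ?_
    obtain ⟨χ, h1, h2, h3, h4, h5, h6, h7⟩ := hb (-(2 * R + R₀)) R (by linarith)
    obtain ⟨i1, i2⟩ := integrable_flux (ρ := ρ) hf ha h1 h2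
    rw [← h6, neg_mul, ← hc χ h1 h2, integral_add i1 i2]
    have : 0 ≤ ∫ y, f y * χ y ∂ρ := integral_nonneg fun y => by
      rcases le_or_gt y (-R₀) with hy | hy
      · exact mul_nonneg (hleft y hy) (h3 y)
      · rw [h7 y (le_abs.2 (Or.inl (by linarith))), mul_zero, Pi.zero_apply]
    linarith [neg_le_of_abs_le (hsnd R hR χ h5)]
  rw [hc ψ hψ hψc, show c = 0 by linarith, zero_mul]

/-- The adjoint equation `L^* ρ = 0` tested with a function `W` that is only absolutely
continuous. -/
theorem integral_weak_eq_zero (hf : Continuous f) (ha : Continuous a) (hpos : ∀ y, 0 < a y)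
    {c : ℝ} (hc : 0 < c) {W w : ℝ → ℝ}
    (hwi : ∀ u v : ℝ, IntervalIntegrable w volume u v)
    (hW : ∀ y, W y = W 0 + ∫ s in (0 : ℝ)..y, w s)
    (hi : Integrable (fun y => f y * W y + a y * w y) (densMeasure f a c))
    (hi' : Integrable (fun y => a y * W y) (densMeasure f a c)) :
    ∫ y, (f y * W y + a y * w y) ∂(densMeasure f a c) = 0 := by
  set E : ℝ → ℝ := fun y => Real.exp (pot f a y) with hE
  have hEd := hasDerivAt_exp_pot hf ha hpos
  have hE1 : ContDiff ℝ 1 E := by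
    rw [show (1 : WithTop ℕ∞) = 0 + 1 by simp, contDiff_succ_iff_deriv]
    refine ⟨fun y => (hEd y).differentiableAt, by simp, contDiff_zero.2 ?_⟩
    rw [funext fun y => (hEd y).deriv]
    exact hf.mul (continuous_dens hf ha hpos)
  rw [integrable_densMeasure hf ha hpos hc.le] at hi hi'
  rw [integral_densMeasure hf ha hpos hc.le]
  -- Since `E' = f * dens` and `a * dens = E`, the integrand is `c (E W)'` almost everywhere, and `E
  -- W` is absolutely continuous.
  have hparts : ∀ R : ℝ, ∫ y in (-R)..R, (f y * W y + a y * w y) * (c * dens f a y) =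
      c * (E R * W R) - c * (E (-R) * W (-R)) := by
    intro R
    have acW : AbsolutelyContinuousOnInterval W (-R) R := by
      have := (hwi (-R) R).absolutelyContinuousOnInterval_intervalIntegral
        (c := -R) (by simp)
      have e : W = (fun y => W (-R) * 1 + 0) + fun x => ∫ s in (-R)..x, w s := by
        ext y
        simp only [Pi.add_apply, mul_one, add_zero]
        rw [hW y, hW (-R), ← intervalIntegral.integral_add_adjacent_intervals (hwi 0 (-R))
          (hwi (-R) y)]
        ring
      rw [e]
      exact AbsolutelyContinuousOnInterval.add
        (contDiff_const.contDiffOn.absolutelyContinuousOnInterval) this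
    have acE : AbsolutelyContinuousOnInterval E (-R) R :=
      hE1.contDiffOn.absolutelyContinuousOnInterval
    rw [← mul_sub, ← acE.integral_deriv_mul_eq_sub acW, ← intervalIntegral.integral_const_mul]
    refine intervalIntegral.integral_congr_ae ?_
    filter_upwards [(hwi (-R) R).ae_hasDerivAt_integral] with y hy hyR
    have h1 := hy (Set.uIoc_subset_uIcc hyR) (-R) (by simp)
    have h2 : HasDerivAt W (w y) y := by
      have e : W = fun x => W (-R) + ∫ s in (-R)..x, w s := by
        ext y
        rw [hW y, hW (-R), ← intervalIntegral.integral_add_adjacent_intervals (hwi 0 (-R))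
          (hwi (-R) y)]
        ring
      rw [e]; exact h1.const_add _
    rw [h2.deriv, (hEd y).deriv, hE]
    simp only
    rw [← mul_dens hpos]
    ring
  have hBi : Integrable fun y => c * (E y * W y) := by
    refine hi'.congr (ae_of_all _ fun y => ?_)
    simp only [hE]
    rw [← mul_dens hpos]; ring
  have hlim : Tendsto (fun R : ℝ => c * (E R * W R) - c * (E (-R) * W (-R))) atTop
      (𝓝 (∫ y, (f y * W y + a y * w y) * (c * dens f a y))) := by
    simp_rw [← hparts]
    exact intervalIntegral_tendsto_integral hi tendsto_neg_atTop_atBot tendsto_id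
  -- The boundary term is integrable as a function of `R` and has a limit at infinity, so the limit
  -- is zero. No pointwise decay of the density is needed.
  refine IntegrableAtFilter.eq_zero_of_tendsto (μ := volume)
    ((hBi.sub hBi.comp_neg).integrableAtFilter atTop) (fun s hs => ?_) hlim
  obtain ⟨b, hb⟩ := mem_atTop_sets.1 hs
  exact top_unique ((Real.volume_Ici (a := b)).symm.le.trans (measure_mono hb))

end OneDim

/-! ### Convergence in weighted total variation -/

/-- Convergence of measures in total variation, with all polynomial weights. -/
def TVConv {ι : Type*} (l : Filter ι) (ρ : ι → Measure ℝ) (ρ₀ : Measure ℝ) : Prop :=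
  ∀ k : ℕ, ∃ τ : ι → ℝ, Tendsto τ l (𝓝 0) ∧ ∀ i, ∀ G : ℝ → ℝ, Measurable G →
    (∀ y, |G y| ≤ 1 + |y| ^ k) → |∫ y, G y ∂(ρ i) - ∫ y, G y ∂ρ₀| ≤ τ i

theorem TVConv.comp {ι κ : Type*} {l : Filter ι} {l' : Filter κ} {ρ : ι → Measure ℝ}
    {ρ₀ : Measure ℝ} (h : TVConv l ρ ρ₀) {u : κ → ι} (hu : Tendsto u l' l) :
    TVConv l' (fun j => ρ (u j)) ρ₀ := fun k => by
  obtain ⟨τ, h1, h2⟩ := h k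
  exact ⟨fun j => τ (u j), h1.comp hu, fun j => h2 (u j)⟩

theorem TVConv.const {ι : Type*} (l : Filter ι) (ρ : Measure ℝ) : TVConv l (fun _ => ρ) ρ :=
  fun _ => ⟨fun _ => 0, tendsto_const_nhds, fun _ _ _ _ => by simp⟩

theorem TVConv.exists_bound {ι : Type*} {l : Filter ι} {ρ : ι → Measure ℝ} {ρ₀ : Measure ℝ}
    (h : TVConv l ρ ρ₀) (k : ℕ) : ∃ τ : ι → ℝ, Tendsto τ l (𝓝 0) ∧ ∀ i, ∀ C : ℝ, 0 ≤ C →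
      ∀ G : ℝ → ℝ, Measurable G → (∀ y, |G y| ≤ C * (1 + |y| ^ k)) →
      |∫ y, G y ∂(ρ i) - ∫ y, G y ∂ρ₀| ≤ C * τ i := by
  obtain ⟨τ, h1, h2⟩ := h k
  refine ⟨τ, h1, fun i C hC G hG hb => ?_⟩
  rcases hC.eq_or_lt with rfl | hC
  · have : ∀ y, G y = 0 := fun y => abs_nonpos_iff.1 (by simpa using hb y)
    simp [this]
  · have := h2 i (fun y => C⁻¹ * G y) (hG.const_mul _) fun y => by
      rw [abs_mul, abs_of_pos (inv_pos.2 hC), inv_mul_le_iff₀ hC]; exact hb y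
    rwa [integral_const_mul, integral_const_mul, ← mul_sub, abs_mul, abs_of_pos (inv_pos.2 hC),
      inv_mul_le_iff₀ hC] at this

/-- All moments of `ρ` are finite. -/
def FiniteMoments (ρ : Measure ℝ) : Prop := ∀ k : ℕ, Integrable (fun y => |y| ^ k) ρ

theorem FiniteMoments.integrable {ρ : Measure ℝ} (h : FiniteMoments ρ) {G : ℝ → ℝ}
    (hG : AEStronglyMeasurable G ρ) {C : ℝ} {k : ℕ} (hb : ∀ y, |G y| ≤ C * (1 + |y| ^ k)) :
    Integrable G ρ :=
  Integrable.mono' (((by simpa using h 0 : Integrable (fun _ : ℝ => (1 : ℝ)) ρ).add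
    (h k)).const_mul C) hG (ae_of_all _ hb)

/-- Dominated convergence along a family of measures converging in weighted total variation. -/
theorem TVConv.tendsto_integral {ι : Type*} {l : Filter ι} [l.IsCountablyGenerated]
    {ρ : ι → Measure ℝ} {ρ₀ : Measure ℝ} (h : TVConv l ρ ρ₀) (hm : FiniteMoments ρ₀)
    {G : ι → ℝ → ℝ} {G₀ : ℝ → ℝ} (hG : ∀ i, Measurable (G i)) {C : ℝ} {k : ℕ}
    (hb : ∀ i y, |G i y| ≤ C * (1 + |y| ^ k)) (hlim : ∀ y, Tendsto (fun i => G i y) l (𝓝 (G₀ y))) :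
    Tendsto (fun i => ∫ y, G i y ∂(ρ i)) l (𝓝 (∫ y, G₀ y ∂ρ₀)) := by
  obtain ⟨τ, h1, h2⟩ := h.exists_bound k
  have hb' : ∀ i y, |G i y| ≤ |C| * (1 + |y| ^ k) := fun i y =>
    (hb i y).trans (mul_le_mul_of_nonneg_right (le_abs_self C) (by positivity))
  -- The total variation bound is uniform over the integrand, which may hence vary with `i` and be
  -- merely measurable in `y`; afterwards the measure is fixed and ordinary dominated convergence
  -- applies.
  have h3 : Tendsto (fun i => ∫ y, G i y ∂(ρ i) - ∫ y, G i y ∂ρ₀) l (𝓝 0) := by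
    refine squeeze_zero_norm (fun i => h2 i |C| (abs_nonneg C) (G i) (hG i) (hb' i)) ?_
    simpa using h1.const_mul |C|
  have h4 : Tendsto (fun i => ∫ y, G i y ∂ρ₀) l (𝓝 (∫ y, G₀ y ∂ρ₀)) := by
    refine tendsto_integral_filter_of_dominated_convergence (fun y => |C| * (1 + |y| ^ k))
      (Eventually.of_forall fun i => (hG i).aestronglyMeasurable)
      (Eventually.of_forall fun i => ae_of_all _ (hb' i)) ?_ (ae_of_all _ hlim)
    exact ((by simpa using hm 0 : Integrable (fun _ : ℝ => (1 : ℝ)) ρ₀).add (hm k)).const_mul |C|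
  simpa using h3.add h4

theorem eventually_forall_mem_compact {ι : Type*} {l : Filter ι} {K : Set ℝ} (hK : IsCompact K)
    {P : ι → ℝ → Prop} (h : ∀ s ∈ K, ∀ᶠ p : ι × ℝ in l ×ˢ 𝓝 s, P p.1 p.2) :
    ∀ᶠ i in l, ∀ s ∈ K, P i s := by
  refine hK.induction_on (p := fun S => ∀ᶠ i in l, ∀ s ∈ S, P i s) (by simp)
    (fun s t hst ht => ht.mono fun i hi s hs => hi s (hst hs))
    (fun s t hs ht => (hs.and ht).mono fun i hi s hs => hs.elim (hi.1 s) (hi.2 s))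
    fun s hs => ?_
  obtain ⟨pa, ha, pb, hb, hab⟩ := eventually_prod_iff.1 (h s hs)
  exact ⟨{t | pb t}, mem_nhdsWithin_of_mem_nhds hb, ha.mono fun i hi t ht => hab hi ht⟩

/-! ### Continuous dependence of the densities on the coefficients -/

section Dens

variable {ι : Type*} {l : Filter ι} {f a : ι → ℝ → ℝ} {i₀ : ι}

/-- Joint convergence in the parameter and in `s` is locally uniform in `s`; compactness turns this
into bounds on the whole interval that hold eventually. -/
theorem eventually_bounds (ha : ∀ i, Continuous (a i)) (hf : ∀ i, Continuous (f i))
    (hpos : ∀ i y, 0 < a i y)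
    (hfl : ∀ s, Tendsto (fun p : ι × ℝ => f p.1 p.2) (l ×ˢ 𝓝 s) (𝓝 (f i₀ s)))
    (hal : ∀ s, Tendsto (fun p : ι × ℝ => a p.1 p.2) (l ×ˢ 𝓝 s) (𝓝 (a i₀ s))) (R : ℝ) :
    ∃ δ B : ℝ, 0 < δ ∧ 0 < B ∧ ∀ᶠ i in l, ∀ s ∈ Set.Icc (-R) R, δ ≤ a i s ∧ |f i s| ≤ B := by
  have hc : IsCompact (Set.Icc (-R) R) := isCompact_Icc
  obtain ⟨δ, h0, hδ⟩ : ∃ δ : ℝ, 0 < δ ∧ ∀ s ∈ Set.Icc (-R) R, δ < a i₀ s := by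
    obtain ⟨δ, h0, h⟩ := hc.exists_forall_le' (ha i₀).continuousOn fun s _ => hpos i₀ s
    exact ⟨δ / 2, half_pos h0, fun s hs => (half_lt_self h0).trans_le (h s hs)⟩
  obtain ⟨B, hB⟩ := hc.exists_bound_of_continuousOn (hf i₀).continuousOn
  refine ⟨δ, max B 0 + 1, h0, by positivity, ?_⟩
  refine eventually_forall_mem_compact hc fun s hs => ?_
  filter_upwards [(hal s).eventually (lt_mem_nhds (hδ s hs)),
    (hfl s).abs.eventually (gt_mem_nhds (show |f i₀ s| < max B 0 + 1 from
      ((hB s hs).trans (le_max_left _ _)).trans_lt (lt_add_one _)))] with p h1 h2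
  exact ⟨h1.le, h2.le⟩

variable [l.IsCountablyGenerated]

theorem abs_le_of_mem_uIoc {s y : ℝ} (hs : s ∈ Set.uIoc 0 y) : |s| ≤ |y| := by
  rcases Set.mem_uIoc.1 hs with h | h
  · rw [abs_of_pos h.1, abs_of_pos (h.1.trans_le h.2)]; exact h.2
  · rw [abs_of_nonpos h.2, abs_of_neg (h.1.trans_le h.2)]; linarith [h.1]

/-- On bounded intervals `f / a` is eventually bounded uniformly, so the potentials converge by
dominated convergence. The local bound supplies the dominating constant for the normalising
integrals. -/
theorem tendsto_dens (ha : ∀ i, Continuous (a i)) (hf : ∀ i, Continuous (f i))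
    (hpos : ∀ i y, 0 < a i y)
    (hfl : ∀ s, Tendsto (fun p : ι × ℝ => f p.1 p.2) (l ×ˢ 𝓝 s) (𝓝 (f i₀ s)))
    (hal : ∀ s, Tendsto (fun p : ι × ℝ => a p.1 p.2) (l ×ˢ 𝓝 s) (𝓝 (a i₀ s))) :
    (∀ y, Tendsto (fun i => dens (f i) (a i) y) l (𝓝 (dens (f i₀) (a i₀) y))) ∧
    ∀ R : ℝ, ∃ B, ∀ᶠ i in l, ∀ y ∈ Set.Icc (-R) R, dens (f i) (a i) y ≤ B := by
  have hq : ∀ s, Tendsto (fun i => f i s) l (𝓝 (f i₀ s)) ∧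
      Tendsto (fun i => a i s) l (𝓝 (a i₀ s)) := fun s =>
    ⟨(hfl s).comp (tendsto_id.prodMk tendsto_const_nhds),
      (hal s).comp (tendsto_id.prodMk tendsto_const_nhds)⟩
  have hcont : ∀ i, Continuous fun s => f i s / a i s := fun i =>
    (hf i).div₀ (ha i) fun y => (hpos i y).ne'
  have hquot : ∀ {δ B : ℝ}, 0 < δ → 0 < B → ∀ i s, δ ≤ a i s → |f i s| ≤ B →
      ‖f i s / a i s‖ ≤ B / δ := by
    intro δ B h0 hB i s h1 h2
    rw [norm_div, Real.norm_eq_abs, Real.norm_of_nonneg (h0.le.trans h1)]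
    gcongr
  have hpot : ∀ y, Tendsto (fun i => pot (f i) (a i) y) l (𝓝 (pot (f i₀) (a i₀) y)) := by
    intro y
    obtain ⟨δ, B, h0, hB0, hB⟩ := eventually_bounds ha hf hpos hfl hal |y|
    refine intervalIntegral.tendsto_integral_filter_of_dominated_convergence (fun _ => B / δ)
      (Eventually.of_forall fun i => (hcont i).aestronglyMeasurable) ?_
      intervalIntegrable_const
      (ae_of_all _ fun s _ => (hq s).1.div (hq s).2 (hpos i₀ s).ne')
    filter_upwards [hB] with i hi
    refine ae_of_all _ fun s hs => ?_
    obtain ⟨h1, h2⟩ := hi s (abs_le.1 (abs_le_of_mem_uIoc hs))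
    exact hquot h0 hB0 i s h1 h2
  refine ⟨fun y => ((Real.continuous_exp.tendsto _).comp (hpot y)).div (hq y).2
    (hpos i₀ y).ne', fun R => ?_⟩
  obtain ⟨δ, B, h0, hB0, hB⟩ := eventually_bounds ha hf hpos hfl hal R
  refine ⟨Real.exp (B / δ * R) / δ, hB.mono fun i hi y hy => ?_⟩
  have hyR : |y| ≤ R := abs_le.2 hy
  refine div_le_div₀ (Real.exp_pos _).le (Real.exp_le_exp.2 ?_) h0 (hi y hy).1
  refine (le_abs_self _).trans (le_trans (intervalIntegral.norm_integral_le_of_norm_le_const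
    (f := fun s => f i s / a i s) (a := 0) (b := y) (C := B / δ) fun s hs => ?_) ?_)
  · obtain ⟨h1, h2⟩ := hi s (abs_le.1 ((abs_le_of_mem_uIoc hs).trans hyR))
    exact hquot h0 hB0 i s h1 h2
  · rw [sub_zero]
    exact mul_le_mul_of_nonneg_left hyR (by positivity)

variable {c : ι → ℝ}

/-- The mass that a density with bounded second moment gives to `[-R, R]`. -/
theorem mass_Icc {p : ℝ → ℝ} (h0 : ∀ y, 0 ≤ p y) (hi : Integrable p) (h1 : ∫ y, p y = 1)
    {C : ℝ} (hi2 : Integrable fun y => |y| ^ 2 * p y) (hC : ∫ y, |y| ^ 2 * p y ≤ C) {R : ℝ}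
    (hR : 0 < R) : 1 - C / R ^ 2 ≤ ∫ y in -R..R, p y ∧ ∫ y in -R..R, p y ≤ 1 := by
  rw [intervalIntegral.integral_of_le (by linarith), ← integral_Icc_eq_integral_Ioc]
  constructor
  · have := integral_add_compl (s := Set.Icc (-R) R) measurableSet_Icc hi
    have h2 : ∫ y in (Set.Icc (-R) R)ᶜ, p y ≤ C / R ^ 2 := by
      rw [le_div_iff₀ (by positivity), mul_comm, ← integral_const_mul]
      refine le_trans (setIntegral_mono_on (hi.const_mul _).integrableOn hi2.integrableOn
        measurableSet_Icc.compl fun y hy => ?_) ((setIntegral_le_integral hi2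
          (ae_of_all _ fun y => mul_nonneg (by positivity) (h0 y))).trans hC)
      have : R < |y| := by
        by_contra h
        exact hy (abs_le.1 (not_lt.1 h))
      gcongr
      exact h0 y
    linarith
  · rw [← h1]
    exact setIntegral_le_integral hi (ae_of_all _ h0)

/-- By Chebyshev, `c i * Z R i` lies within `C / R ^ 2` of `1` uniformly in `i`, while the truncated
masses `Z R i` converge for fixed `R`. Comparing `c i` with `c i₀` at one large `R` suffices, and
tightness comes from the second moment alone. -/
theorem tendsto_normalization (ha : ∀ i, Continuous (a i)) (hf : ∀ i, Continuous (f i))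
    (hpos : ∀ i y, 0 < a i y)
    (hfl : ∀ s, Tendsto (fun p : ι × ℝ => f p.1 p.2) (l ×ˢ 𝓝 s) (𝓝 (f i₀ s)))
    (hal : ∀ s, Tendsto (fun p : ι × ℝ => a p.1 p.2) (l ×ˢ 𝓝 s) (𝓝 (a i₀ s)))
    (hc : ∀ i, 0 < c i) (hi : ∀ i, Integrable fun y => c i * dens (f i) (a i) y)
    (h1 : ∀ i, ∫ y, c i * dens (f i) (a i) y = 1)
    {C : ℝ} (hi2 : ∀ i, Integrable fun y => |y| ^ 2 * (c i * dens (f i) (a i) y))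
    (hC : ∀ i, ∫ y, |y| ^ 2 * (c i * dens (f i) (a i) y) ≤ C) :
    Tendsto c l (𝓝 (c i₀)) := by
  obtain ⟨hlim, hbd⟩ := tendsto_dens ha hf hpos hfl hal
  set Z : ℝ → ι → ℝ := fun R i => ∫ y in -R..R, dens (f i) (a i) y with hZ
  have hcd : ∀ i, Continuous (dens (f i) (a i)) := fun i => continuous_dens (hf i) (ha i) (hpos i)
  have hd0 : ∀ i y, 0 ≤ dens (f i) (a i) y := fun i y => (dens_pos (hpos i) y).le
  have hmass : ∀ R > 0, ∀ i, 1 - C / R ^ 2 ≤ c i * Z R i ∧ c i * Z R i ≤ 1 := by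
    intro R hR i
    rw [hZ, ← intervalIntegral.integral_const_mul]
    exact mass_Icc (fun y => mul_nonneg (hc i).le (hd0 i y)) (hi i) (h1 i) (hi2 i) (hC i) hR
  have hZlim : ∀ R, 0 < R → Tendsto (Z R) l (𝓝 (Z R i₀)) := by
    intro R hR
    obtain ⟨B, hB⟩ := hbd R
    refine intervalIntegral.tendsto_integral_filter_of_dominated_convergence (fun _ => B)
      (Eventually.of_forall fun i => (hcd i).aestronglyMeasurable) ?_
      intervalIntegrable_const (ae_of_all _ fun y _ => hlim y)
    filter_upwards [hB] with i hi
    refine ae_of_all _ fun y hy => ?_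
    rw [Real.norm_of_nonneg (hd0 i y)]
    rw [Set.uIoc_of_le (by linarith)] at hy
    exact hi y ⟨hy.1.le, hy.2⟩
  have hZ1 : ∀ i, 0 < Z 1 i := fun i =>
    intervalIntegral.intervalIntegral_pos_of_pos ((hcd i).intervalIntegrable _ _)
      (dens_pos (hpos i)) (by norm_num)
  set z := Z 1 i₀ with hz
  have hz0 : 0 < z := hZ1 i₀
  have hZmono : ∀ R ≥ 1, z ≤ Z R i₀ := by
    intro R hR
    refine intervalIntegral.integral_mono_interval (by linarith) (by norm_num) hR
      (ae_of_all _ (hd0 i₀)) ((hcd i₀).intervalIntegrable _ _)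
  have hC0 : 0 ≤ C := (integral_nonneg fun y =>
    mul_nonneg (by positivity) (mul_nonneg (hc i₀).le (hd0 i₀ y))).trans (hC i₀)
  rw [Metric.tendsto_nhds]
  intro ε hε
  -- The factor `z = Z 1 i₀` is a lower bound for `Z R i₀` for all `R ≥ 1`; the final division by `Z
  -- R i₀` costs at most `1 / z`.
  obtain ⟨R, hR1, hR⟩ : ∃ R : ℝ, 1 ≤ R ∧ C / R ^ 2 < ε * z / 2 := by
    have : Tendsto (fun R : ℝ => C / R ^ 2) atTop (𝓝 0) :=
      tendsto_const_nhds.div_atTop (tendsto_pow_atTop two_ne_zero)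
    obtain ⟨R, h1, h2⟩ := ((eventually_ge_atTop (1 : ℝ)).and
      (this.eventually (gt_mem_nhds (show (0 : ℝ) < ε * z / 2 by positivity)))).exists
    exact ⟨R, h1, h2⟩
  have hR0 : 0 < R := by linarith
  have e1 := (hZlim 1 one_pos).eventually (lt_mem_nhds (show z / 2 < z by linarith))
  have e2 := (Metric.tendsto_nhds.1 (hZlim R hR0)) (ε * z ^ 2 / 4) (by positivity)
  filter_upwards [e1, e2] with i hi1 hi2
  have hci : c i * z ≤ 2 := by
    have := (hmass 1 one_pos i).2
    nlinarith [hc i]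
  rw [Real.dist_eq] at hi2 ⊢
  have h5 : |c i - c i₀| * Z R i₀ ≤ c i * |Z R i - Z R i₀| + C / R ^ 2 := by
    have hZpos : 0 < Z R i₀ := hz0.trans_le (hZmono R hR1)
    rw [← abs_of_pos hZpos, ← abs_mul, abs_of_pos hZpos]
    have e : (c i - c i₀) * Z R i₀ =
        -(c i * (Z R i - Z R i₀)) + (c i * Z R i - c i₀ * Z R i₀) := by ring
    rw [e]
    refine (abs_add_le _ _).trans (add_le_add (by rw [abs_neg, abs_mul, abs_of_pos (hc i)]) ?_)
    have m1 := hmass R hR0 i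
    have m2 := hmass R hR0 i₀
    rw [abs_le]; constructor <;> linarith [m1.1, m1.2, m2.1, m2.2]
  have h6 : c i * |Z R i - Z R i₀| * z ≤ ε * z ^ 2 / 2 := by
    have : c i * |Z R i - Z R i₀| * z = (c i * z) * |Z R i - Z R i₀| := by ring
    rw [this]
    nlinarith [abs_nonneg (Z R i - Z R i₀), mul_pos (hc i) hz0]
  have h7 : c i * |Z R i - Z R i₀| ≤ ε * z / 2 := by
    by_contra h
    push Not at h
    nlinarith
  have h8 := mul_le_mul_of_nonneg_left (hZmono R hR1) (abs_nonneg (c i - c i₀))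
  by_contra h
  push Not at h
  nlinarith

/-- Densities with uniformly bounded moments that converge pointwise converge in weighted total
variation. -/
theorem tendsto_weighted_integral_abs_sub {p : ι → ℝ → ℝ} (h0 : ∀ i y, 0 ≤ p i y)
    (h1 : ∀ i, ∫ y, p i y = 1)
    (hm : ∀ k : ℕ, ∃ C, ∀ i, Integrable (fun y => |y| ^ k * p i y) ∧ ∫ y, |y| ^ k * p i y ≤ C)
    (hlim : ∀ y, Tendsto (fun i => p i y) l (𝓝 (p i₀ y))) (k : ℕ) :
    Tendsto (fun i => ∫ y, (1 + |y| ^ k) * |p i y - p i₀ y|) l (𝓝 0) := by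
  have hint : ∀ i, Integrable (p i) := fun i => by
    obtain ⟨C, hC⟩ := hm 0; simpa using (hC i).1
  have hw : ∀ k i, Integrable fun y => (1 + |y| ^ k) * p i y := fun k i => by
    obtain ⟨C, hC⟩ := hm k
    refine ((hint i).add (hC i).1).congr (ae_of_all _ fun y => ?_)
    simp only [Pi.add_apply]; ring
  have hwabs : ∀ k i, Integrable fun y => (1 + |y| ^ k) * |p i y - p i₀ y| := fun k i => by
    refine ((hw k i).sub (hw k i₀)).abs.congr (ae_of_all _ fun y => ?_)
    simp only [Pi.sub_apply]
    rw [← mul_sub, abs_mul, abs_of_nonneg (show 0 ≤ 1 + |y| ^ k by positivity)]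
  have hL1 : Tendsto (fun i => ∫ y, |p i y - p i₀ y|) l (𝓝 0) := by
    -- Scheffé's argument: as the masses agree, the `L¹` distance is twice the integral of the
    -- positive part of `p i₀ - p i`, which is dominated by `p i₀`.
    have e : ∀ i, ∫ y, |p i y - p i₀ y| = 2 * ∫ y, max (p i₀ y - p i y) 0 := by
      intro i
      have hs : ∫ y, (p i y - p i₀ y) = 0 := by
        rw [integral_sub (hint i) (hint i₀), h1, h1, sub_self]
      have hpp : Integrable fun y => max (p i₀ y - p i y) 0 := ((hint i₀).sub (hint i)).pos_part
      have := integral_add (hpp.const_mul 2) ((hint i).sub (hint i₀))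
      simp only [Pi.sub_apply] at this
      rw [hs, integral_const_mul, add_zero] at this
      rw [← this]
      congr 1; ext y
      rcases le_total (p i y) (p i₀ y) with h | h
      · rw [abs_of_nonpos (by linarith), max_eq_left (by linarith)]; ring
      · rw [abs_of_nonneg (by linarith), max_eq_right (by linarith)]; ring
    simp_rw [e]
    have : Tendsto (fun i => ∫ y, max (p i₀ y - p i y) 0) l (𝓝 (∫ _ : ℝ, (0 : ℝ))) := by
      refine tendsto_integral_filter_of_dominated_convergence (p i₀)
        (Eventually.of_forall fun i => ((hint i₀).sub (hint i)).pos_part.aestronglyMeasurable)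
        (Eventually.of_forall fun i => ae_of_all _ fun y => ?_) (hint i₀)
        (ae_of_all _ fun y => ?_)
      · rw [Real.norm_of_nonneg (le_max_right _ _)]
        exact max_le (by linarith [h0 i y]) (h0 i₀ y)
      · have := ((tendsto_const_nhds (x := p i₀ y)).sub (hlim y)).max
          (tendsto_const_nhds (x := (0 : ℝ)))
        simpa using this
    simpa using this.const_mul 2
  obtain ⟨C, hC⟩ := hm (2 * k)
  have hC0 : 0 ≤ C := (integral_nonneg fun y =>
    mul_nonneg (by positivity) (h0 i₀ y)).trans (hC i₀).2
  have hbound : ∀ δ > 0, ∀ i, ∫ y, (1 + |y| ^ k) * |p i y - p i₀ y| ≤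
      δ⁻¹ * (∫ y, |p i y - p i₀ y|) + δ * (4 * (1 + C)) := by
    intro δ hδ i
    have hpt : ∀ y, (1 + |y| ^ k) * |p i y - p i₀ y| ≤ δ⁻¹ * |p i y - p i₀ y| +
        δ * (2 * ((1 + |y| ^ (2 * k)) * p i y + (1 + |y| ^ (2 * k)) * p i₀ y)) := by
      intro y
      set t := |y| ^ k with ht
      have ht0 : 0 ≤ t := by positivity
      rw [show |y| ^ (2 * k) = t ^ 2 by rw [ht, ← pow_mul, mul_comm]]
      have hs : (1 + t) ≤ δ⁻¹ + δ * (2 * (1 + t ^ 2)) := by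
        have h2 : (1 + t) ^ 2 ≤ 2 * (1 + t ^ 2) := by nlinarith [sq_nonneg (1 - t)]
        -- Young's inequality trades the weight for a large multiple of the unweighted distance plus
        -- a small multiple of the moment of order `2 * k`.
        have h3 : 1 + t ≤ δ⁻¹ + δ * (1 + t) ^ 2 := by
          have : δ * δ⁻¹ = 1 := mul_inv_cancel₀ hδ.ne'
          have hi : 0 < δ⁻¹ := inv_pos.2 hδ
          nlinarith [mul_nonneg hδ.le (sq_nonneg ((1 + t) - δ⁻¹)), mul_nonneg hδ.le ht0]
        nlinarith
      have hd : |p i y - p i₀ y| ≤ p i y + p i₀ y := by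
        rw [abs_le]; constructor <;> linarith [h0 i y, h0 i₀ y]
      calc (1 + t) * |p i y - p i₀ y|
          ≤ (δ⁻¹ + δ * (2 * (1 + t ^ 2))) * |p i y - p i₀ y| := by gcongr
        _ = δ⁻¹ * |p i y - p i₀ y| + δ * (2 * (1 + t ^ 2)) * |p i y - p i₀ y| := by ring
        _ ≤ δ⁻¹ * |p i y - p i₀ y| + δ * (2 * (1 + t ^ 2)) * (p i y + p i₀ y) := by gcongr
        _ = _ := by ring
    have i0 : Integrable fun y => |p i y - p i₀ y| := ((hint i).sub (hint i₀)).abs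
    refine (integral_mono (hwabs k i) ((i0.const_mul _).add
      ((((hw (2 * k) i).add (hw (2 * k) i₀)).const_mul 2).const_mul δ)) hpt).trans ?_
    have hsum := integral_add (i0.const_mul δ⁻¹) ((((hw (2 * k) i).add
      (hw (2 * k) i₀)).const_mul 2).const_mul δ)
    simp only [Pi.add_apply] at hsum ⊢
    rw [hsum, integral_const_mul]
    refine add_le_add le_rfl ?_
    rw [integral_const_mul]
    refine mul_le_mul_of_nonneg_left ?_ hδ.le
    rw [integral_const_mul]
    have hone : ∀ i, ∫ y, (1 + |y| ^ (2 * k)) * p i y ≤ 1 + C := fun i => by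
      simp only [add_mul, one_mul]
      rw [integral_add (hint i) (hC i).1, h1]
      linarith [(hC i).2]
    rw [integral_add (hw (2 * k) i) (hw (2 * k) i₀)]
    linarith [hone i, hone i₀]
  rw [Metric.tendsto_nhds]
  intro ε hε
  -- This value makes the moment term equal to `ε / 2`.
  set δ := ε / (8 * (1 + C)) with hδdef
  have hδ : 0 < δ := by positivity
  filter_upwards [(Metric.tendsto_nhds.1 hL1) (δ * ε / 2) (by positivity)] with i hi
  rw [Real.dist_0_eq_abs, abs_of_nonneg (integral_nonneg fun y => abs_nonneg _)] at hi
  rw [Real.dist_0_eq_abs, abs_of_nonneg (integral_nonneg fun y => by positivity)]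
  refine (hbound δ hδ i).trans_lt ?_
  have h3 : δ⁻¹ * ∫ y, |p i y - p i₀ y| < ε / 2 := by
    rw [inv_mul_lt_iff₀ hδ]; linarith
  have h4 : δ * (4 * (1 + C)) = ε / 2 := by
    rw [hδdef]; field_simp; ring
  linarith

theorem tvConv_densMeasure (ha : ∀ i, Continuous (a i)) (hf : ∀ i, Continuous (f i))
    (hpos : ∀ i y, 0 < a i y)
    (hfl : ∀ s, Tendsto (fun p : ι × ℝ => f p.1 p.2) (l ×ˢ 𝓝 s) (𝓝 (f i₀ s)))
    (hal : ∀ s, Tendsto (fun p : ι × ℝ => a p.1 p.2) (l ×ˢ 𝓝 s) (𝓝 (a i₀ s)))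
    (hc : ∀ i, 0 < c i) (h1 : ∀ i, c i * ∫ y, dens (f i) (a i) y = 1)
    (hm : ∀ k : ℕ, ∃ C, ∀ i, Integrable (fun y => |y| ^ k) (densMeasure (f i) (a i) (c i)) ∧
      ∫ y, |y| ^ k ∂(densMeasure (f i) (a i) (c i)) ≤ C) :
    TVConv l (fun i => densMeasure (f i) (a i) (c i)) (densMeasure (f i₀) (a i₀) (c i₀)) := by
  set p : ι → ℝ → ℝ := fun i y => c i * dens (f i) (a i) y with hp
  have hm' : ∀ k : ℕ, ∃ C, ∀ i, Integrable (fun y => |y| ^ k * p i y) ∧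
      ∫ y, |y| ^ k * p i y ≤ C := fun k => by
    obtain ⟨C, hC⟩ := hm k
    refine ⟨C, fun i => ?_⟩
    rw [← integrable_densMeasure (hf i) (ha i) (hpos i) (hc i).le,
      ← integral_densMeasure (hf i) (ha i) (hpos i) (hc i).le]
    exact hC i
  have h0 : ∀ i y, 0 ≤ p i y := fun i y => mul_nonneg (hc i).le (dens_pos (hpos i) y).le
  have h1' : ∀ i, ∫ y, p i y = 1 := fun i => by rw [hp]; simp only; rw [integral_const_mul, h1]
  have hint : ∀ i, Integrable (p i) := fun i => by
    obtain ⟨C, hC⟩ := hm' 0; simpa using (hC i).1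
  obtain ⟨C, hC⟩ := hm' 2
  have hcl := tendsto_normalization ha hf hpos hfl hal hc hint h1' (fun i => (hC i).1)
    fun i => (hC i).2
  have hlim : ∀ y, Tendsto (fun i => p i y) l (𝓝 (p i₀ y)) := fun y =>
    hcl.mul ((tendsto_dens ha hf hpos hfl hal).1 y)
  intro k
  refine ⟨_, tendsto_weighted_integral_abs_sub h0 h1' hm' hlim k, fun i G hG hb => ?_⟩
  obtain ⟨C, hC⟩ := hm' k
  have hw : ∀ i, Integrable fun y => (1 + |y| ^ k) * p i y := fun i => by
    refine ((hint i).add (hC i).1).congr (ae_of_all _ fun y => ?_)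
    simp only [Pi.add_apply]; ring
  have hGi : ∀ i, Integrable fun y => G y * p i y := fun i =>
    (hw i).mono' (hG.aestronglyMeasurable.mul (hint i).aestronglyMeasurable)
      (ae_of_all _ fun y => by
        rw [norm_mul, Real.norm_of_nonneg (h0 i y)]
        exact mul_le_mul_of_nonneg_right (hb y) (h0 i y))
  rw [integral_densMeasure (hf i) (ha i) (hpos i) (hc i).le,
    integral_densMeasure (hf i₀) (ha i₀) (hpos i₀) (hc i₀).le,
    ← integral_sub (hGi i) (hGi i₀), ← Real.norm_eq_abs]
  refine norm_integral_le_of_norm_le ?_ (ae_of_all _ fun y => ?_)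
  · refine ((hw i).sub (hw i₀)).abs.congr (ae_of_all _ fun y => ?_)
    simp only [Pi.sub_apply]
    rw [← mul_sub, abs_mul, abs_of_nonneg (show 0 ≤ 1 + |y| ^ k by positivity)]
  · rw [← mul_sub, norm_mul]
    exact mul_le_mul_of_nonneg_right (hb y) (norm_nonneg _)

end Dens

/-! ### Convergence in the Wasserstein space -/

theorem W2_le_of_coupling {μ ν : P2} (γ : Measure (ℝ × ℝ)) (h1 : γ.map Prod.fst = μ.1)
    (h2 : γ.map Prod.snd = ν.1) :
    W2 μ ν ≤ (∫⁻ p, ENNReal.ofReal ((p.1 - p.2) ^ 2) ∂γ) ^ (1 / 2 : ℝ) :=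
  ENNReal.rpow_le_rpow (iInf₂_le γ ⟨h1, h2⟩) (by norm_num)

theorem tendsto_nhdsW2 {ι : Type*} {l : Filter ι} {u : ι → P2} {μ : P2} :
    Tendsto u l (nhdsW2 μ) ↔ Tendsto (fun i => W2 (u i) μ) l (𝓝 0) := tendsto_comap_iff

theorem W2_self (μ : P2) : W2 μ μ = 0 := by
  refine le_antisymm ((W2_le_of_coupling (μ.1.map fun x => (x, x)) ?_ ?_).trans ?_) zero_le
  · rw [Measure.map_map measurable_fst (by fun_prop)]; exact Measure.map_id
  · rw [Measure.map_map measurable_snd (by fun_prop)]; exact Measure.map_id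
  · rw [lintegral_map (by fun_prop) (by fun_prop)]; simp

theorem tendsto_const_nhdsW2 {ι : Type*} {l : Filter ι} (μ : P2) :
    Tendsto (fun _ : ι => μ) l (nhdsW2 μ) := by
  rw [tendsto_nhdsW2]; simp only [W2_self]; exact tendsto_const_nhds

instance (μ : P2) : (nhdsW2 μ).IsCountablyGenerated :=
  inferInstanceAs (comap _ _).IsCountablyGenerated

instance (μ : P2) : IsProbabilityMeasure μ.1 := μ.2.1

section Law

variable {Ω : Type} [MeasurableSpace Ω] {P : Measure Ω} [IsProbabilityMeasure P]

/-- The joint law of `X` and `Y` is a coupling. Continuity in the Wasserstein sense thereby passes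
to liftings. -/
theorem W2_law_le (X Y : Lp ℝ 2 P) : W2 (law X) (law Y) ≤ edist X Y := by
  have hX := (Lp.stronglyMeasurable X).measurable
  have hY := (Lp.stronglyMeasurable Y).measurable
  refine (W2_le_of_coupling (P.map fun ω => (X ω, Y ω)) ?_ ?_).trans ?_
  · rw [Measure.map_map measurable_fst (by fun_prop)]; rfl
  · rw [Measure.map_map measurable_snd (by fun_prop)]; rfl
  · rw [lintegral_map (by fun_prop) (by fun_prop), Lp.edist_def,
      eLpNorm_eq_lintegral_rpow_enorm_toReal (by simp) (by simp)]
    refine ENNReal.rpow_le_rpow (lintegral_mono fun ω => ?_) (by norm_num)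
    simp only [ENNReal.toReal_ofNat, Pi.sub_apply, Real.enorm_eq_ofReal_abs]
    rw [ENNReal.ofReal_rpow_of_nonneg (abs_nonneg _) (by norm_num)]
    simp

theorem tendsto_law (X : Lp ℝ 2 P) : Tendsto law (𝓝 X) (nhdsW2 (law X)) := by
  rw [tendsto_nhdsW2]
  refine tendsto_of_tendsto_of_tendsto_of_le_of_le tendsto_const_nhds
    (tendsto_iff_edist_tendsto_0.1 tendsto_id) (fun _ => zero_le) fun Y => W2_law_le Y X

/-! ### Calculus of Lions derivatives -/

/-- The lifting of `u` is differentiable at `X`, and its gradient is `U (X ·)`. -/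
def LiftDerivAt (u : P2 → ℝ) (U : ℝ → ℝ) (X : Lp ℝ 2 P) : Prop :=
  ∃ g : Lp ℝ 2 P, (∀ᵐ ω ∂P, g ω = U (X ω)) ∧
    HasFDerivAt (fun X' : Lp ℝ 2 P => u (law X')) (innerSL ℝ g) X

variable {u u₁ u₂ : P2 → ℝ} {U U₁ U₂ : ℝ → ℝ} {X : Lp ℝ 2 P}

theorem LiftDerivAt.add (h₁ : LiftDerivAt u₁ U₁ X) (h₂ : LiftDerivAt u₂ U₂ X) :
    LiftDerivAt (fun μ => u₁ μ + u₂ μ) (fun t => U₁ t + U₂ t) X := by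
  obtain ⟨g₁, a₁, d₁⟩ := h₁
  obtain ⟨g₂, a₂, d₂⟩ := h₂
  refine ⟨g₁ + g₂, ?_, by rw [map_add]; exact d₁.add d₂⟩
  filter_upwards [a₁, a₂, Lp.coeFn_add g₁ g₂] with ω e₁ e₂ e₃
  rw [e₃, Pi.add_apply, e₁, e₂]

theorem LiftDerivAt.const_mul (c : ℝ) (h : LiftDerivAt u U X) :
    LiftDerivAt (fun μ => c * u μ) (fun t => c * U t) X := by
  obtain ⟨g, a, d⟩ := h
  refine ⟨c • g, ?_, ?_⟩
  · filter_upwards [a, Lp.coeFn_smul c g] with ω e₁ e₂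
    rw [e₂, Pi.smul_apply, e₁, smul_eq_mul]
  · have : innerSL ℝ (c • g) = c • innerSL ℝ g := by
      rw [map_smulₛₗ]; simp
    rw [this]; exact d.const_mul c

theorem LiftDerivAt.sub (h₁ : LiftDerivAt u₁ U₁ X) (h₂ : LiftDerivAt u₂ U₂ X) :
    LiftDerivAt (fun μ => u₁ μ - u₂ μ) (fun t => U₁ t - U₂ t) X := by
  convert h₁.add (h₂.const_mul (-1)) using 2 <;> ring

theorem LiftDerivAt.const (c : ℝ) : LiftDerivAt (fun _ => c) (fun _ => 0) X := by
  refine ⟨0, ?_, ?_⟩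
  · filter_upwards [Lp.coeFn_zero ℝ 2 P] with ω h using h
  · rw [map_zero]; exact hasFDerivAt_const _ _

theorem LiftDerivAt.mul_const (h : LiftDerivAt u U X) (c : ℝ) :
    LiftDerivAt (fun μ => u μ * c) (fun t => U t * c) X := by
  convert h.const_mul c using 2 <;> ring

theorem LiftDerivAt.mul (h₁ : LiftDerivAt u₁ U₁ X) (h₂ : LiftDerivAt u₂ U₂ X) :
    LiftDerivAt (fun μ => u₁ μ * u₂ μ)
      (fun t => U₁ t * u₂ (law X) + u₁ (law X) * U₂ t) X := by
  -- The linear rules supply an `L²` gradient with the right pointwise representative; uniqueness of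
  -- Fréchet derivatives then identifies it with the derivative of the product.
  have e := (h₁.mul_const (u₂ (law X))).add (h₂.const_mul (u₁ (law X)))
  obtain ⟨g₁, a₁, d₁⟩ := h₁
  obtain ⟨g₂, a₂, d₂⟩ := h₂
  obtain ⟨g, a, d⟩ := e
  refine ⟨g, a, ?_⟩
  rw [d.unique ((d₁.mul_const (u₂ (law X))).add (d₂.const_mul (u₁ (law X))))]
  rw [add_comm]
  exact d₁.mul d₂

theorem LiftDerivAt.sum {κ : Type*} {s : Finset κ} {u : κ → P2 → ℝ} {U : κ → ℝ → ℝ}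
    (h : ∀ i ∈ s, LiftDerivAt (u i) (U i) X) :
    LiftDerivAt (fun μ => ∑ i ∈ s, u i μ) (fun t => ∑ i ∈ s, U i t) X := by
  classical
  induction s using Finset.induction_on with
  | empty => simpa using LiftDerivAt.const (X := X) 0
  | insert i s hi ih =>
    simp only [Finset.sum_insert hi]
    exact (h i (Finset.mem_insert_self i s)).add
      (ih fun j hj => h j (Finset.mem_insert_of_mem hj))

theorem LiftDerivAt.congr (h : LiftDerivAt u₁ U₁ X) (hu : ∀ μ, u₁ μ = u₂ μ)
    (hU : ∀ t, U₁ t = U₂ t) : LiftDerivAt u₂ U₂ X := by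
  rwa [← funext hu, ← funext hU]

/-- Mean value inequality along a segment of liftings. -/
theorem abs_sub_le_of_liftDerivAt {u : P2 → ℝ} {U : P2 → ℝ → ℝ} {B : ℝ}
    (h : ∀ Y : Lp ℝ 2 P, LiftDerivAt u (U (law Y)) Y) (hB : ∀ μ t, |U μ t| ≤ B)
    (X Y : Lp ℝ 2 P) : |u (law Y) - u (law X)| ≤ B * ‖Y - X‖ := by
  choose g hg hd using h
  have hB0 : 0 ≤ B := (abs_nonneg _).trans (hB (law X) 0)
  refine Convex.norm_image_sub_le_of_norm_hasFDerivWithin_le (𝕜 := ℝ)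
    (f := fun Z : Lp ℝ 2 P => u (law Z)) (fun Z _ => (hd Z).hasFDerivWithinAt) (fun Z _ => ?_)
    convex_univ (Set.mem_univ X) (Set.mem_univ Y)
  rw [innerSL_apply_norm]
  -- On a probability space the almost sure bound on the gradient bounds its `L²` norm by the same
  -- constant.
  have := Lp.norm_le_of_ae_bound (f := g Z) hB0 (by
    filter_upwards [hg Z] with ω e
    rw [e]; exact hB _ _)
  simpa [measureUnivNNReal] using this

end Law

/-! ### Differentiation of integrals with a varying measure -/

section Transfer

/-- Differentiation of `e ↦ ∫ Φ e dρ_e` when the derivative does not fall on `ρ_e`. -/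
theorem hasFDerivAt_integral_of_tvConv {E : Type*} [NormedAddCommGroup E] [NormedSpace ℝ E]
    {ρ : E → Measure ℝ} {e₀ : E} (h : TVConv (𝓝 e₀) ρ (ρ e₀)) (hm : ∀ e, FiniteMoments (ρ e))
    {Φ : E → ℝ → ℝ} (hΦ : ∀ e, Measurable (Φ e)) {C₀ : ℝ} {k₀ : ℕ}
    (hΦ₀ : ∀ y, |Φ e₀ y| ≤ C₀ * (1 + |y| ^ k₀))
    (hconst : ∀ e, ∫ y, Φ e₀ y ∂(ρ e) = ∫ y, Φ e₀ y ∂(ρ e₀))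
    {Φ' : ℝ → E →L[ℝ] ℝ} (hΦ' : ∀ y, HasFDerivAt (fun e => Φ e y) (Φ' y) e₀)
    (hmeas : ∀ v, Measurable fun y => Φ' y v) {C : ℝ} {k : ℕ}
    (hlip : ∀ e y, |Φ e y - Φ e₀ y| ≤ C * (1 + |y| ^ k) * ‖e - e₀‖)
    {L : E →L[ℝ] ℝ} (hL : ∀ v, L v = ∫ y, Φ' y v ∂(ρ e₀)) :
    HasFDerivAt (fun e => ∫ y, Φ e y ∂(ρ e)) L e₀ := by
  have hlip' : ∀ e y, |Φ e y - Φ e₀ y| ≤ |C| * (1 + |y| ^ k) * ‖e - e₀‖ := fun e y =>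
    (hlip e y).trans (by gcongr; exact le_abs_self C)
  have hΦn : ∀ y, ‖Φ' y‖ ≤ |C| * (1 + |y| ^ k) := fun y =>
    (hΦ' y).le_of_lip' (by positivity) (Eventually.of_forall fun e => hlip' e y)
  have hΦv : ∀ y v, |Φ' y v| ≤ (|C| * ‖v‖) * (1 + |y| ^ k) := fun y v =>
    ((Φ' y).le_opNorm v).trans ((mul_le_mul_of_nonneg_right (hΦn y) (norm_nonneg v)).trans_eq
      (by ring))
  have i0 : ∀ e, Integrable (Φ e₀) (ρ e) := fun e =>
    (hm e).integrable (hΦ e₀).aestronglyMeasurable hΦ₀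
  have i1 : ∀ e, Integrable (fun y => Φ e y - Φ e₀ y) (ρ e) := fun e =>
    (hm e).integrable ((hΦ e).sub (hΦ e₀)).aestronglyMeasurable (C := |C| * ‖e - e₀‖) (k := k)
      fun y => (hlip' e y).trans_eq (by ring)
  have i2 : ∀ v e, Integrable (fun y => Φ' y v) (ρ e) := fun v e =>
    (hm e).integrable (hmeas v).aestronglyMeasurable fun y => hΦv y v
  set Rm : E → ℝ → ℝ := fun e y => ‖e - e₀‖⁻¹ * (Φ e y - Φ e₀ y - Φ' y (e - e₀)) with hRm
  -- The normalised Taylor remainder tends to zero for each `y` and is dominated by twice the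
  -- Lipschitz bound, so its integral vanishes in the limit even though the measure moves.
  have hR : Tendsto (fun e => ∫ y, Rm e y ∂(ρ e)) (𝓝 e₀) (𝓝 (∫ _ : ℝ, (0 : ℝ) ∂(ρ e₀))) := by
    refine h.tendsto_integral (hm e₀) (C := 2 * |C|) (k := k) (fun e => ?_) (fun e y => ?_)
      fun y => ?_
    · exact (((hΦ e).sub (hΦ e₀)).sub (hmeas _)).const_mul _
    · rw [hRm, abs_mul, abs_inv, abs_norm]
      rcases eq_or_ne ‖e - e₀‖ 0 with hz | hz
      · rw [hz]; simp; positivity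
      · rw [inv_mul_le_iff₀ (by positivity)]
        refine (abs_sub _ _).trans ?_
        linarith [hlip' e y, hΦv y (e - e₀)]
    · have := hasFDerivAt_iff_tendsto.1 (hΦ' y)
      rw [tendsto_zero_iff_norm_tendsto_zero]
      refine this.congr fun e => ?_
      rw [hRm, norm_mul, norm_inv, norm_norm]
  obtain ⟨τ, t1, t2⟩ := h.exists_bound k
  rw [integral_zero] at hR
  rw [hasFDerivAt_iff_tendsto]
  have hsum : Tendsto (fun e => |∫ y, Rm e y ∂(ρ e)| + |C| * |τ e|) (𝓝 e₀) (𝓝 0) := by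
    have := hR.abs.add (t1.abs.const_mul |C|)
    simpa using this
  refine squeeze_zero (fun e => by positivity) (fun e => ?_) hsum
  -- Since `∫ Φ e₀ dρ_e` does not depend on `e`, the only trace of the moving measure is the linear
  -- term integrated against `ρ e - ρ e₀`. That is `‖e - e₀‖` times a quantity tending to zero, so
  -- no rate for `ρ` is required.
  have key : (∫ y, Φ e y ∂(ρ e)) - (∫ y, Φ e₀ y ∂(ρ e₀)) - L (e - e₀) =
      (∫ y, (Φ e y - Φ e₀ y - Φ' y (e - e₀)) ∂(ρ e)) +
      ((∫ y, Φ' y (e - e₀) ∂(ρ e)) - ∫ y, Φ' y (e - e₀) ∂(ρ e₀)) := by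
    have h1 : ∫ y, Φ e y ∂(ρ e) = (∫ y, (Φ e y - Φ e₀ y) ∂(ρ e)) + ∫ y, Φ e₀ y ∂(ρ e) := by
      rw [← integral_add (i1 e) (i0 e)]; simp
    rw [h1, integral_sub (i1 e) (i2 _ e), hL, hconst]
    ring
  rw [key]
  rcases eq_or_ne ‖e - e₀‖ 0 with hz | hz
  · rw [hz]; simp; positivity
  have hp : 0 < ‖e - e₀‖ := lt_of_le_of_ne (norm_nonneg _) hz.symm
  calc ‖e - e₀‖⁻¹ * ‖_‖
      ≤ ‖e - e₀‖⁻¹ * (|∫ y, (Φ e y - Φ e₀ y - Φ' y (e - e₀)) ∂(ρ e)| +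
        (|C| * ‖e - e₀‖) * |τ e|) := by
        gcongr
        refine (norm_add_le _ _).trans (add_le_add le_rfl ?_)
        exact (t2 e (|C| * ‖e - e₀‖) (by positivity) _ (hmeas _) fun y => hΦv y _).trans
          (by gcongr; exact le_abs_self _)
    _ = |∫ y, Rm e y ∂(ρ e)| + |C| * |τ e| := by
        rw [hRm]
        simp only
        rw [integral_const_mul, abs_mul, abs_inv, abs_norm]
        field_simp

theorem hasDerivAt_integral_of_tvConv {ρ : ℝ → Measure ℝ} {x₀ : ℝ}
    (h : TVConv (𝓝 x₀) ρ (ρ x₀)) (hm : ∀ x, FiniteMoments (ρ x))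
    {Φ Φ' : ℝ → ℝ → ℝ} (hΦ : ∀ x, Measurable (Φ x)) {C₀ : ℝ} {k₀ : ℕ}
    (hΦ₀ : ∀ y, |Φ x₀ y| ≤ C₀ * (1 + |y| ^ k₀))
    (hconst : ∀ x, ∫ y, Φ x₀ y ∂(ρ x) = ∫ y, Φ x₀ y ∂(ρ x₀))
    (hΦ' : ∀ x y, HasDerivAt (fun x => Φ x y) (Φ' x y) x) (hmeas : Measurable (Φ' x₀))
    {C : ℝ} {k : ℕ} (hb : ∀ x y, |Φ' x y| ≤ C * (1 + |y| ^ k)) :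
    HasDerivAt (fun x => ∫ y, Φ x y ∂(ρ x)) (∫ y, Φ' x₀ y ∂(ρ x₀)) x₀ := by
  rw [hasDerivAt_iff_hasFDerivAt]
  refine hasFDerivAt_integral_of_tvConv h hm hΦ hΦ₀ hconst
    (fun y => (hΦ' x₀ y).hasFDerivAt) (fun v => ?_) (C := C) (k := k) (fun x y => ?_) fun v => ?_
  · simpa using hmeas.const_mul v
  · exact Convex.norm_image_sub_le_of_norm_hasDerivWithin_le (𝕜 := ℝ) (s := Set.univ)
      (f := fun x => Φ x y) (fun z _ => (hΦ' z y).hasDerivWithinAt) (fun z _ => hb z y)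
      convex_univ (Set.mem_univ x₀) (Set.mem_univ x)
  · simp [integral_const_mul]

/-- The gradient of the integral is `ω ↦ ∫ U (law X) y (X ω) dρ`, by Fubini. Differentiability is
assumed at every lifting, not only at `X`, because the Lipschitz bound on the integrand comes from
the mean value inequality in `L²`. -/
theorem liftDerivAt_integral_of_tvConv {Ω : Type} [MeasurableSpace Ω] {P : Measure Ω}
    [IsProbabilityMeasure P] {X : Lp ℝ 2 P} {ρ : P2 → Measure ℝ}
    (h : TVConv (nhdsW2 (law X)) ρ (ρ (law X))) (hm : ∀ μ, FiniteMoments (ρ μ))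
    {Φ : P2 → ℝ → ℝ} {U : P2 → ℝ → ℝ → ℝ} (hΦ : ∀ μ, Measurable (Φ μ)) {C₀ : ℝ} {k₀ : ℕ}
    (hΦ₀ : ∀ y, |Φ (law X) y| ≤ C₀ * (1 + |y| ^ k₀))
    (hconst : ∀ μ, ∫ y, Φ (law X) y ∂(ρ μ) = ∫ y, Φ (law X) y ∂(ρ (law X)))
    (hU : ∀ (Y : Lp ℝ 2 P) y, LiftDerivAt (fun μ => Φ μ y) (U (law Y) y) Y)
    (hmeas : ∀ t, Measurable fun y => U (law X) y t) (hcont : ∀ y, Continuous (U (law X) y))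
    {C : ℝ} {k : ℕ} (hb : ∀ μ y t, |U μ y t| ≤ C * (1 + |y| ^ k)) :
    LiftDerivAt (fun μ => ∫ y, Φ μ y ∂(ρ μ)) (fun t => ∫ y, U (law X) y t ∂(ρ (law X))) X := by
  set ρ₀ := ρ (law X) with hρ₀
  have hXm := (Lp.stronglyMeasurable X).measurable
  have hfin : IsFiniteMeasure ρ₀ := by
    have := hm (law X) 0
    simp only [pow_zero] at this
    exact (integrable_const_iff_isFiniteMeasure one_ne_zero).1 this
  -- Joint measurability is of Carathéodory type: continuous in `t`, measurable in `y`.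
  have hjoint : Measurable fun p : ℝ × ℝ => U (law X) p.2 p.1 :=
    (stronglyMeasurable_uncurry_of_continuous_of_stronglyMeasurable
      (u := fun t y => U (law X) y t) hcont fun t => (hmeas t).stronglyMeasurable).measurable
  have hjΩ : Measurable fun p : ℝ × Ω => U (law X) p.1 (X p.2) :=
    hjoint.comp ((hXm.comp measurable_snd).prodMk measurable_fst)
  have hKi : Integrable (fun y : ℝ => C * (1 + |y| ^ k)) ρ₀ :=
    ((integrable_const (1 : ℝ)).add (hm (law X) k)).const_mul C
  have hGm : StronglyMeasurable fun ω => ∫ y, U (law X) y (X ω) ∂ρ₀ := by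
    have : StronglyMeasurable fun p : Ω × ℝ => U (law X) p.2 (X p.1) :=
      (hjΩ.comp measurable_swap).stronglyMeasurable
    exact this.integral_prod_right
  have hGb : ∀ ω, ‖∫ y, U (law X) y (X ω) ∂ρ₀‖ ≤ ∫ y, C * (1 + |y| ^ k) ∂ρ₀ := fun ω =>
    norm_integral_le_of_norm_le hKi (ae_of_all _ fun y => hb _ _ _)
  have hGL : MemLp (fun ω => ∫ y, U (law X) y (X ω) ∂ρ₀) 2 P :=
    MemLp.of_bound hGm.aestronglyMeasurable _ (ae_of_all _ hGb)
  have hU' := fun y => hU X y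
  choose g hg hd using hU'
  refine ⟨hGL.toLp _, hGL.coeFn_toLp, ?_⟩
  have hinner : ∀ y (V : Lp ℝ 2 P), innerSL ℝ (g y) V = ∫ ω, U (law X) y (X ω) * V ω ∂P := by
    intro y V
    rw [innerSL_apply_apply, L2.inner_def]
    refine integral_congr_ae ?_
    filter_upwards [hg y] with ω e
    rw [e]; simp [mul_comm]
  refine hasFDerivAt_integral_of_tvConv (Φ := fun (Y : Lp ℝ 2 P) y => Φ (law Y) y)
    (ρ := fun Y : Lp ℝ 2 P => ρ (law Y)) (h.comp (tendsto_law X)) (fun Y => hm _)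
    (fun Y => hΦ _) hΦ₀ (fun Y => hconst _) hd (fun V => ?_) (C := C) (k := k)
    (fun Y y => abs_sub_le_of_liftDerivAt (u := fun μ => Φ μ y) (U := fun μ => U μ y)
      (fun Y => hU Y y) (fun μ t => hb μ y t) X Y) fun V => ?_
  · simp_rw [hinner]
    have hVm := (Lp.stronglyMeasurable V).measurable
    have : StronglyMeasurable fun p : ℝ × Ω => U (law X) p.1 (X p.2) * V p.2 :=
      (hjΩ.mul (hVm.comp measurable_snd)).stronglyMeasurable
    exact (this.integral_prod_right).measurable
  · simp_rw [hinner]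
    have hVm := (Lp.stronglyMeasurable V).measurable
    have hVi : Integrable V P := (Lp.memLp V).integrable (by norm_num)
    rw [innerSL_apply_apply, L2.inner_def, integral_integral_swap]
    · refine integral_congr_ae ?_
      filter_upwards [hGL.coeFn_toLp] with ω e
      rw [e, integral_mul_const]; simp [mul_comm, hρ₀]
    · refine (hKi.mul_prod hVi.norm).mono'
        (hjΩ.mul (hVm.comp measurable_snd)).aestronglyMeasurable (ae_of_all _ fun p => ?_)
      simp only [Function.uncurry, norm_mul]
      exact mul_le_mul_of_nonneg_right (hb _ _ _) (norm_nonneg _)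

end Transfer

/-! ### Uniqueness of continuous Lions derivatives -/

/-- The law `(1 - t) μ + t ν`. -/
def mixture (μ ν : P2) (s t : ℝ≥0∞) (hst : s + t = 1) : P2 :=
  ⟨s • μ.1 + t • ν.1, ⟨by simp [hst]⟩, by
    have hs : s ≠ ∞ := ne_top_of_le_ne_top ENNReal.one_ne_top (hst ▸ le_self_add)
    have ht : t ≠ ∞ := ne_top_of_le_ne_top ENNReal.one_ne_top (hst ▸ le_add_self)
    refine (memLp_two_iff_integrable_sq measurable_id'.aestronglyMeasurable).2 ?_
    exact (μ.2.2.integrable_sq.smul_measure hs).add_measure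
      (ν.2.2.integrable_sq.smul_measure ht)⟩

/-- The part of mass `s` is left in place, and only the part of mass `t` is coupled independently.
-/
theorem W2_mixture_le (μ ν : P2) (s t : ℝ≥0∞) (hst : s + t = 1) :
    W2 (mixture μ ν s t hst) μ ≤
      (t * ∫⁻ p, ENNReal.ofReal ((p.1 - p.2) ^ 2) ∂(ν.1.prod μ.1)) ^ (1 / 2 : ℝ) := by
  refine (W2_le_of_coupling (s • (μ.1.map fun x => (x, x)) + t • (ν.1.prod μ.1)) ?_ ?_).trans ?_
  · rw [Measure.map_add _ _ measurable_fst, Measure.map_smul, Measure.map_smul,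
      Measure.map_map measurable_fst (by fun_prop), Measure.map_fst_prod]
    simp only [measure_univ, one_smul]
    change s • μ.1.map id + _ = _
    rw [Measure.map_id]; rfl
  · rw [Measure.map_add _ _ measurable_snd, Measure.map_smul, Measure.map_smul,
      Measure.map_map measurable_snd (by fun_prop), Measure.map_snd_prod]
    simp only [measure_univ, one_smul]
    change s • μ.1.map id + _ = _
    rw [Measure.map_id, ← add_smul, hst, one_smul]
  · refine ENNReal.rpow_le_rpow ?_ (by norm_num)
    rw [lintegral_add_measure, lintegral_smul_measure, lintegral_smul_measure,
      lintegral_map (by fun_prop) (by fun_prop)]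
    simp

theorem lintegral_prod_sq_ne_top (μ ν : P2) :
    ∫⁻ p, ENNReal.ofReal ((p.1 - p.2) ^ 2) ∂(ν.1.prod μ.1) ≠ ∞ := by
  have h1 : MemLp (fun p : ℝ × ℝ => p.1) 2 (ν.1.prod μ.1) := ν.2.2.comp_fst μ.1
  have h2 : MemLp (fun p : ℝ × ℝ => p.2) 2 (ν.1.prod μ.1) := μ.2.2.comp_snd ν.1
  exact (h1.sub h2).integrable_sq.lintegral_lt_top.ne

/-- Giving weight `1 / (n + 1)` to `ν` costs little in Wasserstein distance and makes `ν` absolutely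
continuous with respect to the mixture. With a Gaussian `ν`, the laws dominating Lebesgue measure
are thus dense. -/
theorem exists_tendsto_mixture (μ ν : P2) : ∃ u : ℕ → P2, Tendsto u atTop (nhdsW2 μ) ∧
    ∀ n, ν.1 ≪ (u n).1 := by
  have hst : ∀ n : ℕ, (1 - ((n : ℝ≥0∞) + 1)⁻¹) + ((n : ℝ≥0∞) + 1)⁻¹ = 1 := fun n =>
    tsub_add_cancel_of_le (ENNReal.inv_le_one.2 le_add_self)
  refine ⟨fun n => mixture μ ν _ _ (hst n), ?_, fun n => ?_⟩
  · rw [tendsto_nhdsW2]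
    refine tendsto_of_tendsto_of_tendsto_of_le_of_le tendsto_const_nhds ?_ (fun _ => zero_le)
      fun n => W2_mixture_le μ ν _ _ (hst n)
    have h0 : Tendsto (fun n : ℕ => ((n : ℝ≥0∞) + 1)⁻¹) atTop (𝓝 0) := by
      have := (tendsto_add_atTop_iff_nat 1).2 ENNReal.tendsto_inv_nat_nhds_zero
      simpa using this
    have h1 := ENNReal.Tendsto.mul_const h0 (Or.inr (lintegral_prod_sq_ne_top μ ν))
    rw [zero_mul] at h1
    have := (ENNReal.continuous_rpow_const (y := 1 / 2)).tendsto 0 |>.comp h1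
    rwa [ENNReal.zero_rpow_of_pos (by norm_num)] at this
  · refine Measure.AbsolutelyContinuous.mk fun S _ hS => ?_
    have : (((n : ℝ≥0∞) + 1)⁻¹ • ν.1) S ≤ 0 := hS ▸ (Measure.le_add_left le_rfl :
      ((n : ℝ≥0∞) + 1)⁻¹ • ν.1 ≤ _) S
    simpa using this

/-- The independent Gaussian coordinate makes the probability space atomless, whatever atoms `μ`
has. -/
theorem exists_lift (μ : P2) : ∃ (P : Measure (ℝ × ℝ)) (_ : IsProbabilityMeasure P)
    (_ : NullSingletonClass P) (X : Lp ℝ 2 P), law X = μ := by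
  let γ := ProbabilityTheory.gaussianReal 0 1
  have hγ : NullSingletonClass γ := ProbabilityTheory.nullSingletonClass_gaussianReal (by simp)
  have h1 : MemLp (fun p : ℝ × ℝ => p.1) 2 (μ.1.prod γ) := μ.2.2.comp_fst γ
  refine ⟨μ.1.prod γ, inferInstance, inferInstance, h1.toLp _, Subtype.ext ?_⟩
  change (μ.1.prod γ).map (h1.toLp _) = μ.1
  rw [Measure.map_congr h1.coeFn_toLp]
  simp

/-- The standard Gaussian law. -/
def gaussP2 : P2 := ⟨ProbabilityTheory.gaussianReal 0 1, inferInstance,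
  ProbabilityTheory.memLp_id_gaussianReal 2⟩

theorem continuous_of_continuousW2 {E : Type} [TopologicalSpace E] {F : E → P2 → ℝ}
    (h : ContinuousW2 F) (μ : P2) : Continuous fun e => F e μ :=
  continuous_iff_continuousAt.2 fun e =>
    (h e μ).comp (tendsto_id.prodMk (tendsto_const_nhdsW2 μ))

/-- A jointly continuous Lions derivative is unique. -/
theorem HasLionsDeriv.unique {u : P2 → ℝ} {U V : P2 → ℝ → ℝ} (hU : HasLionsDeriv u U)
    (hV : HasLionsDeriv u V) (cU : ContinuousW2 fun t μ => U μ t)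
    (cV : ContinuousW2 fun t μ => V μ t) (μ : P2) (t : ℝ) : U μ t = V μ t := by
  -- The gradient determines a Lions derivative only almost everywhere for the law. If Lebesgue
  -- measure is absolutely continuous with respect to that law, continuity in `t` upgrades this to
  -- equality everywhere.
  have key : ∀ ν : P2, volume ≪ ν.1 → U ν = V ν := by
    intro ν hν
    obtain ⟨P, h1, h2, X, rfl⟩ := exists_lift ν
    obtain ⟨g, ag, dg⟩ := hU (ℝ × ℝ) P X
    obtain ⟨g', ag', dg'⟩ := hV (ℝ × ℝ) P X
    have e : g = g' := ext_inner_right ℝ fun v => by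
      simpa only [innerSL_apply_apply] using DFunLike.congr_fun (dg.unique dg') v
    subst e
    refine Continuous.ae_eq_iff_eq volume (continuous_of_continuousW2 cU _)
      (continuous_of_continuousW2 cV _) |>.1 (hν.ae_eq ?_)
    have : ∀ᵐ ω ∂P, U (law X) (X ω) = V (law X) (X ω) := by
      filter_upwards [ag, ag'] with ω e1 e2
      rw [← e1, ← e2]
    exact (ae_map_iff (Lp.aestronglyMeasurable X).aemeasurable (measurableSet_eq_fun
      (continuous_of_continuousW2 cU _).measurable
      (continuous_of_continuousW2 cV _).measurable)).2 this
  -- Other laws are reached as limits of such laws, by joint continuity.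
  obtain ⟨u', hu, hac⟩ := exists_tendsto_mixture μ gaussP2
  have l1 := (cU t μ).comp ((tendsto_const_nhds (x := t)).prodMk hu)
  have l2 := (cV t μ).comp ((tendsto_const_nhds (x := t)).prodMk hu)
  refine tendsto_nhds_unique l1 (l2.congr fun n => ?_)
  exact (congrFun (key (u' n) ((ProbabilityTheory.gaussianReal_absolutelyContinuous' 0
    one_ne_zero).trans (hac n))) t).symm

/-! ### The Leibniz sums -/

/-- Families of candidates for the mixed derivatives of a function of `(x, μ)`. -/
abbrev Family : Type := (m : MultiIndex) → ℝ → P2 → (Fin m.n → ℝ) → ℝ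

/-- The truncated Leibniz sum for the product of two functions. -/
def leib (D E : Family) (m : MultiIndex) (x : ℝ) (μ : P2) (z : Fin m.n → ℝ) : ℝ :=
  ∑ p : Finset (Fin m.n), ∑ j ∈ Finset.range (m.l + 1), (transferCoeff p.card j m.l : ℝ) *
    (D (m.sub p j) x μ (restr z p) * E (m.sub pᶜ (m.l - j)) x μ (restr z pᶜ))

theorem transferIntegrand_eq
    (Dh Df Da Dv₁ Dv₂ : (m : MultiIndex) → ℝ → ℝ → P2 → (Fin m.n → ℝ) → ℝ)
    (m : MultiIndex) (x y : ℝ) (μ : P2) (z : Fin m.n → ℝ) :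
    transferIntegrand Dh Df Da Dv₁ Dv₂ m x y μ z = Dh m x y μ z -
      (leib (fun m x => Df m x y) (fun m x => Dv₁ m x y) m x μ z +
        leib (fun m x => Da m x y) (fun m x => Dv₂ m x y) m x μ z) := by
  simp only [transferIntegrand, leib, mul_add, Finset.sum_add_distrib]

variable {ζ : Set MultiIndex}

theorem sub_mem (hζ : IsCompleteCollection ζ) {m : MultiIndex} (hm : m ∈ ζ)
    (p : Finset (Fin m.n)) {j : ℕ} (hj : j ≤ m.l) : m.sub p j ∈ ζ :=
  hζ m hm p.card j (p.orderEmbOfFin rfl) _ hj fun _ => le_rfl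

/-- Unless `p = ∅` and `j = 0`, at least one derivative falls on the first factor, and the second
factor then misses the maximum in `n` or in `l`. The truncation omits exactly the term in which this
fails. -/
theorem sub_compl_mem (hζ : IsCompleteCollection ζ) {m : MultiIndex} (hm : m ∈ ζ)
    (p : Finset (Fin m.n)) {j : ℕ} (hj : j ≤ m.l) (h0 : ¬ (p.card = 0 ∧ j = 0)) :
    m.sub pᶜ (m.l - j) ∈ removeMax ζ := by
  refine ⟨sub_mem hζ hm _ (Nat.sub_le _ _), fun ⟨h1, h2⟩ => h0 ?_⟩
  have e1 : m.n ≤ pᶜ.card := h1 m hm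
  have e2 : m.l ≤ m.l - j := h2 m hm
  have e3 : p.card ≤ m.n := (Finset.card_le_univ p).trans_eq (Fintype.card_fin _)
  rw [Finset.card_compl, Fintype.card_fin] at e1
  omega

/-- If the smaller index attains both maxima, so does the larger one. -/
theorem removeMax_complete (hζ : IsCompleteCollection ζ) : IsCompleteCollection (removeMax ζ) := by
  rintro m ⟨hm, hmax⟩ k j e α hj hα
  refine ⟨hζ m hm k j e α hj hα, fun ⟨h1, h2⟩ => hmax ⟨fun m' hm' => (h1 m' hm').trans ?_,
    fun m' hm' => (h2 m' hm').trans hj⟩⟩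
  simpa using Fintype.card_le_of_embedding e.toEmbedding

theorem mem_of_le (hζ : IsCompleteCollection ζ) {n l : ℕ} {β : Fin n → ℕ}
    (h : (⟨n, l, β⟩ : MultiIndex) ∈ ζ) {j : ℕ} (hj : j ≤ l) {α : Fin n → ℕ} (hα : ∀ i, α i ≤ β i) :
    (⟨n, j, α⟩ : MultiIndex) ∈ ζ :=
  hζ _ h n j (OrderIso.refl _).toOrderEmbedding α hj hα

/-- The Poisson equation of order `(n, l)` is thus available exactly when one more derivative in `x`
is to be taken. -/
theorem mem_removeMax_of_x (hζ : IsCompleteCollection ζ) {n l : ℕ} {β : Fin n → ℕ}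
    (h : (⟨n, l + 1, β⟩ : MultiIndex) ∈ ζ) : (⟨n, l, β⟩ : MultiIndex) ∈ removeMax ζ :=
  ⟨mem_of_le hζ h (Nat.le_succ l) fun _ => le_rfl, fun ⟨_, h2⟩ => by
    have : l + 1 ≤ l := h2 _ h
    omega⟩

theorem mem_of_mu (hζ : IsCompleteCollection ζ) {n l : ℕ}
    (h : (⟨n + 1, l, 0⟩ : MultiIndex) ∈ ζ) : (⟨n, l, 0⟩ : MultiIndex) ∈ ζ :=
  hζ _ h n l Fin.castSuccOrderEmb 0 le_rfl fun _ => Nat.zero_le _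

theorem mem_removeMax_of_mu (hζ : IsCompleteCollection ζ) {n l : ℕ}
    (h : (⟨n + 1, l, 0⟩ : MultiIndex) ∈ ζ) : (⟨n, l, 0⟩ : MultiIndex) ∈ removeMax ζ :=
  ⟨mem_of_mu hζ h, fun ⟨h1, _⟩ => by
    have : n + 1 ≤ n := h1 _ h
    omega⟩

theorem mem_of_z (hζ : IsCompleteCollection ζ) {n l : ℕ} {β : Fin n → ℕ} {i : Fin n}
    (h : (⟨n, l, β + Pi.single i 1⟩ : MultiIndex) ∈ ζ) : (⟨n, l, β⟩ : MultiIndex) ∈ ζ :=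
  mem_of_le hζ h le_rfl fun _ => Nat.le_add_right _ _

theorem zero_mem (hζ : IsCompleteCollection ζ) {m : MultiIndex} (h : m ∈ ζ) :
    (⟨0, 0, 0⟩ : MultiIndex) ∈ ζ :=
  hζ m h 0 0 ⟨⟨fun i => i.elim0, fun i => i.elim0⟩, fun {i} => i.elim0⟩ 0 (Nat.zero_le _)
    fun i => i.elim0

/-- Evaluation at a subset, in terms of any increasing enumeration of it. -/
theorem sub_eval (D : Family) (m : MultiIndex) (p : Finset (Fin m.n)) (j : ℕ) {k : ℕ}
    (e : Fin k → Fin m.n) (he : StrictMono e) (hp : p = Finset.univ.image e) (x : ℝ) (μ : P2)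
    (z : Fin m.n → ℝ) :
    D (m.sub p j) x μ (restr z p) = D ⟨k, j, fun i => m.β (e i)⟩ x μ (fun i => z (e i)) := by
  obtain rfl : p.card = k := by
    rw [hp, Finset.card_image_of_injective _ he.injective, Finset.card_univ, Fintype.card_fin]
  obtain rfl : e = p.orderEmbOfFin rfl :=
    Finset.orderEmbOfFin_unique rfl
      (fun i => hp.ge (Finset.mem_image_of_mem e (Finset.mem_univ i))) he
  rfl

theorem sub_eval_univ (D : Family) (m : MultiIndex) (j : ℕ) (x : ℝ) (μ : P2) (z : Fin m.n → ℝ) :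
    D (m.sub Finset.univ j) x μ (restr z Finset.univ) = D ⟨m.n, j, m.β⟩ x μ z :=
  sub_eval D m _ j id strictMono_id (by simp) x μ z

theorem sub_eval_empty (D : Family) (m : MultiIndex) (j : ℕ) (x : ℝ) (μ : P2) (z : Fin m.n → ℝ) :
    D (m.sub ∅ j) x μ (restr z ∅) = D ⟨0, j, 0⟩ x μ 0 := by
  have e1 : (fun i : Fin 0 => m.β i.elim0) = 0 := funext fun i => i.elim0
  have e2 : (fun i : Fin 0 => z i.elim0) = 0 := funext fun i => i.elim0
  rw [sub_eval D m ∅ j (k := 0) (fun i => i.elim0) (fun i => i.elim0) (by simp), e1, e2]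

/-- Removing the truncation. -/
theorem sum_transferCoeff_mul {n : ℕ} (l : ℕ) (T : Finset (Fin n) → ℕ → ℝ) :
    ∑ p : Finset (Fin n), ∑ j ∈ Finset.range (l + 1), (transferCoeff p.card j l : ℝ) * T p j =
      (∑ p : Finset (Fin n), ∑ j ∈ Finset.range (l + 1), (l.choose j : ℝ) * T p j) - T ∅ 0 := by
  have e : ∀ (p : Finset (Fin n)) j, (transferCoeff p.card j l : ℝ) * T p j =
      (l.choose j : ℝ) * T p j - if p = ∅ then (if j = 0 then T p j else 0) else 0 := by
    intro p j
    rw [transferCoeff]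
    by_cases hp : p = ∅ <;> by_cases hj : j = 0 <;> simp [hp, hj]
  simp_rw [e, Finset.sum_sub_distrib]
  congr 1
  have : ∀ p : Finset (Fin n), (∑ j ∈ Finset.range (l + 1),
      if p = ∅ then (if j = 0 then T p j else 0) else 0) = if p = ∅ then T p 0 else 0 := by
    intro p
    split_ifs with h
    · rw [Finset.sum_ite_eq' (Finset.range (l + 1)) 0 (T p)]; simp
    · simp
  rw [Finset.sum_congr rfl fun p _ => this p, Finset.sum_ite_eq']
  simp

theorem HasDerivAt.transferCoeff_mul {u : ℝ → ℝ} {u' x : ℝ} {k j l : ℕ}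
    (h : ¬ (k = 0 ∧ j = 0) → HasDerivAt u u' x) :
    HasDerivAt (fun s => (transferCoeff k j l : ℝ) * u s) ((transferCoeff k j l : ℝ) * u') x := by
  by_cases h0 : k = 0 ∧ j = 0
  · simpa [transferCoeff, h0] using hasDerivAt_const x (0 : ℝ)
  · exact (h h0).const_mul _

variable {F G : ℝ → P2 → ℝ} {D E : Family}

/-- By Pascal's rule the full Leibniz sums differentiate into each other. The term omitted at level
`l` would have produced two terms: the one with all derivatives on `G` is omitted at level `l + 1`
as well, the other one is the correction subtracted here. -/
theorem leib_deriv_x (hζ : IsCompleteCollection ζ) (hD : IsDerivFamily ζ F D)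
    (hE : IsDerivFamily (removeMax ζ) G E) {n l : ℕ} (hm : (⟨n, l + 1, 0⟩ : MultiIndex) ∈ ζ)
    (x : ℝ) (μ : P2) (z : Fin n → ℝ) :
    HasDerivAt (fun s => leib D E ⟨n, l, 0⟩ s μ z)
      (leib D E ⟨n, l + 1, 0⟩ x μ z - D ⟨0, 1, 0⟩ x μ 0 * E ⟨n, l, 0⟩ x μ z) x := by
  set m : MultiIndex := ⟨n, l, 0⟩ with hmdef
  set A : Finset (Fin n) → ℕ → ℝ → ℝ := fun p j s => D (m.sub p j) s μ (restr z p) with hA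
  set B : Finset (Fin n) → ℕ → ℝ → ℝ := fun p j s => E (m.sub pᶜ j) s μ (restr z pᶜ) with hB
  have hterm : HasDerivAt (fun s => ∑ p : Finset (Fin n), ∑ j ∈ Finset.range (l + 1),
      (transferCoeff p.card j l : ℝ) * (A p j s * B p (l - j) s))
      (∑ p : Finset (Fin n), ∑ j ∈ Finset.range (l + 1), (transferCoeff p.card j l : ℝ) *
        (A p (j + 1) x * B p (l - j) x + A p j x * B p (l + 1 - j) x)) x := by
    refine HasDerivAt.fun_sum fun p _ => HasDerivAt.fun_sum fun j hj =>
      HasDerivAt.transferCoeff_mul fun h0 => ?_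
    have hj' : j ≤ l := Nat.lt_succ_iff.1 (Finset.mem_range.1 hj)
    have hs : l + 1 - j = l - j + 1 := by omega
    have m1 : (⟨p.card, j + 1, 0⟩ : MultiIndex) ∈ ζ := sub_mem hζ hm p (Nat.succ_le_succ hj')
    have m2 : (⟨pᶜ.card, l - j + 1, 0⟩ : MultiIndex) ∈ removeMax ζ :=
      hs ▸ sub_compl_mem hζ hm p (Nat.le_succ_of_le hj') h0
    rw [hs]
    exact (hD.deriv_x _ _ m1 x μ (restr z p)).mul (hE.deriv_x _ _ m2 x μ (restr z pᶜ))
  refine HasDerivAt.congr_deriv (f := fun s => leib D E ⟨n, l, 0⟩ s μ z) hterm (Eq.symm ?_)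
  have e1 : leib D E ⟨n, l + 1, 0⟩ x μ z = ∑ p : Finset (Fin n), ∑ j ∈ Finset.range (l + 1 + 1),
      (transferCoeff p.card j (l + 1) : ℝ) * (A p j x * B p (l + 1 - j) x) := rfl
  rw [e1, sum_transferCoeff_mul (l + 1) fun p j => A p j x * B p (l + 1 - j) x,
    sum_transferCoeff_mul l fun p j => A p (j + 1) x * B p (l - j) x + A p j x * B p (l + 1 - j) x]
  have e2 : A ∅ (0 + 1) x = D ⟨0, 1, 0⟩ x μ 0 := sub_eval_empty D m 1 x μ z
  have e3 : B ∅ (l - 0) x = E ⟨n, l, 0⟩ x μ z := by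
    have := sub_eval_univ E m l x μ z
    rw [← Finset.compl_empty] at this
    exact this
  rw [e2, e3]
  have e4 : ∀ p : Finset (Fin n), ∑ j ∈ Finset.range (l + 1 + 1),
      ((l + 1).choose j : ℝ) * (A p j x * B p (l + 1 - j) x) =
      ∑ j ∈ Finset.range (l + 1), (l.choose j : ℝ) *
        (A p (j + 1) x * B p (l - j) x + A p j x * B p (l + 1 - j) x) := by
    intro p
    have := Finset.sum_choose_succ_mul (fun i j => A p i x * B p j x) l
    rw [this, ← Finset.sum_add_distrib]
    refine Finset.sum_congr rfl fun j _ => by ring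
  rw [Finset.sum_congr rfl fun p _ => e4 p]
  simp only [Nat.sub_zero]
  ring

theorem restr_update_of_mem {n : ℕ} (z : Fin n → ℝ) {p : Finset (Fin n)} (k : Fin p.card) (s : ℝ) :
    restr (Function.update z (p.orderEmbOfFin rfl k) s) p = Function.update (restr z p) k s := by
  ext i
  simp only [restr, Function.update_apply]
  simp

theorem restr_update_of_notMem {n : ℕ} (z : Fin n → ℝ) {p : Finset (Fin n)} {i : Fin n}
    (hi : i ∉ p) (s : ℝ) : restr (Function.update z i s) p = restr z p := by
  ext k
  simp only [restr]
  rw [Function.update_of_ne]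
  rintro rfl
  exact hi (Finset.orderEmbOfFin_mem p rfl k)

theorem restrict_add_single_of_notMem {n : ℕ} {β : Fin n → ℕ} {p : Finset (Fin n)} {i : Fin n}
    (hi : i ∉ p) : (fun r => (β + Pi.single i 1 : Fin n → ℕ) (p.orderEmbOfFin rfl r)) =
      fun r => β (p.orderEmbOfFin rfl r) := by
  ext k
  rw [Pi.add_apply, Pi.single_apply, if_neg, add_zero]
  intro h
  exact hi (h ▸ Finset.orderEmbOfFin_mem p rfl k)

theorem restrict_add_single_of_mem {n : ℕ} {β : Fin n → ℕ} {p : Finset (Fin n)} (k : Fin p.card) :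
    (fun r => (β + Pi.single (p.orderEmbOfFin rfl k) 1 : Fin n → ℕ) (p.orderEmbOfFin rfl r)) =
      (fun r => β (p.orderEmbOfFin rfl r)) + Pi.single k 1 := by
  ext i
  simp only [Pi.add_apply, Pi.single_apply]
  simp

/-- Enumerating `p` increasingly preserves the rule that the variables are differentiated from the
last to the first. -/
theorem sub_deriv_z {ξ : Set MultiIndex} (hD : IsDerivFamily ξ F D) {n l : ℕ} {β : Fin n → ℕ}
    {i : Fin n} (hi : ∀ j < i, β j = 0) {p : Finset (Fin n)} (hp : i ∈ p) {j : ℕ}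
    (hm : (⟨n, l, β + Pi.single i 1⟩ : MultiIndex).sub p j ∈ ξ) (x : ℝ) (μ : P2)
    (z : Fin n → ℝ) :
    HasDerivAt (fun s => D ((⟨n, l, β⟩ : MultiIndex).sub p j) x μ (restr (Function.update z i s) p))
      (D ((⟨n, l, β + Pi.single i 1⟩ : MultiIndex).sub p j) x μ (restr z p)) (z i) := by
  obtain ⟨k, rfl⟩ : ∃ k, p.orderEmbOfFin rfl k = i := by
    have : i ∈ Set.range (p.orderEmbOfFin rfl) := by rw [Finset.range_orderEmbOfFin]; exact hp
    exact this
  have hb := restrict_add_single_of_mem (β := β) k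
  have hm' : (⟨p.card, j, fun r => (β + Pi.single (p.orderEmbOfFin rfl k) 1 : Fin n → ℕ)
    (p.orderEmbOfFin rfl r)⟩ : MultiIndex) ∈ ξ := hm
  rw [hb] at hm'
  have key := hD.deriv_z p.card j (fun i => β (p.orderEmbOfFin rfl i)) k
    (fun i' hi' => hi _ ((p.orderEmbOfFin rfl).strictMono hi')) hm' x μ (restr z p)
  simp_rw [restr_update_of_mem]
  exact key.congr_deriv
    (congrArg (fun b : Fin p.card → ℕ => D ⟨p.card, j, b⟩ x μ (restr z p)) hb).symm

/-- Each variable `z i` occurs in exactly one of the two factors, and the coefficients ignore `β`;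
hence no correction term appears. -/
theorem leib_deriv_z (hζ : IsCompleteCollection ζ) (hD : IsDerivFamily ζ F D)
    (hE : IsDerivFamily (removeMax ζ) G E) {n l : ℕ} {β : Fin n → ℕ} {i : Fin n}
    (hi : ∀ j < i, β j = 0) (hm : (⟨n, l, β + Pi.single i 1⟩ : MultiIndex) ∈ ζ)
    (x : ℝ) (μ : P2) (z : Fin n → ℝ) :
    HasDerivAt (fun s => leib D E ⟨n, l, β⟩ x μ (Function.update z i s))
      (leib D E ⟨n, l, β + Pi.single i 1⟩ x μ z) (z i) := by
  refine HasDerivAt.fun_sum fun p _ => HasDerivAt.fun_sum fun j hj =>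
      HasDerivAt.transferCoeff_mul fun h0 => ?_
  have hj' : j ≤ l := Nat.lt_succ_iff.1 (Finset.mem_range.1 hj)
  have m1 := sub_mem hζ hm p hj'
  have m2 := sub_compl_mem hζ hm p hj' h0
  by_cases hp : i ∈ p
  · have hpc : i ∉ pᶜ := by simpa using hp
    have h1 := sub_deriv_z hD hi hp m1 x μ z
    have h2 : ∀ s, restr (Function.update z i s) pᶜ = restr z pᶜ := restr_update_of_notMem z hpc
    simp only [h2]
    have h3 := h1.mul_const (E ((⟨n, l, β⟩ : MultiIndex).sub pᶜ (l - j)) x μ (restr z pᶜ))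
    refine h3.congr_deriv (congrArg (_ * ·) ?_)
    exact (congrArg (fun b : Fin pᶜ.card → ℕ => E ⟨pᶜ.card, l - j, b⟩ x μ (restr z pᶜ))
      (restrict_add_single_of_notMem hpc)).symm
  · have hpc : i ∈ pᶜ := by simpa using hp
    have h1 := sub_deriv_z hE hi hpc m2 x μ z
    have h2 : ∀ s, restr (Function.update z i s) p = restr z p := restr_update_of_notMem z hp
    simp only [h2]
    have h3 := h1.const_mul (D ((⟨n, l, β⟩ : MultiIndex).sub p j) x μ (restr z p))
    refine h3.congr_deriv (congrArg (· * _) ?_)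
    exact (congrArg (fun b : Fin p.card → ℕ => D ⟨p.card, j, b⟩ x μ (restr z p))
      (restrict_add_single_of_notMem hp)).symm

theorem sum_finset_fin_succ {n : ℕ} (f : Finset (Fin (n + 1)) → ℝ) :
    ∑ p, f p = (∑ p : Finset (Fin n), f (p.map Fin.castSuccEmb)) +
      ∑ p : Finset (Fin n), f (insert (Fin.last n) (p.map Fin.castSuccEmb)) := by
  have h1 : (Finset.univ : Finset (Fin (n + 1))) =
      insert (Fin.last n) (Finset.univ.map Fin.castSuccEmb) := by
    rw [Fin.univ_castSuccEmb, Finset.cons_eq_insert]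
  rw [← Finset.powerset_univ, h1, Finset.sum_powerset_insert (by simp)]
  have h2 : (Finset.univ.map (Fin.castSuccEmb (n := n))).powerset =
      Finset.univ.map (Finset.mapEmbedding Fin.castSuccEmb).toEmbedding := by
    ext p
    simp only [Finset.mem_powerset, Finset.mem_map, Finset.mem_univ, true_and]
    rw [Finset.subset_map_iff]
    simp [eq_comm]
  rw [h2, Finset.sum_map, Finset.sum_map]
  simp

theorem compl_map_castSucc {n : ℕ} (p : Finset (Fin n)) :
    (p.map Fin.castSuccEmb)ᶜ = insert (Fin.last n) (pᶜ.map Fin.castSuccEmb) := by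
  ext i
  induction i using Fin.lastCases <;> simp

theorem compl_insert_last {n : ℕ} (p : Finset (Fin n)) :
    (insert (Fin.last n) (p.map Fin.castSuccEmb))ᶜ = pᶜ.map Fin.castSuccEmb := by
  ext i
  induction i using Fin.lastCases <;> simp

theorem sub_eval_castSucc (D : Family) {n : ℕ} (p : Finset (Fin n)) (j l : ℕ) (x : ℝ) (μ : P2)
    (z : Fin n → ℝ) (t : ℝ) :
    D ((⟨n + 1, l, 0⟩ : MultiIndex).sub (p.map Fin.castSuccEmb) j) x μ
      (restr (Fin.snoc z t) (p.map Fin.castSuccEmb)) = D ⟨p.card, j, 0⟩ x μ (restr z p) := by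
  rw [sub_eval D ⟨n + 1, l, 0⟩ (p.map Fin.castSuccEmb) j
    (fun i => (p.orderEmbOfFin rfl i).castSucc)
    ((Fin.strictMono_castSucc).comp (p.orderEmbOfFin rfl).strictMono)]
  · simp only [Fin.snoc_castSucc]; rfl
  · ext i
    simp only [Finset.mem_map, Finset.mem_image, Finset.mem_univ, true_and, Fin.castSuccEmb_apply]
    constructor
    · rintro ⟨k, hk, rfl⟩
      have : k ∈ Set.range (p.orderEmbOfFin rfl) := by rw [Finset.range_orderEmbOfFin]; exact hk
      obtain ⟨r, rfl⟩ := this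
      exact ⟨r, rfl⟩
    · rintro ⟨r, rfl⟩
      exact ⟨_, Finset.orderEmbOfFin_mem p rfl r, rfl⟩

theorem sub_eval_insert_last (D : Family) {n : ℕ} (p : Finset (Fin n)) (j l : ℕ) (x : ℝ) (μ : P2)
    (z : Fin n → ℝ) (t : ℝ) :
    D ((⟨n + 1, l, 0⟩ : MultiIndex).sub (insert (Fin.last n) (p.map Fin.castSuccEmb)) j) x μ
      (restr (Fin.snoc z t) (insert (Fin.last n) (p.map Fin.castSuccEmb))) =
      D ⟨p.card + 1, j, 0⟩ x μ (Fin.snoc (restr z p) t) := by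
  let e : Fin (p.card + 1) → Fin (n + 1) :=
    Fin.snoc (α := fun _ => Fin (n + 1)) (fun i => (p.orderEmbOfFin rfl i).castSucc) (Fin.last n)
  have hec : ∀ i : Fin p.card, e i.castSucc = (p.orderEmbOfFin rfl i).castSucc := fun i =>
    Fin.snoc_castSucc ..
  have hel : e (Fin.last _) = Fin.last n := Fin.snoc_last ..
  have he : StrictMono e := by
    intro i k hik
    induction k using Fin.lastCases with
    | last =>
      induction i using Fin.lastCases with
      | last => exact absurd hik (lt_irrefl _)
      | cast i => rw [hec, hel]; exact Fin.castSucc_lt_last _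
    | cast k =>
      induction i using Fin.lastCases with
      | last => exact absurd hik (not_lt.2 (Fin.le_last _))
      | cast i =>
        rw [hec, hec]
        exact Fin.castSucc_lt_castSucc_iff.2
          ((p.orderEmbOfFin rfl).strictMono (Fin.castSucc_lt_castSucc_iff.1 hik))
  rw [sub_eval D ⟨n + 1, l, 0⟩ _ j e he]
  · have : (fun i => (Fin.snoc z t : Fin (n + 1) → ℝ) (e i)) = Fin.snoc (restr z p) t := by
      ext i
      induction i using Fin.lastCases with
      | last => rw [hel]; simp
      | cast i => rw [hec]; simp [restr]
    rw [this]; rfl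
  · ext i
    simp only [Finset.mem_insert, Finset.mem_map, Finset.mem_image, Finset.mem_univ, true_and,
      Fin.castSuccEmb_apply]
    constructor
    · rintro (rfl | ⟨k, hk, rfl⟩)
      · exact ⟨Fin.last _, hel⟩
      · have : k ∈ Set.range (p.orderEmbOfFin rfl) := by rw [Finset.range_orderEmbOfFin]; exact hk
        obtain ⟨r, rfl⟩ := this
        exact ⟨r.castSucc, hec r⟩
    · rintro ⟨r, rfl⟩
      induction r using Fin.lastCases with
      | last => exact Or.inl hel
      | cast r => exact Or.inr ⟨_, Finset.orderEmbOfFin_mem p rfl r, (hec r).symm⟩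

theorem LiftDerivAt.transferCoeff_mul {Ω : Type} [MeasurableSpace Ω] {P : Measure Ω}
    [IsProbabilityMeasure P] {X : Lp ℝ 2 P} {u : P2 → ℝ} {U : ℝ → ℝ} {k j l : ℕ}
    (h : ¬ (k = 0 ∧ j = 0) → LiftDerivAt u U X) :
    LiftDerivAt (fun μ => (transferCoeff k j l : ℝ) * u μ)
      (fun t => (transferCoeff k j l : ℝ) * U t) X := by
  by_cases h0 : k = 0 ∧ j = 0
  · simpa [transferCoeff, h0] using LiftDerivAt.const (X := X) (0 : ℝ)
  · exact (h h0).const_mul _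

/-- The measure derivative creates a last variable, which joins either `p` or its complement; this
is the splitting of subsets of `Fin (n + 1)` by membership of the last element. As for `x`, the
truncation at `p = ∅` leaves one correction term. -/
theorem leib_deriv_mu (hζ : IsCompleteCollection ζ) (hD : IsDerivFamily ζ F D)
    (hE : IsDerivFamily (removeMax ζ) G E) {n : ℕ} (hm : (⟨n + 1, 0, 0⟩ : MultiIndex) ∈ ζ)
    (x : ℝ) (z : Fin n → ℝ) {Ω : Type} [MeasurableSpace Ω] [StandardBorelSpace Ω] {P : Measure Ω}
    [IsProbabilityMeasure P] [NullSingletonClass P] (X : Lp ℝ 2 P) :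
    LiftDerivAt (fun μ => leib D E ⟨n, 0, 0⟩ x μ z)
      (fun t => leib D E ⟨n + 1, 0, 0⟩ x (law X) (Fin.snoc z t) -
        D ⟨1, 0, 0⟩ x (law X) (fun _ => t) * E ⟨n, 0, 0⟩ x (law X) z) X := by
  have hm0 := mem_of_mu hζ hm
  set A : Finset (Fin n) → P2 → ℝ := fun p μ => D ⟨p.card, 0, 0⟩ x μ (restr z p) with hA
  set B : Finset (Fin n) → P2 → ℝ := fun p μ => E ⟨pᶜ.card, 0, 0⟩ x μ (restr z pᶜ) with hB
  set A' : Finset (Fin n) → ℝ → ℝ := fun p t =>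
    D ⟨p.card + 1, 0, 0⟩ x (law X) (Fin.snoc (restr z p) t) with hA'
  set B' : Finset (Fin n) → ℝ → ℝ := fun p t =>
    E ⟨pᶜ.card + 1, 0, 0⟩ x (law X) (Fin.snoc (restr z pᶜ) t) with hB'
  have hterm : LiftDerivAt (fun μ => ∑ p : Finset (Fin n), ∑ j ∈ Finset.range (0 + 1),
      (transferCoeff p.card j 0 : ℝ) * (A p μ * B p μ))
      (fun t => ∑ p : Finset (Fin n), ∑ j ∈ Finset.range (0 + 1), (transferCoeff p.card j 0 : ℝ) *
        (A' p t * B p (law X) + A p (law X) * B' p t)) X := by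
    refine LiftDerivAt.sum fun p _ => LiftDerivAt.sum fun j hj =>
      LiftDerivAt.transferCoeff_mul fun h0 => ?_
    obtain rfl : j = 0 := by simpa using hj
    have hp : p.card ≠ 0 := by simpa using h0
    have m1 : (⟨p.card + 1, 0, 0⟩ : MultiIndex) ∈ ζ := by
      have := sub_mem hζ hm (insert (Fin.last n) (p.map Fin.castSuccEmb)) (Nat.zero_le _)
      have hc : (insert (Fin.last n) (p.map Fin.castSuccEmb)).card = p.card + 1 := by
        rw [Finset.card_insert_of_notMem (by simp), Finset.card_map]
      have e : (⟨n + 1, 0, 0⟩ : MultiIndex).sub (insert (Fin.last n) (p.map Fin.castSuccEmb)) 0 =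
        ⟨(insert (Fin.last n) (p.map Fin.castSuccEmb)).card, 0, 0⟩ := rfl
      rwa [e, hc] at this
    have m2 : (⟨pᶜ.card + 1, 0, 0⟩ : MultiIndex) ∈ removeMax ζ := by
      have := sub_compl_mem hζ hm (p.map Fin.castSuccEmb) (Nat.zero_le _) (by simpa using hp)
      rw [compl_map_castSucc] at this
      have hc : (insert (Fin.last n) (pᶜ.map Fin.castSuccEmb)).card = pᶜ.card + 1 := by
        rw [Finset.card_insert_of_notMem (by simp), Finset.card_map]
      have e : (⟨n + 1, 0, 0⟩ : MultiIndex).sub (insert (Fin.last n) (pᶜ.map Fin.castSuccEmb))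
        (0 - 0) = ⟨(insert (Fin.last n) (pᶜ.map Fin.castSuccEmb)).card, 0, 0⟩ := rfl
      rwa [e, hc] at this
    have d1 : LiftDerivAt (A p) (A' p) X := hD.deriv_mu _ m1 x (restr z p) Ω P X
    have d2 : LiftDerivAt (B p) (B' p) X := hE.deriv_mu _ m2 x (restr z pᶜ) Ω P X
    exact d1.mul d2
  refine hterm.congr (fun μ => Finset.sum_congr rfl fun p _ => Finset.sum_congr rfl
    fun j hj => ?_) fun t => ?_
  · obtain rfl : j = 0 := by simpa using hj
    rfl
  rw [sum_transferCoeff_mul 0 fun p _ => A' p t * B p (law X) + A p (law X) * B' p t]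
  have e1 : leib D E ⟨n + 1, 0, 0⟩ x (law X) (Fin.snoc z t) =
      ∑ p : Finset (Fin (n + 1)), ∑ j ∈ Finset.range (0 + 1), (transferCoeff p.card j 0 : ℝ) *
        (D ((⟨n + 1, 0, 0⟩ : MultiIndex).sub p j) x (law X) (restr (Fin.snoc z t) p) *
          E ((⟨n + 1, 0, 0⟩ : MultiIndex).sub pᶜ (0 - j)) x (law X)
            (restr (Fin.snoc z t) pᶜ)) := rfl
  rw [e1, sum_transferCoeff_mul 0 fun p j =>
    D ((⟨n + 1, 0, 0⟩ : MultiIndex).sub p j) x (law X) (restr (Fin.snoc z t) p) *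
      E ((⟨n + 1, 0, 0⟩ : MultiIndex).sub pᶜ (0 - j)) x (law X) (restr (Fin.snoc z t) pᶜ)]
  simp only [zero_add, Finset.sum_range_one, Nat.choose_self, Nat.cast_one, one_mul, Nat.sub_zero]
  rw [sum_finset_fin_succ]
  have c1 : ∀ p : Finset (Fin n), E ((⟨n + 1, 0, 0⟩ : MultiIndex).sub (p.map Fin.castSuccEmb)ᶜ 0) x
      (law X) (restr (Fin.snoc z t) (p.map Fin.castSuccEmb)ᶜ) = B' p t := fun p => by
    rw [compl_map_castSucc]; exact sub_eval_insert_last E pᶜ 0 0 x (law X) z t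
  have c2 : ∀ p : Finset (Fin n), E ((⟨n + 1, 0, 0⟩ : MultiIndex).sub
      (insert (Fin.last n) (p.map Fin.castSuccEmb))ᶜ 0) x (law X)
      (restr (Fin.snoc z t) (insert (Fin.last n) (p.map Fin.castSuccEmb))ᶜ) = B p (law X) :=
    fun p => by rw [compl_insert_last]; exact sub_eval_castSucc E pᶜ 0 0 x (law X) z t
  simp only [c1, c2, sub_eval_castSucc, sub_eval_insert_last]
  have e2 : D ((⟨n + 1, 0, 0⟩ : MultiIndex).sub ∅ 0) x (law X) (restr (Fin.snoc z t) ∅) *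
      E ((⟨n + 1, 0, 0⟩ : MultiIndex).sub ∅ᶜ 0) x (law X) (restr (Fin.snoc z t) ∅ᶜ) =
      A ∅ (law X) * B' ∅ t := by
    have h1 := sub_eval_castSucc D (∅ : Finset (Fin n)) 0 0 x (law X) z t
    have h2 := sub_eval_insert_last E (∅ : Finset (Fin n))ᶜ 0 0 x (law X) z t
    rw [← compl_map_castSucc] at h2
    rw [Finset.map_empty] at h1 h2
    rw [h1, h2]
  have e3 : A' ∅ t = D ⟨1, 0, 0⟩ x (law X) fun _ => t := by
    rw [hA']
    change D ⟨0 + 1, 0, 0⟩ x (law X) _ = _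
    congr 1
  have e4 : B ∅ (law X) = E ⟨n, 0, 0⟩ x (law X) z := by
    have := sub_eval_univ E ⟨n, 0, 0⟩ 0 x (law X) z
    rw [← Finset.compl_empty] at this
    exact this
  rw [e2, e3, e4, Finset.sum_add_distrib]
  ring

/-! ### Polynomial growth -/

/-- At most polynomial growth, uniformly in a parameter. -/
def UnifPolyGrowth {ι : Type*} (G : ι → ℝ → ℝ) : Prop :=
  ∃ (C : ℝ) (k : ℕ), ∀ i y, |G i y| ≤ C * (1 + |y| ^ k)

section Growth

variable {ι : Type*} {G G₁ G₂ : ι → ℝ → ℝ}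

theorem pow_le_one_add_pow {t : ℝ} (ht : 0 ≤ t) {k m : ℕ} (h : k ≤ m) : t ^ k ≤ 1 + t ^ m := by
  rcases le_total t 1 with h1 | h1
  · linarith [pow_le_one₀ (n := k) ht h1, pow_nonneg ht m]
  · linarith [pow_le_pow_right₀ h1 h]

theorem UnifPolyGrowth.nonneg_const (h : UnifPolyGrowth G) :
    ∃ (C : ℝ) (k : ℕ), 0 ≤ C ∧ ∀ i y, |G i y| ≤ C * (1 + |y| ^ k) := by
  obtain ⟨C, k, h⟩ := h
  exact ⟨|C|, k, abs_nonneg C, fun i y => (h i y).trans (by gcongr; exact le_abs_self C)⟩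

theorem UnifPolyGrowth.mul (h₁ : UnifPolyGrowth G₁) (h₂ : UnifPolyGrowth G₂) :
    UnifPolyGrowth fun i y => G₁ i y * G₂ i y := by
  obtain ⟨C₁, k₁, c₁, h₁⟩ := h₁.nonneg_const
  obtain ⟨C₂, k₂, c₂, h₂⟩ := h₂.nonneg_const
  refine ⟨C₁ * C₂ * 3, k₁ + k₂, fun i y => ?_⟩
  rw [abs_mul]
  refine (mul_le_mul (h₁ i y) (h₂ i y) (abs_nonneg _) (by positivity)).trans ?_
  have e1 := pow_le_one_add_pow (abs_nonneg y) (Nat.le_add_right k₁ k₂)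
  have e2 := pow_le_one_add_pow (abs_nonneg y) (Nat.le_add_left k₂ k₁)
  have : (1 + |y| ^ k₁) * (1 + |y| ^ k₂) ≤ 3 * (1 + |y| ^ (k₁ + k₂)) := by
    have e : |y| ^ k₁ * |y| ^ k₂ = |y| ^ (k₁ + k₂) := (pow_add _ _ _).symm
    nlinarith
  calc _ = C₁ * C₂ * ((1 + |y| ^ k₁) * (1 + |y| ^ k₂)) := by ring
    _ ≤ C₁ * C₂ * (3 * (1 + |y| ^ (k₁ + k₂))) := by gcongr
    _ = _ := by ring

theorem UnifPolyGrowth.add (h₁ : UnifPolyGrowth G₁) (h₂ : UnifPolyGrowth G₂) :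
    UnifPolyGrowth fun i y => G₁ i y + G₂ i y := by
  obtain ⟨C₁, k₁, c₁, h₁⟩ := h₁.nonneg_const
  obtain ⟨C₂, k₂, c₂, h₂⟩ := h₂.nonneg_const
  refine ⟨2 * (C₁ + C₂), k₁ + k₂, fun i y => ?_⟩
  refine ((abs_add_le _ _).trans (add_le_add (h₁ i y) (h₂ i y))).trans ?_
  have e1 := pow_le_one_add_pow (abs_nonneg y) (Nat.le_add_right k₁ k₂)
  have e2 := pow_le_one_add_pow (abs_nonneg y) (Nat.le_add_left k₂ k₁)
  have e3 : (0 : ℝ) ≤ |y| ^ (k₁ + k₂) := by positivity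
  nlinarith

theorem UnifPolyGrowth.abs (h : UnifPolyGrowth G) : UnifPolyGrowth fun i y => |G i y| := by
  obtain ⟨C, k, h⟩ := h
  exact ⟨C, k, fun i y => (abs_abs _).trans_le (h i y)⟩

theorem UnifPolyGrowth.const (c : ℝ) : UnifPolyGrowth fun (_ : ι) _ => c :=
  ⟨|c|, 0, fun _ _ => by simp; linarith [abs_nonneg c]⟩

theorem UnifPolyGrowth.sub (h₁ : UnifPolyGrowth G₁) (h₂ : UnifPolyGrowth G₂) :
    UnifPolyGrowth fun i y => G₁ i y - G₂ i y := by
  convert h₁.add ((UnifPolyGrowth.const (-1)).mul h₂) using 3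
  ring

theorem UnifPolyGrowth.sum {κ : Type*} {s : Finset κ} {G : κ → ι → ℝ → ℝ}
    (h : ∀ j ∈ s, UnifPolyGrowth (G j)) : UnifPolyGrowth fun i y => ∑ j ∈ s, G j i y := by
  classical
  induction s using Finset.induction_on with
  | empty => simpa using UnifPolyGrowth.const (ι := ι) 0
  | insert j s hj ih =>
    simp only [Finset.sum_insert hj]
    exact (h j (Finset.mem_insert_self j s)).add (ih fun r hr => h r (Finset.mem_insert_of_mem hr))

theorem UnifPolyGrowth.comp {κ : Type*} (h : UnifPolyGrowth G) (e : κ → ι) :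
    UnifPolyGrowth fun j => G (e j) := by
  obtain ⟨C, k, h⟩ := h
  exact ⟨C, k, fun j => h (e j)⟩

theorem FiniteMoments.integrable_of_growth {ρ : Measure ℝ} (hρ : FiniteMoments ρ)
    (h : UnifPolyGrowth G) (i : ι) (hm : Measurable (G i)) : Integrable (G i) ρ := by
  obtain ⟨C, k, h⟩ := h
  exact hρ.integrable hm.aestronglyMeasurable (h i)

theorem finiteMoments_Ioc (u v : ℝ) : FiniteMoments (volume.restrict (Set.Ioc u v)) := fun k =>
  (((continuous_abs.pow k).continuousOn).integrableOn_compact isCompact_Icc).mono_set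
    Set.Ioc_subset_Icc_self

theorem intervalIntegrable_of_growth (h : UnifPolyGrowth G) (i : ι) (hm : Measurable (G i))
    (u v : ℝ) : IntervalIntegrable (G i) volume u v :=
  ⟨(finiteMoments_Ioc u v).integrable_of_growth h i hm,
    (finiteMoments_Ioc v u).integrable_of_growth h i hm⟩

end Growth

/-! ### Joint continuity -/

section Cont

variable {E E' : Type} [TopologicalSpace E] [TopologicalSpace E'] {F F₁ F₂ : E → P2 → ℝ}

theorem ContinuousW2.comp_param (h : ContinuousW2 F) {φ : E' → E} (hφ : Continuous φ) :
    ContinuousW2 fun e μ => F (φ e) μ := fun e μ =>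
  (h (φ e) μ).comp (((hφ.tendsto e).comp tendsto_fst).prodMk tendsto_snd)

theorem ContinuousW2.add (h₁ : ContinuousW2 F₁) (h₂ : ContinuousW2 F₂) :
    ContinuousW2 fun e μ => F₁ e μ + F₂ e μ := fun e μ => (h₁ e μ).add (h₂ e μ)

theorem ContinuousW2.sub (h₁ : ContinuousW2 F₁) (h₂ : ContinuousW2 F₂) :
    ContinuousW2 fun e μ => F₁ e μ - F₂ e μ := fun e μ => (h₁ e μ).sub (h₂ e μ)

theorem ContinuousW2.mul (h₁ : ContinuousW2 F₁) (h₂ : ContinuousW2 F₂) :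
    ContinuousW2 fun e μ => F₁ e μ * F₂ e μ := fun e μ => (h₁ e μ).mul (h₂ e μ)

theorem ContinuousW2.const (c : ℝ) : ContinuousW2 fun (_ : E) _ => c := fun _ _ =>
  tendsto_const_nhds

theorem ContinuousW2.sum {κ : Type*} {s : Finset κ} {F : κ → E → P2 → ℝ}
    (h : ∀ j ∈ s, ContinuousW2 (F j)) : ContinuousW2 fun e μ => ∑ j ∈ s, F j e μ := fun e μ =>
  tendsto_finsetSum s fun j hj => h j hj e μ

/-- An integral with a jointly continuous integrand against a continuous family of measures is
jointly continuous. -/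
theorem continuousW2_integral [FirstCountableTopology E] {F : E → ℝ → P2 → ℝ}
    {ρ : E → P2 → Measure ℝ}
    (hρ : ∀ e μ, TVConv (𝓝 e ×ˢ nhdsW2 μ) (fun q : E × P2 => ρ q.1 q.2) (ρ e μ))
    (hm : ∀ e μ, FiniteMoments (ρ e μ)) (hF : ∀ y, ContinuousW2 fun e μ => F e y μ)
    (hmeas : ∀ e μ, Measurable fun y => F e y μ)
    (hg : UnifPolyGrowth fun (q : E × P2) y => F q.1 y q.2) :
    ContinuousW2 fun e μ => ∫ y, F e y μ ∂(ρ e μ) := by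
  intro e μ
  obtain ⟨C, k, h⟩ := hg
  exact (hρ e μ).tendsto_integral (hm e μ) (G := fun q y => F q.1 y q.2) (fun q => hmeas _ _) h
    fun y => hF y e μ

end Cont

/-! ### Differentiation of the relation `G₁(y₂) - G₁(y₁) = ∫ G₂` in the parameters -/

section Families

variable {ξ : Set MultiIndex} {G : ℝ → ℝ → P2 → ℝ}
  {D : (m : MultiIndex) → ℝ → ℝ → P2 → (Fin m.n → ℝ) → ℝ}

theorem MemMp.unifPolyGrowth (h : MemMp ξ G D) {m : MultiIndex} (hm : m ∈ ξ) :
    UnifPolyGrowth fun (q : ℝ × P2 × (Fin m.n → ℝ)) y => D m q.1 y q.2.1 q.2.2 := by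
  obtain ⟨C, k, h⟩ := h.growth m hm
  exact ⟨C, k, fun q y => h q.1 y q.2.1 q.2.2⟩

theorem HasLionsDeriv.liftDerivAt {u : P2 → ℝ} {U : P2 → ℝ → ℝ} (h : HasLionsDeriv u U)
    {Ω : Type} [MeasurableSpace Ω] [StandardBorelSpace Ω] {P : Measure Ω}
    [IsProbabilityMeasure P] [NullSingletonClass P] (X : Lp ℝ 2 P) :
    LiftDerivAt u (U (law X)) X := h Ω P X

theorem continuous_snoc {n : ℕ} (z : Fin n → ℝ) :
    Continuous fun t : ℝ => (Fin.snoc z t : Fin (n + 1) → ℝ) := by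
  refine continuous_pi fun i => ?_
  induction i using Fin.lastCases with
  | last => simpa using continuous_id'
  | cast i => simpa using continuous_const

theorem MemMp.continuousW2_snoc (h : MemMp ξ G D) {n : ℕ}
    (hm : (⟨n + 1, 0, 0⟩ : MultiIndex) ∈ ξ) (x y : ℝ) (z : Fin n → ℝ) :
    ContinuousW2 fun t μ => D ⟨n + 1, 0, 0⟩ x y μ (Fin.snoc z t) :=
  ((h.family y).cont _ hm).comp_param (φ := fun t : ℝ => (x, (Fin.snoc z t : Fin (n + 1) → ℝ)))
    (continuous_const.prodMk (continuous_snoc z))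

/-- The parameter derivatives of `v_yy` are only known to be Borel in `y`, so they cannot be
recovered as classical `y`-derivatives of those of `v_y`. The integrated relation does survive
differentiation: Lebesgue measure on an interval is a constant family of measures, and derivatives
are unique. -/
theorem integral_relation_of_family {G₁ G₂ : ℝ → ℝ → P2 → ℝ}
    {D₁ D₂ : (m : MultiIndex) → ℝ → ℝ → P2 → (Fin m.n → ℝ) → ℝ} (hξ : IsCompleteCollection ξ)
    (h₁ : MemMp ξ G₁ D₁) (h₂ : MemMp ξ G₂ D₂) {y₁ y₂ : ℝ}
    (h0 : ∀ x μ, G₁ x y₂ μ - G₁ x y₁ μ = ∫ s in Set.Ioc y₁ y₂, G₂ x s μ) (n l : ℕ)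
    (hm : (⟨n, l, 0⟩ : MultiIndex) ∈ ξ) (x : ℝ) (μ : P2) (z : Fin n → ℝ) :
    D₁ ⟨n, l, 0⟩ x y₂ μ z - D₁ ⟨n, l, 0⟩ x y₁ μ z =
      ∫ s in Set.Ioc y₁ y₂, D₂ ⟨n, l, 0⟩ x s μ z := by
  have hfm := finiteMoments_Ioc y₁ y₂
  induction l generalizing x μ z with
  | zero =>
    induction n generalizing x μ with
    | zero =>
      rw [(h₁.family y₂).base hm, (h₁.family y₁).base hm, h0]
      simp_rw [fun s => (h₂.family s).base hm]
    | succ n ih =>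
      have hm' := mem_of_mu hξ hm
      have key : ∀ z : Fin n → ℝ, ∀ t : ℝ, D₁ ⟨n + 1, 0, 0⟩ x y₂ μ (Fin.snoc z t) -
          D₁ ⟨n + 1, 0, 0⟩ x y₁ μ (Fin.snoc z t) =
          ∫ s in Set.Ioc y₁ y₂, D₂ ⟨n + 1, 0, 0⟩ x s μ (Fin.snoc z t) := by
        intro z t
        refine HasLionsDeriv.unique (u := fun μ => D₁ ⟨n, 0, 0⟩ x y₂ μ z - D₁ ⟨n, 0, 0⟩ x y₁ μ z)
          (U := fun μ t => D₁ ⟨n + 1, 0, 0⟩ x y₂ μ (Fin.snoc z t) -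
            D₁ ⟨n + 1, 0, 0⟩ x y₁ μ (Fin.snoc z t))
          (V := fun μ t => ∫ s in Set.Ioc y₁ y₂, D₂ ⟨n + 1, 0, 0⟩ x s μ (Fin.snoc z t))
          ?_ ?_ ?_ ?_ μ t
        · intro Ω _ _ P _ _ X
          exact (((h₁.family y₂).deriv_mu n hm x z).liftDerivAt X).sub
            (((h₁.family y₁).deriv_mu n hm x z).liftDerivAt X)
        · intro Ω _ _ P _ _ X
          obtain ⟨C, k, hC⟩ := h₂.growth _ hm
          obtain ⟨C₀, k₀, hC₀⟩ := h₂.growth _ hm'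
          have := liftDerivAt_integral_of_tvConv (X := X)
            (TVConv.const (nhdsW2 (law X)) (volume.restrict (Set.Ioc y₁ y₂))) (fun _ => hfm)
            (Φ := fun μ s => D₂ ⟨n, 0, 0⟩ x s μ z)
            (U := fun μ s t => D₂ ⟨n + 1, 0, 0⟩ x s μ (Fin.snoc z t))
            (fun μ => h₂.meas _ hm' x μ z) (fun y => hC₀ x y (law X) z) (fun _ => rfl)
            (fun Y s => (h₂.family s).deriv_mu n hm x z Ω P Y)
            (fun t => h₂.meas _ hm x (law X) _)
            (fun s => continuous_of_continuousW2 (h₂.continuousW2_snoc hm x s z) (law X))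
            (fun μ s t => hC x s μ _)
          exact this.congr (fun μ => (ih hm' x μ z).symm) fun _ => rfl
        · exact (h₁.continuousW2_snoc hm x y₂ z).sub (h₁.continuousW2_snoc hm x y₁ z)
        · exact continuousW2_integral (ρ := fun _ _ => volume.restrict (Set.Ioc y₁ y₂))
            (F := fun t s μ => D₂ ⟨n + 1, 0, 0⟩ x s μ (Fin.snoc z t))
            (fun _ _ => TVConv.const _ _) (fun _ _ => hfm)
            (fun s => h₂.continuousW2_snoc hm x s z)
            (fun t μ => h₂.meas _ hm x μ _)
            ((h₂.unifPolyGrowth hm).comp fun q : ℝ × P2 => (x, q.2, Fin.snoc z q.1))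
      have := key (Fin.init z) (z (Fin.last n))
      rwa [Fin.snoc_init_self] at this
  | succ l ih =>
    have hm' : (⟨n, l, 0⟩ : MultiIndex) ∈ ξ := mem_of_le hξ hm (Nat.le_succ l) fun _ => le_rfl
    have d1 := ((h₁.family y₂).deriv_x n l hm x μ z).sub ((h₁.family y₁).deriv_x n l hm x μ z)
    obtain ⟨C, k, hC⟩ := h₂.growth _ hm
    obtain ⟨C₀, k₀, hC₀⟩ := h₂.growth _ hm'
    have d2 := hasDerivAt_integral_of_tvConv (x₀ := x)
      (TVConv.const (𝓝 x) (volume.restrict (Set.Ioc y₁ y₂))) (fun _ => hfm)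
      (Φ := fun x s => D₂ ⟨n, l, 0⟩ x s μ z) (Φ' := fun x s => D₂ ⟨n, l + 1, 0⟩ x s μ z)
      (fun x => h₂.meas _ hm' x μ z) (fun y => hC₀ x y μ z) (fun _ => rfl)
      (fun x s => (h₂.family s).deriv_x n l hm x μ z) (h₂.meas _ hm x μ z)
      (fun x s => hC x s μ z)
    refine d1.unique (d2.congr_of_eventuallyEq (Eventually.of_forall fun x => ?_))
    exact ih hm' x μ z

end Families

/-! ### The transfer formula for mixed derivatives -/

/-- The data of the transfer formula, together with the properties of the invariant measures that
its proof uses. -/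
structure TransferData (ζ : Set MultiIndex) (f a h : ℝ → ℝ → P2 → ℝ) (π : ℝ → P2 → Measure ℝ)
    (v : ℝ → ℝ → P2 → ℝ)
    (Dh Df Da Dv₁ Dv₂ : (m : MultiIndex) → ℝ → ℝ → P2 → (Fin m.n → ℝ) → ℝ) : Prop where
  complete : IsCompleteCollection ζ
  memh : MemMp ζ h Dh
  memf : MemMp ζ f Df
  mema : MemMp ζ a Da
  memv₁ : MemMp (removeMax ζ) (dy v) Dv₁
  memv₂ : MemMp (removeMax ζ) (dyy v) Dv₂
  prob : ∀ x μ, IsProbabilityMeasure (π x μ)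
  moments : ∀ x μ, FiniteMoments (π x μ)
  tv : ∀ x μ, TVConv (𝓝 x ×ˢ nhdsW2 μ) (fun q : ℝ × P2 => π q.1 q.2) (π x μ)
  weak : ∀ x μ (W w : ℝ → ℝ), Measurable w → UnifPolyGrowth (fun _ : Unit => W) →
    UnifPolyGrowth (fun _ : Unit => w) → (∀ y, W y = W 0 + ∫ s in (0 : ℝ)..y, w s) →
    ∫ y, (f x y μ * W y + a x y μ * w y) ∂(π x μ) = 0
  pois : IsPoissonSol f a h π v

section Poisson

variable {f a h v : ℝ → ℝ → P2 → ℝ} {π : ℝ → P2 → Measure ℝ}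

theorem IsPoissonSol.hasDerivAt_dy (hv : IsPoissonSol f a h π v) (x : ℝ) (μ : P2) (y : ℝ) :
    HasDerivAt (fun y => dy v x y μ) (dyy v x y μ) y := by
  have := (hv x μ).1
  rw [show (2 : WithTop ℕ∞) = 1 + 1 by norm_num, contDiff_succ_iff_deriv] at this
  exact (this.2.2.differentiable (by simp) y).hasDerivAt

theorem IsPoissonSol.continuous_dyy (hv : IsPoissonSol f a h π v) (x : ℝ) (μ : P2) :
    Continuous fun y => dyy v x y μ := by
  have := (hv x μ).1
  rw [show (2 : WithTop ℕ∞) = 1 + 1 by norm_num, contDiff_succ_iff_deriv] at this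
  exact this.2.2.continuous_deriv le_rfl

theorem IsPoissonSol.integral_dyy (hv : IsPoissonSol f a h π v) (x : ℝ) (μ : P2) (y₁ y₂ : ℝ) :
    ∫ s in y₁..y₂, dyy v x s μ = dy v x y₂ μ - dy v x y₁ μ :=
  intervalIntegral.integral_eq_sub_of_hasDerivAt (fun s _ => hv.hasDerivAt_dy x μ s)
    ((hv.continuous_dyy x μ).intervalIntegrable _ _)

end Poisson

theorem snoc_zero_eq (t : ℝ) :
    (Fin.snoc (0 : Fin 0 → ℝ) t : Fin (0 + 1) → ℝ) = fun _ => t := by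
  ext i
  rw [Subsingleton.elim (α := Fin 1) i (Fin.last 0)]
  exact Fin.snoc_last ..

/-! ### Growth, measurability and continuity of the Leibniz sums -/

section Closure

variable {ζ : Set MultiIndex} {F G : ℝ → ℝ → P2 → ℝ}
  {D E : (m : MultiIndex) → ℝ → ℝ → P2 → (Fin m.n → ℝ) → ℝ}

theorem leib_growth (hζ : IsCompleteCollection ζ) (hD : MemMp ζ F D)
    (hE : MemMp (removeMax ζ) G E) {m : MultiIndex} (hm : m ∈ ζ) :
    UnifPolyGrowth fun (q : ℝ × P2 × (Fin m.n → ℝ)) y =>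
      leib (fun m x => D m x y) (fun m x => E m x y) m q.1 q.2.1 q.2.2 := by
  refine UnifPolyGrowth.sum fun p _ => UnifPolyGrowth.sum fun j hj => ?_
  have hj' : j ≤ m.l := Nat.lt_succ_iff.1 (Finset.mem_range.1 hj)
  by_cases h0 : p.card = 0 ∧ j = 0
  · simpa [transferCoeff, h0] using UnifPolyGrowth.const (ι := ℝ × P2 × (Fin m.n → ℝ)) 0
  · refine (UnifPolyGrowth.const _).mul (UnifPolyGrowth.mul ?_ ?_)
    · exact (hD.unifPolyGrowth (sub_mem hζ hm p hj')).comp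
        fun q : ℝ × P2 × (Fin m.n → ℝ) => (q.1, q.2.1, restr q.2.2 p)
    · exact (hE.unifPolyGrowth (sub_compl_mem hζ hm p hj' h0)).comp
        fun q : ℝ × P2 × (Fin m.n → ℝ) => (q.1, q.2.1, restr q.2.2 pᶜ)

theorem leib_measurable (hζ : IsCompleteCollection ζ) (hD : MemMp ζ F D)
    (hE : MemMp (removeMax ζ) G E) {m : MultiIndex} (hm : m ∈ ζ) (x : ℝ) (μ : P2)
    (z : Fin m.n → ℝ) :
    Measurable fun y => leib (fun m x => D m x y) (fun m x => E m x y) m x μ z := by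
  refine Finset.measurable_fun_sum _ fun p _ => Finset.measurable_fun_sum _ fun j hj => ?_
  have hj' : j ≤ m.l := Nat.lt_succ_iff.1 (Finset.mem_range.1 hj)
  by_cases h0 : p.card = 0 ∧ j = 0
  · simp [transferCoeff, h0]
  · exact ((hD.meas _ (sub_mem hζ hm p hj') x μ _).mul
      (hE.meas _ (sub_compl_mem hζ hm p hj' h0) x μ _)).const_mul _

theorem continuous_restr {n : ℕ} (p : Finset (Fin n)) :
    Continuous fun z : Fin n → ℝ => restr z p :=
  continuous_pi fun _ => continuous_apply _

theorem leib_continuousW2 (hζ : IsCompleteCollection ζ) (hD : MemMp ζ F D)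
    (hE : MemMp (removeMax ζ) G E) {m : MultiIndex} (hm : m ∈ ζ) (y : ℝ) :
    ContinuousW2 fun (q : ℝ × (Fin m.n → ℝ)) μ =>
      leib (fun m x => D m x y) (fun m x => E m x y) m q.1 μ q.2 := by
  refine ContinuousW2.sum fun p _ => ContinuousW2.sum fun j hj => ?_
  have hj' : j ≤ m.l := Nat.lt_succ_iff.1 (Finset.mem_range.1 hj)
  by_cases h0 : p.card = 0 ∧ j = 0
  · simpa [transferCoeff, h0] using ContinuousW2.const (E := ℝ × (Fin m.n → ℝ)) 0
  · refine (ContinuousW2.const _).mul (ContinuousW2.mul ?_ ?_)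
    · exact ((hD.family y).cont _ (sub_mem hζ hm p hj')).comp_param
        (φ := fun q : ℝ × (Fin m.n → ℝ) => (q.1, restr q.2 p))
        (continuous_fst.prodMk ((continuous_restr p).comp continuous_snd))
    · exact ((hE.family y).cont _ (sub_compl_mem hζ hm p hj' h0)).comp_param
        (φ := fun q : ℝ × (Fin m.n → ℝ) => (q.1, restr q.2 pᶜ))
        (continuous_fst.prodMk ((continuous_restr pᶜ).comp continuous_snd))

end Closure

/-! ### Induction over the multi-indices -/

namespace TransferData

variable {ζ : Set MultiIndex} {f a h : ℝ → ℝ → P2 → ℝ} {π : ℝ → P2 → Measure ℝ}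
  {v : ℝ → ℝ → P2 → ℝ} {Dh Df Da Dv₁ Dv₂ : (m : MultiIndex) → ℝ → ℝ → P2 → (Fin m.n → ℝ) → ℝ}
  (T : TransferData ζ f a h π v Dh Df Da Dv₁ Dv₂)

include T

theorem growth {m : MultiIndex} (hm : m ∈ ζ) :
    UnifPolyGrowth fun (q : ℝ × P2 × (Fin m.n → ℝ)) y =>
      transferIntegrand Dh Df Da Dv₁ Dv₂ m q.1 y q.2.1 q.2.2 := by
  simp only [transferIntegrand_eq]
  exact (T.memh.unifPolyGrowth hm).sub ((leib_growth T.complete T.memf T.memv₁ hm).add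
    (leib_growth T.complete T.mema T.memv₂ hm))

theorem measurable {m : MultiIndex} (hm : m ∈ ζ) (x : ℝ) (μ : P2) (z : Fin m.n → ℝ) :
    Measurable fun y => transferIntegrand Dh Df Da Dv₁ Dv₂ m x y μ z := by
  simp only [transferIntegrand_eq]
  exact (T.memh.meas _ hm x μ z).sub ((leib_measurable T.complete T.memf T.memv₁ hm x μ z).add
    (leib_measurable T.complete T.mema T.memv₂ hm x μ z))

theorem continuousW2 {m : MultiIndex} (hm : m ∈ ζ) (y : ℝ) :
    ContinuousW2 fun (q : ℝ × (Fin m.n → ℝ)) μ =>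
      transferIntegrand Dh Df Da Dv₁ Dv₂ m q.1 y μ q.2 := by
  simp only [transferIntegrand_eq]
  exact ((T.memh.family y).cont _ hm).sub ((leib_continuousW2 T.complete T.memf T.memv₁ hm y).add
    (leib_continuousW2 T.complete T.mema T.memv₂ hm y))

theorem integrable {m : MultiIndex} (hm : m ∈ ζ) (x : ℝ) (μ : P2) (z : Fin m.n → ℝ) :
    Integrable (fun y => transferIntegrand Dh Df Da Dv₁ Dv₂ m x y μ z) (π x μ) :=
  (T.moments x μ).integrable_of_growth (T.growth hm) (x, μ, z) (T.measurable hm x μ z)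

theorem integral_continuousW2 {m : MultiIndex} (hm : m ∈ ζ) :
    ContinuousW2 fun (q : ℝ × (Fin m.n → ℝ)) μ =>
      ∫ y, transferIntegrand Dh Df Da Dv₁ Dv₂ m q.1 y μ q.2 ∂(π q.1 μ) := by
  refine continuousW2_integral (ρ := fun (q : ℝ × (Fin m.n → ℝ)) μ => π q.1 μ)
    (F := fun (q : ℝ × (Fin m.n → ℝ)) y μ => transferIntegrand Dh Df Da Dv₁ Dv₂ m q.1 y μ q.2)
    (fun q μ => ?_) (fun q μ => T.moments _ _) (fun y => T.continuousW2 hm y)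
    (fun q μ => T.measurable hm _ _ _)
    ((T.growth hm).comp fun r : (ℝ × (Fin m.n → ℝ)) × P2 => (r.1.1, r.2, r.1.2))
  exact (T.tv q.1 μ).comp (u := fun r : (ℝ × (Fin m.n → ℝ)) × P2 => (r.1.1, r.2))
    (((continuous_fst.tendsto q).comp tendsto_fst).prodMk tendsto_snd)

/-- The term added to the next integrand pairs one derivative of the coefficients with the family of
`v` at the present order: it is the correction of `leib_deriv_x`, with the sign of the subtracted
sums. -/
theorem integrand_deriv_x {n l : ℕ} (hm : (⟨n, l + 1, 0⟩ : MultiIndex) ∈ ζ) (x y : ℝ) (μ : P2)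
    (z : Fin n → ℝ) :
    HasDerivAt (fun s => transferIntegrand Dh Df Da Dv₁ Dv₂ ⟨n, l, 0⟩ s y μ z)
      (transferIntegrand Dh Df Da Dv₁ Dv₂ ⟨n, l + 1, 0⟩ x y μ z +
        (Df ⟨0, 1, 0⟩ x y μ 0 * Dv₁ ⟨n, l, 0⟩ x y μ z +
          Da ⟨0, 1, 0⟩ x y μ 0 * Dv₂ ⟨n, l, 0⟩ x y μ z)) x := by
  simp only [transferIntegrand_eq]
  refine HasDerivAt.congr_deriv (((T.memh.family y).deriv_x n l hm x μ z).sub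
    ((leib_deriv_x T.complete (T.memf.family y) (T.memv₁.family y) hm x μ z).add
    (leib_deriv_x T.complete (T.mema.family y) (T.memv₂.family y) hm x μ z))) ?_
  ring

theorem integrand_deriv_mu {n : ℕ} (hm : (⟨n + 1, 0, 0⟩ : MultiIndex) ∈ ζ) (x y : ℝ)
    (z : Fin n → ℝ) {Ω : Type} [MeasurableSpace Ω] [StandardBorelSpace Ω] {P : Measure Ω}
    [IsProbabilityMeasure P] [NullSingletonClass P] (X : Lp ℝ 2 P) :
    LiftDerivAt (fun μ => transferIntegrand Dh Df Da Dv₁ Dv₂ ⟨n, 0, 0⟩ x y μ z)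
      (fun t => transferIntegrand Dh Df Da Dv₁ Dv₂ ⟨n + 1, 0, 0⟩ x y (law X) (Fin.snoc z t) +
        (Df ⟨1, 0, 0⟩ x y (law X) (fun _ => t) * Dv₁ ⟨n, 0, 0⟩ x y (law X) z +
          Da ⟨1, 0, 0⟩ x y (law X) (fun _ => t) * Dv₂ ⟨n, 0, 0⟩ x y (law X) z)) X := by
  simp only [transferIntegrand_eq]
  refine ((((T.memh.family y).deriv_mu n hm x z).liftDerivAt X).sub
    ((leib_deriv_mu T.complete (T.memf.family y) (T.memv₁.family y) hm x z X).add
    (leib_deriv_mu T.complete (T.mema.family y) (T.memv₂.family y) hm x z X))).congr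
    (fun _ => rfl) fun t => ?_
  ring

theorem integrand_deriv_z {n l : ℕ} {β : Fin n → ℕ} {i : Fin n} (hi : ∀ j < i, β j = 0)
    (hm : (⟨n, l, β + Pi.single i 1⟩ : MultiIndex) ∈ ζ) (x y : ℝ) (μ : P2) (z : Fin n → ℝ) :
    HasDerivAt (fun s => transferIntegrand Dh Df Da Dv₁ Dv₂ ⟨n, l, β⟩ x y μ (Function.update z i s))
      (transferIntegrand Dh Df Da Dv₁ Dv₂ ⟨n, l, β + Pi.single i 1⟩ x y μ z) (z i) := by
  simp only [transferIntegrand_eq]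
  exact ((T.memh.family y).deriv_z n l β i hi hm x μ z).sub
    ((leib_deriv_z T.complete (T.memf.family y) (T.memv₁.family y) hi hm x μ z).add
    (leib_deriv_z T.complete (T.mema.family y) (T.memv₂.family y) hi hm x μ z))

theorem f_eq (hm : (⟨0, 0, 0⟩ : MultiIndex) ∈ ζ) : f = fun x y μ => Df ⟨0, 0, 0⟩ x y μ 0 := by
  ext x y μ; rw [(T.memf.family y).base hm]

theorem a_eq (hm : (⟨0, 0, 0⟩ : MultiIndex) ∈ ζ) : a = fun x y μ => Da ⟨0, 0, 0⟩ x y μ 0 := by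
  ext x y μ; rw [(T.mema.family y).base hm]

theorem measurable_f (hm : (⟨0, 0, 0⟩ : MultiIndex) ∈ ζ) (x : ℝ) (μ : P2) :
    Measurable fun y => f x y μ := by
  rw [T.f_eq hm]; exact T.memf.meas _ hm x μ 0

theorem measurable_a (hm : (⟨0, 0, 0⟩ : MultiIndex) ∈ ζ) (x : ℝ) (μ : P2) :
    Measurable fun y => a x y μ := by
  rw [T.a_eq hm]; exact T.mema.meas _ hm x μ 0

theorem growth_f (hm : (⟨0, 0, 0⟩ : MultiIndex) ∈ ζ) :
    UnifPolyGrowth fun (q : ℝ × P2) y => f q.1 y q.2 := by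
  rw [T.f_eq hm]
  exact (T.memf.unifPolyGrowth hm).comp fun q : ℝ × P2 => (q.1, q.2, 0)

theorem growth_a (hm : (⟨0, 0, 0⟩ : MultiIndex) ∈ ζ) :
    UnifPolyGrowth fun (q : ℝ × P2) y => a q.1 y q.2 := by
  rw [T.a_eq hm]
  exact (T.mema.unifPolyGrowth hm).comp fun q : ℝ × P2 => (q.1, q.2, 0)

/-- The derivatives of `v_y` and `v_yy` in the parameters are again related by integration. -/
theorem integral_relation {n l : ℕ} (hm : (⟨n, l, 0⟩ : MultiIndex) ∈ removeMax ζ) (x : ℝ) (μ : P2)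
    (z : Fin n → ℝ) (y : ℝ) :
    Dv₁ ⟨n, l, 0⟩ x y μ z = Dv₁ ⟨n, l, 0⟩ x 0 μ z + ∫ s in (0 : ℝ)..y, Dv₂ ⟨n, l, 0⟩ x s μ z := by
  have base : ∀ y₁ y₂, y₁ ≤ y₂ → ∀ x μ, dy v x y₂ μ - dy v x y₁ μ =
      ∫ s in Set.Ioc y₁ y₂, dyy v x s μ := fun y₁ y₂ hy x μ => by
    rw [← intervalIntegral.integral_of_le hy, T.pois.integral_dyy]
  have key := fun y₁ y₂ (hy : y₁ ≤ y₂) => integral_relation_of_family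
    (removeMax_complete T.complete) T.memv₁ T.memv₂ (base y₁ y₂ hy) n l hm x μ z
  rcases le_total 0 y with hy | hy
  · rw [intervalIntegral.integral_of_le hy, ← key 0 y hy]; ring
  · rw [intervalIntegral.integral_of_ge hy, ← key y 0 hy]; ring

/-- The test functions come from the base point `(x, μ)` and the coefficients and measure from
another point; this freedom is what allows the test functions to be frozen. -/
theorem weak_family {n l : ℕ} (hm : (⟨n, l, 0⟩ : MultiIndex) ∈ removeMax ζ) (x x' : ℝ)
    (μ μ' : P2) (z : Fin n → ℝ) :
    ∫ y, (f x' y μ' * Dv₁ ⟨n, l, 0⟩ x y μ z + a x' y μ' * Dv₂ ⟨n, l, 0⟩ x y μ z) ∂(π x' μ') = 0 :=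
  T.weak x' μ' (fun y => Dv₁ ⟨n, l, 0⟩ x y μ z) (fun y => Dv₂ ⟨n, l, 0⟩ x y μ z)
    (T.memv₂.meas _ hm x μ z) ((T.memv₁.unifPolyGrowth hm).comp fun _ => (x, μ, z))
    ((T.memv₂.unifPolyGrowth hm).comp fun _ => (x, μ, z)) fun y => T.integral_relation hm x μ z y

/-- The Poisson equation satisfied by the derivative of `v` with multi-index `(n, l, 0)`. -/
def PoissonAt (_ : TransferData ζ f a h π v Dh Df Da Dv₁ Dv₂) (n l : ℕ) : Prop :=
  ∀ (x : ℝ) (μ : P2) (z : Fin n → ℝ) (y : ℝ),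
    transferIntegrand Dh Df Da Dv₁ Dv₂ ⟨n, l, 0⟩ x y μ z -
      (f x y μ * Dv₁ ⟨n, l, 0⟩ x y μ z + a x y μ * Dv₂ ⟨n, l, 0⟩ x y μ z) =
    ∫ y, transferIntegrand Dh Df Da Dv₁ Dv₂ ⟨n, l, 0⟩ x y μ z ∂(π x μ)

theorem integrable_weak {n l : ℕ} (hm : (⟨n, l, 0⟩ : MultiIndex) ∈ removeMax ζ) (x x' : ℝ)
    (μ μ' : P2) (z : Fin n → ℝ) :
    Integrable (fun y => f x' y μ' * Dv₁ ⟨n, l, 0⟩ x y μ z + a x' y μ' * Dv₂ ⟨n, l, 0⟩ x y μ z)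
      (π x' μ') := by
  have h0 := zero_mem T.complete hm.1
  have g1 := (T.memv₁.unifPolyGrowth hm).comp fun _ : Unit => (x, μ, z)
  have g2 := (T.memv₂.unifPolyGrowth hm).comp fun _ : Unit => (x, μ, z)
  refine (T.moments x' μ').integrable_of_growth
    (((T.growth_f h0).comp fun _ => (x', μ')).mul g1 |>.add
      (((T.growth_a h0).comp fun _ => (x', μ')).mul g2)) () ?_
  exact ((T.measurable_f h0 x' μ').mul (T.memv₁.meas _ hm x μ z)).add
    ((T.measurable_a h0 x' μ').mul (T.memv₂.meas _ hm x μ z))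

/-- The integral of `transferIntegrand` does not change when a term with vanishing mean is
subtracted. -/
theorem integral_sub_weak {n l : ℕ} (hm : (⟨n, l, 0⟩ : MultiIndex) ∈ removeMax ζ) (x x' : ℝ)
    (μ μ' : P2) (z : Fin n → ℝ) :
    ∫ y, (transferIntegrand Dh Df Da Dv₁ Dv₂ ⟨n, l, 0⟩ x' y μ' z -
      (f x' y μ' * Dv₁ ⟨n, l, 0⟩ x y μ z + a x' y μ' * Dv₂ ⟨n, l, 0⟩ x y μ z)) ∂(π x' μ') =
    ∫ y, transferIntegrand Dh Df Da Dv₁ Dv₂ ⟨n, l, 0⟩ x' y μ' z ∂(π x' μ') := by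
  rw [integral_sub (T.integrable hm.1 x' μ' z) (T.integrable_weak hm x x' μ μ' z),
    T.weak_family hm, sub_zero]

/-- Subtracting the generator on frozen test functions leaves every integral unchanged and makes the
integrand at the base point constant in `y`. The derivative of the frozen part cancels the extra
term of `integrand_deriv_x` at the base point. -/
theorem integral_deriv_x {n l : ℕ} (hm : (⟨n, l + 1, 0⟩ : MultiIndex) ∈ ζ)
    (hP : T.PoissonAt n l) (x : ℝ) (μ : P2) (z : Fin n → ℝ) :
    HasDerivAt (fun s => ∫ y, transferIntegrand Dh Df Da Dv₁ Dv₂ ⟨n, l, 0⟩ s y μ z ∂(π s μ))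
      (∫ y, transferIntegrand Dh Df Da Dv₁ Dv₂ ⟨n, l + 1, 0⟩ x y μ z ∂(π x μ)) x := by
  have hr := mem_removeMax_of_x T.complete hm
  have h0 := zero_mem T.complete hm
  have h1 : (⟨0, 1, 0⟩ : MultiIndex) ∈ ζ :=
    T.complete _ hm 0 1 ⟨⟨fun i => i.elim0, fun i => i.elim0⟩, fun {i} => i.elim0⟩ 0 (by simp)
      fun i => i.elim0
  have := T.prob
  set W : ℝ → ℝ := fun y => Dv₁ ⟨n, l, 0⟩ x y μ z with hW
  set w : ℝ → ℝ := fun y => Dv₂ ⟨n, l, 0⟩ x y μ z with hw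
  have gW : UnifPolyGrowth fun _ : ℝ => W := (T.memv₁.unifPolyGrowth hr).comp fun _ => (x, μ, z)
  have gw : UnifPolyGrowth fun _ : ℝ => w := (T.memv₂.unifPolyGrowth hr).comp fun _ => (x, μ, z)
  have mW : Measurable W := T.memv₁.meas _ hr x μ z
  have mw : Measurable w := T.memv₂.meas _ hr x μ z
  have df : ∀ s y, HasDerivAt (fun s => f s y μ) (Df ⟨0, 1, 0⟩ s y μ 0) s := fun s y => by
    rw [T.f_eq h0]; exact (T.memf.family y).deriv_x 0 0 h1 s μ 0
  have da : ∀ s y, HasDerivAt (fun s => a s y μ) (Da ⟨0, 1, 0⟩ s y μ 0) s := fun s y => by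
    rw [T.a_eq h0]; exact (T.mema.family y).deriv_x 0 0 h1 s μ 0
  have gDf := (T.memf.unifPolyGrowth h1).comp fun s : ℝ => (s, μ, 0)
  have gDa := (T.mema.unifPolyGrowth h1).comp fun s : ℝ => (s, μ, 0)
  have gV₁ := (T.memv₁.unifPolyGrowth hr).comp fun s : ℝ => (s, μ, z)
  have gV₂ := (T.memv₂.unifPolyGrowth hr).comp fun s : ℝ => (s, μ, z)
  obtain ⟨C, k, hC⟩ := ((((T.growth hm).comp fun s : ℝ => (s, μ, z)).add
    ((gDf.mul gV₁).add (gDa.mul gV₂))).sub ((gDf.mul gW).add (gDa.mul gw)))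
  -- The Poisson equation enters only here, to make the integrand at the base point independent of
  -- `y`; its integral is then the same for all the probability measures `π s μ`.
  have hΦ₀ : ∀ y, transferIntegrand Dh Df Da Dv₁ Dv₂ ⟨n, l, 0⟩ x y μ z -
      (f x y μ * W y + a x y μ * w y) = _ := hP x μ z
  have key := hasDerivAt_integral_of_tvConv (ρ := fun s => π s μ) (x₀ := x)
    ((T.tv x μ).comp (tendsto_id.prodMk (tendsto_const_nhdsW2 μ))) (fun s => T.moments s μ)
    (Φ := fun s y => transferIntegrand Dh Df Da Dv₁ Dv₂ ⟨n, l, 0⟩ s y μ z -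
      (f s y μ * W y + a s y μ * w y))
    (Φ' := fun s y => (transferIntegrand Dh Df Da Dv₁ Dv₂ ⟨n, l + 1, 0⟩ s y μ z +
        (Df ⟨0, 1, 0⟩ s y μ 0 * Dv₁ ⟨n, l, 0⟩ s y μ z +
          Da ⟨0, 1, 0⟩ s y μ 0 * Dv₂ ⟨n, l, 0⟩ s y μ z)) -
        (Df ⟨0, 1, 0⟩ s y μ 0 * W y + Da ⟨0, 1, 0⟩ s y μ 0 * w y))
    (fun s => (T.measurable hr.1 s μ z).sub (((T.measurable_f h0 s μ).mul mW).add
      ((T.measurable_a h0 s μ).mul mw)))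
    (C₀ := |∫ y, transferIntegrand Dh Df Da Dv₁ Dv₂ ⟨n, l, 0⟩ x y μ z ∂(π x μ)|) (k₀ := 0)
    (fun y => by rw [hΦ₀]; exact le_mul_of_one_le_right (abs_nonneg _) (by simp))
    (fun s => by simp only [hΦ₀, integral_const, probReal_univ])
    (fun s y => (T.integrand_deriv_x hm s y μ z).sub
      (((df s y).mul_const (W y)).add ((da s y).mul_const (w y))))
    (by simpa only [hW, hw, add_sub_cancel_right] using T.measurable hm x μ z) hC
  simp only [hW, hw, add_sub_cancel_right, T.integral_sub_weak hr x] at key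
  exact key

theorem continuous_integrand_snoc {n : ℕ} (hm : (⟨n + 1, 0, 0⟩ : MultiIndex) ∈ ζ) (x y : ℝ)
    (z : Fin n → ℝ) : ContinuousW2 fun t μ =>
      transferIntegrand Dh Df Da Dv₁ Dv₂ ⟨n + 1, 0, 0⟩ x y μ (Fin.snoc z t) :=
  (T.continuousW2 hm y).comp_param (φ := fun t : ℝ => (x, (Fin.snoc z t : Fin (n + 1) → ℝ)))
    (continuous_const.prodMk (continuous_snoc z))

theorem integral_deriv_mu {n : ℕ} (hm : (⟨n + 1, 0, 0⟩ : MultiIndex) ∈ ζ)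
    (hP : T.PoissonAt n 0) (x : ℝ) (z : Fin n → ℝ) :
    HasLionsDeriv
      (fun μ => ∫ y, transferIntegrand Dh Df Da Dv₁ Dv₂ ⟨n, 0, 0⟩ x y μ z ∂(π x μ))
      (fun μ t => ∫ y, transferIntegrand Dh Df Da Dv₁ Dv₂ ⟨n + 1, 0, 0⟩ x y μ (Fin.snoc z t)
        ∂(π x μ)) := by
  intro Ω _ _ P _ _ X
  have hr := mem_removeMax_of_mu T.complete hm
  have h0 := zero_mem T.complete hm
  have h1 : (⟨1, 0, 0⟩ : MultiIndex) ∈ ζ :=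
    T.complete _ hm 1 0 (Fin.castLEOrderEmb (by simp)) 0 le_rfl fun _ => Nat.zero_le _
  have := T.prob
  set W : ℝ → ℝ := fun y => Dv₁ ⟨n, 0, 0⟩ x y (law X) z with hW
  set w : ℝ → ℝ := fun y => Dv₂ ⟨n, 0, 0⟩ x y (law X) z with hw
  have gW : UnifPolyGrowth fun _ : P2 × ℝ => W :=
    (T.memv₁.unifPolyGrowth hr).comp fun _ => (x, law X, z)
  have gw : UnifPolyGrowth fun _ : P2 × ℝ => w :=
    (T.memv₂.unifPolyGrowth hr).comp fun _ => (x, law X, z)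
  have mW : Measurable W := T.memv₁.meas _ hr x _ z
  have mw : Measurable w := T.memv₂.meas _ hr x _ z
  have df : ∀ (Y : Lp ℝ 2 P) y, LiftDerivAt (fun μ => f x y μ)
      (fun t => Df ⟨1, 0, 0⟩ x y (law Y) fun _ => t) Y := fun Y y => by
    rw [T.f_eq h0]
    exact (((T.memf.family y).deriv_mu 0 h1 x 0).liftDerivAt Y).congr (fun _ => rfl)
      fun t => congrArg (Df ⟨1, 0, 0⟩ x y (law Y)) (snoc_zero_eq t)
  have da : ∀ (Y : Lp ℝ 2 P) y, LiftDerivAt (fun μ => a x y μ)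
      (fun t => Da ⟨1, 0, 0⟩ x y (law Y) fun _ => t) Y := fun Y y => by
    rw [T.a_eq h0]
    exact (((T.mema.family y).deriv_mu 0 h1 x 0).liftDerivAt Y).congr (fun _ => rfl)
      fun t => congrArg (Da ⟨1, 0, 0⟩ x y (law Y)) (snoc_zero_eq t)
  have gDf := (T.memf.unifPolyGrowth h1).comp fun q : P2 × ℝ => (x, q.1, fun _ => q.2)
  have gDa := (T.mema.unifPolyGrowth h1).comp fun q : P2 × ℝ => (x, q.1, fun _ => q.2)
  have gV₁ := (T.memv₁.unifPolyGrowth hr).comp fun q : P2 × ℝ => (x, q.1, z)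
  have gV₂ := (T.memv₂.unifPolyGrowth hr).comp fun q : P2 × ℝ => (x, q.1, z)
  obtain ⟨C, k, hC⟩ := ((((T.growth hm).comp fun q : P2 × ℝ => (x, q.1, Fin.snoc z q.2)).add
    ((gDf.mul gV₁).add (gDa.mul gV₂))).sub ((gDf.mul gW).add (gDa.mul gw)))
  have hΦ₀ : ∀ y, transferIntegrand Dh Df Da Dv₁ Dv₂ ⟨n, 0, 0⟩ x y (law X) z -
      (f x y (law X) * W y + a x y (law X) * w y) = _ := hP x (law X) z
  -- The same cancellation along liftings, with `W` and `w` frozen at `law X`.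
  have key := liftDerivAt_integral_of_tvConv (ρ := fun μ => π x μ) (X := X)
    ((T.tv x (law X)).comp (tendsto_const_nhds.prodMk tendsto_id)) (fun μ => T.moments x μ)
    (Φ := fun μ y => transferIntegrand Dh Df Da Dv₁ Dv₂ ⟨n, 0, 0⟩ x y μ z -
      (f x y μ * W y + a x y μ * w y))
    (U := fun μ y t => (transferIntegrand Dh Df Da Dv₁ Dv₂ ⟨n + 1, 0, 0⟩ x y μ (Fin.snoc z t) +
        (Df ⟨1, 0, 0⟩ x y μ (fun _ => t) * Dv₁ ⟨n, 0, 0⟩ x y μ z +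
          Da ⟨1, 0, 0⟩ x y μ (fun _ => t) * Dv₂ ⟨n, 0, 0⟩ x y μ z)) -
        (Df ⟨1, 0, 0⟩ x y μ (fun _ => t) * W y + Da ⟨1, 0, 0⟩ x y μ (fun _ => t) * w y))
    (fun μ => (T.measurable hr.1 x μ z).sub (((T.measurable_f h0 x μ).mul mW).add
      ((T.measurable_a h0 x μ).mul mw)))
    (C₀ := |∫ y, transferIntegrand Dh Df Da Dv₁ Dv₂ ⟨n, 0, 0⟩ x y (law X) z ∂(π x (law X))|)
    (k₀ := 0)
    (fun y => by rw [hΦ₀]; exact le_mul_of_one_le_right (abs_nonneg _) (by simp))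
    (fun s => by simp only [hΦ₀, integral_const, probReal_univ])
    (fun Y y => (T.integrand_deriv_mu hm x y z Y).sub
      (((df Y y).mul_const (W y)).add ((da Y y).mul_const (w y))))
    (fun t => by
      simpa only [hW, hw, add_sub_cancel_right] using T.measurable hm x (law X) (Fin.snoc z t))
    (fun y => by
      simpa only [hW, hw, add_sub_cancel_right] using
        continuous_of_continuousW2 (T.continuous_integrand_snoc hm x y z) (law X))
    fun μ y t => hC (μ, t) y
  simp only [hW, hw, add_sub_cancel_right, T.integral_sub_weak hr x] at key
  exact key

theorem poissonAt_zero (hm : (⟨0, 0, 0⟩ : MultiIndex) ∈ removeMax ζ) : T.PoissonAt 0 0 := by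
  have e : ∀ x y μ z, transferIntegrand Dh Df Da Dv₁ Dv₂ ⟨0, 0, 0⟩ x y μ z = h x y μ := by
    intro x y μ z
    have : ∀ D E : Family, leib D E ⟨0, 0, 0⟩ x μ z = 0 := fun D E => by
      refine Finset.sum_eq_zero fun p _ => Finset.sum_eq_zero fun j hj => ?_
      have hp : p = ∅ := Subsingleton.elim _ _
      obtain rfl : j = 0 := by simpa using hj
      simp [hp, transferCoeff]
    rw [transferIntegrand_eq, this, this, (T.memh.family y).base hm.1]
    simp
  intro x μ z y
  simp only [e]
  rw [(T.memv₁.family y).base hm, (T.memv₂.family y).base hm]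
  have := (T.pois x μ).2.2 y
  rw [gen] at this
  have e2 : f x y μ * dy v x y μ + a x y μ * dyy v x y μ = h x y μ - avg h π x μ := this
  rw [e2, avg]
  ring

/-- Both sides of the equation of the previous order are differentiated: the left side by the
product rule, whose cross terms cancel the extra term of the integrand, the right side by the
differentiated integral that this equation provides. Uniqueness of derivatives yields the next
equation, first along `μ`, then along `x`. -/
theorem poissonAt_of_mem (n l : ℕ) (hm : (⟨n, l, 0⟩ : MultiIndex) ∈ removeMax ζ) :
    T.PoissonAt n l := by
  have hc := removeMax_complete T.complete
  induction l with
  | zero =>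
    induction n with
    | zero => exact T.poissonAt_zero hm
    | succ n ih =>
      have hm' := mem_of_mu hc hm
      have hP := ih hm'
      have h0 := zero_mem T.complete hm.1
      have h1 : (⟨1, 0, 0⟩ : MultiIndex) ∈ ζ :=
        T.complete _ hm.1 1 0 (Fin.castLEOrderEmb (by simp)) 0 le_rfl fun _ => Nat.zero_le _
      have cf : ∀ x y, ContinuousW2 fun (_ : ℝ) μ => f x y μ := fun x y => by
        rw [T.f_eq h0]
        exact ((T.memf.family y).cont _ h0).comp_param (φ := fun _ : ℝ => (x, 0)) continuous_const
      have ca : ∀ x y, ContinuousW2 fun (_ : ℝ) μ => a x y μ := fun x y => by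
        rw [T.a_eq h0]
        exact ((T.mema.family y).cont _ h0).comp_param (φ := fun _ : ℝ => (x, 0)) continuous_const
      have key : ∀ x μ (z : Fin n → ℝ) t y,
          transferIntegrand Dh Df Da Dv₁ Dv₂ ⟨n + 1, 0, 0⟩ x y μ (Fin.snoc z t) -
            (f x y μ * Dv₁ ⟨n + 1, 0, 0⟩ x y μ (Fin.snoc z t) +
              a x y μ * Dv₂ ⟨n + 1, 0, 0⟩ x y μ (Fin.snoc z t)) =
          ∫ y, transferIntegrand Dh Df Da Dv₁ Dv₂ ⟨n + 1, 0, 0⟩ x y μ (Fin.snoc z t)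
            ∂(π x μ) := by
        intro x μ z t y
        refine HasLionsDeriv.unique
          (u := fun μ => ∫ y, transferIntegrand Dh Df Da Dv₁ Dv₂ ⟨n, 0, 0⟩ x y μ z ∂(π x μ))
          (U := fun μ t => transferIntegrand Dh Df Da Dv₁ Dv₂ ⟨n + 1, 0, 0⟩ x y μ (Fin.snoc z t) -
            (f x y μ * Dv₁ ⟨n + 1, 0, 0⟩ x y μ (Fin.snoc z t) +
              a x y μ * Dv₂ ⟨n + 1, 0, 0⟩ x y μ (Fin.snoc z t)))
          (V := fun μ t => ∫ y, transferIntegrand Dh Df Da Dv₁ Dv₂ ⟨n + 1, 0, 0⟩ x y μ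
            (Fin.snoc z t) ∂(π x μ)) ?_ (T.integral_deriv_mu hm.1 hP x z) ?_ ?_ μ t
        · intro Ω _ _ P _ _ X
          have df : LiftDerivAt (fun μ => f x y μ)
              (fun t => Df ⟨1, 0, 0⟩ x y (law X) fun _ => t) X := by
            rw [T.f_eq h0]
            exact (((T.memf.family y).deriv_mu 0 h1 x 0).liftDerivAt X).congr (fun _ => rfl)
              fun t => congrArg (Df ⟨1, 0, 0⟩ x y (law X)) (snoc_zero_eq t)
          have da : LiftDerivAt (fun μ => a x y μ)
              (fun t => Da ⟨1, 0, 0⟩ x y (law X) fun _ => t) X := by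
            rw [T.a_eq h0]
            exact (((T.mema.family y).deriv_mu 0 h1 x 0).liftDerivAt X).congr (fun _ => rfl)
              fun t => congrArg (Da ⟨1, 0, 0⟩ x y (law X)) (snoc_zero_eq t)
          have key := LiftDerivAt.congr ((T.integrand_deriv_mu hm.1 x y z X).sub
            ((df.mul (((T.memv₁.family y).deriv_mu n hm x z).liftDerivAt X)).add
            (da.mul (((T.memv₂.family y).deriv_mu n hm x z).liftDerivAt X))))
            (fun μ => hP x μ z y) (fun t => rfl)
          have key' : LiftDerivAt
              (fun μ => ∫ y, transferIntegrand Dh Df Da Dv₁ Dv₂ ⟨n, 0, 0⟩ x y μ z ∂(π x μ))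
              (fun t => transferIntegrand Dh Df Da Dv₁ Dv₂ ⟨n + 1, 0, 0⟩ x y (law X)
                  (Fin.snoc z t) -
                (f x y (law X) * Dv₁ ⟨n + 1, 0, 0⟩ x y (law X) (Fin.snoc z t) +
                  a x y (law X) * Dv₂ ⟨n + 1, 0, 0⟩ x y (law X) (Fin.snoc z t))) X :=
            key.congr (fun _ => rfl) fun t => by ring
          exact key'
        · exact (T.continuous_integrand_snoc hm.1 x y z).sub
            (((cf x y).mul (T.memv₁.continuousW2_snoc hm x y z)).add
            ((ca x y).mul (T.memv₂.continuousW2_snoc hm x y z)))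
        · exact (T.integral_continuousW2 hm.1).comp_param
            (φ := fun t : ℝ => (x, (Fin.snoc z t : Fin (n + 1) → ℝ)))
            (continuous_const.prodMk (continuous_snoc z))
      intro x μ z y
      have := key x μ (Fin.init z) (z (Fin.last n)) y
      rwa [Fin.snoc_init_self] at this
  | succ l ih =>
    have hm' : (⟨n, l, 0⟩ : MultiIndex) ∈ removeMax ζ :=
      mem_of_le hc hm (Nat.le_succ l) fun _ => le_rfl
    have hP := ih hm'
    have h0 := zero_mem T.complete hm.1
    have h1 : (⟨0, 1, 0⟩ : MultiIndex) ∈ ζ :=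
      T.complete _ hm.1 0 1 ⟨⟨fun i => i.elim0, fun i => i.elim0⟩, fun {i} => i.elim0⟩ 0 (by simp)
        fun i => i.elim0
    intro x μ z y
    have df : HasDerivAt (fun s => f s y μ) (Df ⟨0, 1, 0⟩ x y μ 0) x := by
      rw [T.f_eq h0]; exact (T.memf.family y).deriv_x 0 0 h1 x μ 0
    have da : HasDerivAt (fun s => a s y μ) (Da ⟨0, 1, 0⟩ x y μ 0) x := by
      rw [T.a_eq h0]; exact (T.mema.family y).deriv_x 0 0 h1 x μ 0
    have d1 := (T.integrand_deriv_x hm.1 x y μ z).sub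
      ((df.mul ((T.memv₁.family y).deriv_x n l hm x μ z)).add
      (da.mul ((T.memv₂.family y).deriv_x n l hm x μ z)))
    have d2 := T.integral_deriv_x hm.1 hP x μ z
    rw [← d1.unique (d2.congr_of_eventuallyEq (Eventually.of_forall fun s => hP s μ z y))]
    ring

theorem isDerivFamily : IsDerivFamily ζ (avg h π)
    (fun m x μ z => ∫ y, transferIntegrand Dh Df Da Dv₁ Dv₂ m x y μ z ∂(π x μ)) where
  base hm x μ z := by
    have e : ∀ y, transferIntegrand Dh Df Da Dv₁ Dv₂ ⟨0, 0, 0⟩ x y μ z = h x y μ := by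
      intro y
      have : ∀ D E : Family, leib D E ⟨0, 0, 0⟩ x μ z = 0 := fun D E => by
        refine Finset.sum_eq_zero fun p _ => Finset.sum_eq_zero fun j hj => ?_
        have hp : p = ∅ := Subsingleton.elim _ _
        obtain rfl : j = 0 := by simpa using hj
        simp [hp, transferCoeff]
      rw [transferIntegrand_eq, this, this, (T.memh.family y).base hm]
      simp
    simp only [e, avg]
  deriv_mu n hm x z :=
    T.integral_deriv_mu hm (T.poissonAt_of_mem n 0 (mem_removeMax_of_mu T.complete hm)) x z
  deriv_x n l hm x μ z :=
    T.integral_deriv_x hm (T.poissonAt_of_mem n l (mem_removeMax_of_x T.complete hm)) x μ z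
  -- The measure does not depend on `z`, so plain differentiation under the integral suffices; this
  -- is why the Poisson equations are only needed for `β = 0`.
  deriv_z n l β i hi hm x μ z := by
    have hm' := mem_of_z T.complete hm
    obtain ⟨C, k, hC⟩ := (T.growth hm).comp fun s : ℝ => (x, μ, Function.update z i s)
    obtain ⟨C₀, k₀, hC₀⟩ := (T.growth hm').comp fun s : ℝ => (x, μ, Function.update z i s)
    have key := hasDerivAt_integral_of_tvConv (x₀ := z i) (TVConv.const (𝓝 (z i)) (π x μ))
      (fun _ => T.moments x μ)
      (Φ := fun s y => transferIntegrand Dh Df Da Dv₁ Dv₂ ⟨n, l, β⟩ x y μ (Function.update z i s))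
      (Φ' := fun s y => transferIntegrand Dh Df Da Dv₁ Dv₂ ⟨n, l, β + Pi.single i 1⟩ x y μ
        (Function.update z i s))
      (fun s => T.measurable hm' x μ _) (hC₀ (z i)) (fun _ => rfl)
      (fun s y => by
        have := T.integrand_deriv_z hi hm x y μ (Function.update z i s)
        simpa only [Function.update_idem, Function.update_self] using this)
      (T.measurable hm x μ _) hC
    simpa only [Function.update_eq_self] using key
  cont m hm := T.integral_continuousW2 hm

end TransferData

/-! ### Invariant measures with uniformly bounded moments -/

theorem PolyGrowth.unif {G : ℝ → ℝ → P2 → ℝ} (h : PolyGrowth G) :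
    UnifPolyGrowth fun (q : ℝ × P2) y => G q.1 y q.2 := by
  obtain ⟨C, k, h⟩ := h
  exact ⟨C, k, fun q y => h q.1 y q.2⟩

theorem UniformMoments.finiteMoments {π : ℝ → P2 → Measure ℝ} (h : UniformMoments π) (x : ℝ)
    (μ : P2) : FiniteMoments (π x μ) := fun k => by
  obtain ⟨C, hC⟩ := h k
  exact (hC x μ).1

/-! ### From uniform moments to the density, the weak equation and continuity -/

section Invariant

variable {f a : ℝ → ℝ → P2 → ℝ} {π : ℝ → P2 → Measure ℝ}

/-- Polynomial growth and finite moments make the coefficients integrable, which removes the flux.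
-/
theorem exists_density (hf : ∀ x μ, Continuous fun y => f x y μ)
    (ha : ∀ x μ, Continuous fun y => a x y μ) (hpos : ∀ x y μ, 0 < a x y μ) (gf : PolyGrowth f)
    (ga : PolyGrowth a) (hinv : ∀ x μ, IsInvariantProb f a x μ (π x μ)) (hπ : UniformMoments π)
    (x : ℝ) (μ : P2) :
    ∃ c : ℝ, 0 < c ∧ π x μ = densMeasure (fun y => f x y μ) (fun y => a x y μ) c ∧
      Integrable (dens (fun y => f x y μ) fun y => a x y μ) ∧
      c * ∫ y, dens (fun y => f x y μ) (fun y => a x y μ) y = 1 := by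
  have := (hinv x μ).1
  exact exists_eq_densMeasure (hf x μ) (ha x μ) (fun y => hpos x y μ) fun ψ =>
    flux_eq_zero_of_integrable (hf x μ) (ha x μ)
      ((hπ.finiteMoments x μ).integrable_of_growth gf.unif (x, μ) (hf x μ).measurable)
      ((hπ.finiteMoments x μ).integrable_of_growth ga.unif (x, μ) (ha x μ).measurable)
      (hinv x μ).2

theorem integral_weak_invariant (hf : ∀ x μ, Continuous fun y => f x y μ)
    (ha : ∀ x μ, Continuous fun y => a x y μ) (hpos : ∀ x y μ, 0 < a x y μ) (gf : PolyGrowth f)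
    (ga : PolyGrowth a) (hinv : ∀ x μ, IsInvariantProb f a x μ (π x μ)) (hπ : UniformMoments π)
    (x : ℝ) (μ : P2) {W w : ℝ → ℝ} (hw : Measurable w) (gW : UnifPolyGrowth fun _ : Unit => W)
    (gw : UnifPolyGrowth fun _ : Unit => w) (h : ∀ y, W y = W 0 + ∫ s in (0 : ℝ)..y, w s) :
    ∫ y, (f x y μ * W y + a x y μ * w y) ∂(π x μ) = 0 := by
  obtain ⟨c, hc, e, -, -⟩ := exists_density hf ha hpos gf ga hinv hπ x μ
  have hm := hπ.finiteMoments x μ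
  have hwi := intervalIntegrable_of_growth gw () hw
  have hW : Measurable W := by
    rw [funext h]
    exact (continuous_const.add (intervalIntegral.continuous_primitive hwi 0)).measurable
  rw [e] at hm ⊢
  exact integral_weak_eq_zero (hf x μ) (ha x μ) (fun y => hpos x y μ) hc hwi h
    (hm.integrable_of_growth (((gf.unif.comp fun _ => (x, μ)).mul gW).add
      ((ga.unif.comp fun _ => (x, μ)).mul gw)) ()
      (((hf x μ).measurable.mul hW).add ((ha x μ).measurable.mul hw)))
    (hm.integrable_of_growth ((ga.unif.comp fun _ => (x, μ)).mul gW) ()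
      ((ha x μ).measurable.mul hW))

theorem tendsto_of_continuousW2 {g : ℝ → ℝ → P2 → ℝ}
    (hg : ContinuousW2 fun (q : ℝ × ℝ) μ => g q.1 q.2 μ) (x : ℝ) (μ : P2) (s : ℝ) :
    Tendsto (fun p : (ℝ × P2) × ℝ => g p.1.1 p.2 p.1.2) ((𝓝 x ×ˢ nhdsW2 μ) ×ˢ 𝓝 s)
      (𝓝 (g x s μ)) := by
  have h : Tendsto (fun p : (ℝ × P2) × ℝ => ((p.1.1, p.2), p.1.2)) ((𝓝 x ×ˢ nhdsW2 μ) ×ˢ 𝓝 s)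
      (𝓝 (x, s) ×ˢ nhdsW2 μ) := by
    rw [nhds_prod_eq]
    exact ((tendsto_fst.comp tendsto_fst).prodMk tendsto_snd).prodMk
      (tendsto_snd.comp tendsto_fst)
  exact (hg (x, s) μ).comp h

/-- The pair `(x, μ)` serves as a single parameter; the uniform moments of `π` provide the
tightness. -/
theorem tvConv_invariant (hf : ∀ x μ, Continuous fun y => f x y μ)
    (ha : ∀ x μ, Continuous fun y => a x y μ) (hpos : ∀ x y μ, 0 < a x y μ) (gf : PolyGrowth f)
    (ga : PolyGrowth a) (hinv : ∀ x μ, IsInvariantProb f a x μ (π x μ)) (hπ : UniformMoments π)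
    (hfc : ContinuousW2 fun (q : ℝ × ℝ) μ => f q.1 q.2 μ)
    (hac : ContinuousW2 fun (q : ℝ × ℝ) μ => a q.1 q.2 μ) (x : ℝ) (μ : P2) :
    TVConv (𝓝 x ×ˢ nhdsW2 μ) (fun q : ℝ × P2 => π q.1 q.2) (π x μ) := by
  choose c hc e _ h1 using exists_density hf ha hpos gf ga hinv hπ
  have key := tvConv_densMeasure (ι := ℝ × P2) (l := 𝓝 x ×ˢ nhdsW2 μ) (i₀ := (x, μ))
    (f := fun q y => f q.1 y q.2) (a := fun q y => a q.1 y q.2) (c := fun q => c q.1 q.2)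
    (fun q => ha q.1 q.2) (fun q => hf q.1 q.2) (fun q y => hpos q.1 y q.2)
    (tendsto_of_continuousW2 hfc x μ) (tendsto_of_continuousW2 hac x μ) (fun q => hc q.1 q.2)
    (fun q => h1 q.1 q.2) fun k => by
      obtain ⟨C, hC⟩ := hπ k
      exact ⟨C, fun q => e q.1 q.2 ▸ hC q.1 q.2⟩
  simpa only [← e] using key

variable {h v : ℝ → ℝ → P2 → ℝ}

/-- The transfer formula for differences in both parameters at the same time. -/
theorem integral_sub_integral_eq (hf : ∀ x μ, Continuous fun y => f x y μ)
    (ha : ∀ x μ, Continuous fun y => a x y μ) (hpos : ∀ x y μ, 0 < a x y μ) (gf : PolyGrowth f)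
    (ga : PolyGrowth a) (hh : ∀ x μ, Continuous fun y => h x y μ) (gh : PolyGrowth h)
    (hinv : ∀ x μ, IsInvariantProb f a x μ (π x μ)) (hπ : UniformMoments π)
    (hv : IsPoissonSol f a h π v) (x₁ x₂ : ℝ) (μ₁ μ₂ : P2) :
    Integrable (fun y => h x₁ y μ₁) (π x₁ μ₁) ∧ Integrable (fun y => h x₂ y μ₂) (π x₂ μ₂) ∧
    Integrable (fun y => h x₁ y μ₁ - h x₂ y μ₂ -
      (gen f a x₁ μ₁ (fun s => v x₂ s μ₂) y - gen f a x₂ μ₂ (fun s => v x₂ s μ₂) y)) (π x₁ μ₁) ∧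
    ∫ y, h x₁ y μ₁ ∂(π x₁ μ₁) - ∫ y, h x₂ y μ₂ ∂(π x₂ μ₂) =
      ∫ y, (h x₁ y μ₁ - h x₂ y μ₂ -
        (gen f a x₁ μ₁ (fun s => v x₂ s μ₂) y - gen f a x₂ μ₂ (fun s => v x₂ s μ₂) y))
          ∂(π x₁ μ₁) := by
  have hp := (hinv x₁ μ₁).1
  have ih : ∀ x μ, Integrable (fun y => h x y μ) (π x μ) := fun x μ =>
    (hπ.finiteMoments x μ).integrable_of_growth gh.unif (x, μ) (hh x μ).measurable
  obtain ⟨C, k, hC⟩ := (hv x₂ μ₂).2.1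
  have g₁ : UnifPolyGrowth fun _ : Unit => fun y => dy v x₂ y μ₂ := ⟨C, k, fun _ y => (hC y).1⟩
  have g₂ : UnifPolyGrowth fun _ : Unit => fun y => dyy v x₂ y μ₂ := ⟨C, k, fun _ y => (hC y).2⟩
  have m₁ : Measurable fun y => dy v x₂ y μ₂ := measurable_deriv _
  have m₂ : Measurable fun y => dyy v x₂ y μ₂ := measurable_deriv _
  have iW : Integrable (fun y => f x₁ y μ₁ * dy v x₂ y μ₂ + a x₁ y μ₁ * dyy v x₂ y μ₂)
      (π x₁ μ₁) :=
    (hπ.finiteMoments x₁ μ₁).integrable_of_growth (((gf.unif.comp fun _ => (x₁, μ₁)).mul g₁).add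
      ((ga.unif.comp fun _ => (x₁, μ₁)).mul g₂)) ()
      (((hf x₁ μ₁).measurable.mul m₁).add ((ha x₁ μ₁).measurable.mul m₂))
  have key : ∫ y, (f x₁ y μ₁ * dy v x₂ y μ₂ + a x₁ y μ₁ * dyy v x₂ y μ₂) ∂(π x₁ μ₁) = 0 :=
    integral_weak_invariant hf ha hpos gf ga hinv hπ x₁ μ₁ (W := fun y => dy v x₂ y μ₂) m₂ g₁ g₂
      fun y => by rw [hv.integral_dyy]; ring
  -- The Poisson equation at `(x₂, μ₂)` replaces the second generator by `h - avg`, so `h x₂ y μ₂`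
  -- drops out and only a constant and a term of vanishing mean remain.
  have e : (fun y => h x₁ y μ₁ - h x₂ y μ₂ -
      (gen f a x₁ μ₁ (fun s => v x₂ s μ₂) y - gen f a x₂ μ₂ (fun s => v x₂ s μ₂) y)) =
      fun y => h x₁ y μ₁ - avg h π x₂ μ₂ -
        (f x₁ y μ₁ * dy v x₂ y μ₂ + a x₁ y μ₁ * dyy v x₂ y μ₂) := by
    ext y
    rw [(hv x₂ μ₂).2.2 y, gen, dy, dyy]
    ring
  have i1 : Integrable (fun y => h x₁ y μ₁ - avg h π x₂ μ₂) (π x₁ μ₁) :=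
    (ih x₁ μ₁).sub (integrable_const _)
  rw [e]
  refine ⟨ih x₁ μ₁, ih x₂ μ₂, i1.sub iW, ?_⟩
  rw [integral_sub i1 iW, key, integral_sub (ih x₁ μ₁) (integrable_const _)]
  simp [avg]

theorem transferData_of_invariant (hf : ∀ x μ, Continuous fun y => f x y μ)
    (ha : ∀ x μ, Continuous fun y => a x y μ) (hpos : ∀ x y μ, 0 < a x y μ) (gf : PolyGrowth f)
    (ga : PolyGrowth a) (hinv : ∀ x μ, IsInvariantProb f a x μ (π x μ)) (hπ : UniformMoments π)
    (hv : IsPoissonSol f a h π v) {ζ : Set MultiIndex} (hζ : IsCompleteCollection ζ)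
    (hfc : ContinuousW2 fun (q : ℝ × ℝ) μ => f q.1 q.2 μ)
    (hac : ContinuousW2 fun (q : ℝ × ℝ) μ => a q.1 q.2 μ)
    {Dh Df Da Dv₁ Dv₂ : (m : MultiIndex) → ℝ → ℝ → P2 → (Fin m.n → ℝ) → ℝ}
    (mh : MemMp ζ h Dh) (mf : MemMp ζ f Df) (ma : MemMp ζ a Da)
    (mv₁ : MemMp (removeMax ζ) (dy v) Dv₁) (mv₂ : MemMp (removeMax ζ) (dyy v) Dv₂) :
    TransferData ζ f a h π v Dh Df Da Dv₁ Dv₂ where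
  complete := hζ
  memh := mh
  memf := mf
  mema := ma
  memv₁ := mv₁
  memv₂ := mv₂
  prob x μ := (hinv x μ).1
  moments := hπ.finiteMoments
  tv := tvConv_invariant hf ha hpos gf ga hinv hπ hfc hac
  weak x μ _ _ hw gW gw h := integral_weak_invariant hf ha hpos gf ga hinv hπ x μ hw gW gw h
  pois := hv

end Invariant

/-! ### Confining coefficients -/

/-- Coefficients of a one-dimensional diffusion with quadratically confining potential. -/
structure Confining (c₁ c₂ M κ : ℝ) (f a : ℝ → ℝ) : Prop where
  cont_f : Continuous f
  cont_a : Continuous a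
  lower_pos : 0 < c₁
  rate_pos : 0 < κ
  lower : ∀ y, c₁ ≤ a y
  upper : ∀ y, a y ≤ c₂
  near : ∀ y, |y| ≤ 1 → |f y / a y| ≤ M
  right : ∀ y, 0 ≤ y → f y / a y ≤ M - 2 * κ * y
  left : ∀ y, y ≤ 0 → -M - 2 * κ * y ≤ f y / a y

/-- The constant in the Gaussian bound of `dens`. -/
def gaussConst (c₁ M κ : ℝ) : ℝ := Real.exp (M ^ 2 / (2 * κ)) / c₁

theorem integrable_pow_mul_gauss {κ : ℝ} (hκ : 0 < κ) (k : ℕ) :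
    Integrable fun y : ℝ => |y| ^ k * Real.exp (-(κ / 2) * y ^ 2) := by
  have := (integrable_rpow_mul_exp_neg_mul_sq (half_pos hκ) (s := k)
    (by have : (0 : ℝ) ≤ k := k.cast_nonneg; linarith)).norm
  refine this.congr (ae_of_all _ fun y => ?_)
  simp only [norm_mul, Real.rpow_natCast, norm_pow, Real.norm_eq_abs, Real.abs_exp]

theorem pot_comp_neg (f a : ℝ → ℝ) (y : ℝ) :
    pot (fun y => -f (-y)) (fun y => a (-y)) y = pot f a (-y) := by
  simp only [pot, neg_div]
  rw [intervalIntegral.integral_neg, intervalIntegral.integral_comp_neg (fun s => f s / a s),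
    ← intervalIntegral.integral_symm, neg_zero]

theorem dens_comp_neg (f a : ℝ → ℝ) (y : ℝ) :
    dens (fun y => -f (-y)) (fun y => a (-y)) y = dens f a (-y) := by
  rw [dens, pot_comp_neg, dens]

namespace Confining

variable {c₁ c₂ M κ : ℝ} {f a : ℝ → ℝ} (H : Confining c₁ c₂ M κ f a)

include H

theorem pos (y : ℝ) : 0 < a y := H.lower_pos.trans_le (H.lower y)

theorem nonneg_const : 0 ≤ M := (abs_nonneg _).trans (H.near 0 (by simp))

theorem upper_pos : 0 < c₂ := (H.pos 0).trans_le (H.upper 0)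

/-- The symmetry `y ↦ -y` reduces the estimates on the left half-line to those on the right one. -/
theorem reflect : Confining c₁ c₂ M κ (fun y => -f (-y)) fun y => a (-y) where
  cont_f := (H.cont_f.comp continuous_neg).neg
  cont_a := H.cont_a.comp continuous_neg
  lower_pos := H.lower_pos
  rate_pos := H.rate_pos
  lower y := H.lower (-y)
  upper y := H.upper (-y)
  near y hy := by rw [neg_div, abs_neg]; exact H.near (-y) (by rwa [abs_neg])
  right y hy := by have := H.left (-y) (by linarith); rw [neg_div]; linarith
  left y hy := by have := H.right (-y) (by linarith); rw [neg_div]; linarith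

/-- Integrating `f / a ≤ M - 2 * κ * s` from `y` to `y + t` gives this up to the term `-2 * κ * y *
t`, which is dropped. The bound is uniform in the starting point `y`, as the tail estimate requires.
-/
theorem pot_add_le {y t : ℝ} (hy : 0 ≤ y) (ht : 0 ≤ t) :
    pot f a (y + t) ≤ pot f a y + (M * t - κ * t ^ 2) := by
  have hd : ∀ s, HasDerivAt (fun s => pot f a s - M * s + κ * s ^ 2)
      (f s / a s - M + κ * (2 * s)) s := fun s => by
    refine HasDerivAt.congr_deriv (f := fun s => pot f a s - M * s + κ * s ^ 2)
      (((hasDerivAt_pot H.cont_f H.cont_a H.pos s).sub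
        ((hasDerivAt_id s).const_mul M)).add ((hasDerivAt_pow 2 s).const_mul κ)) ?_
    simp
  have hanti : AntitoneOn (fun s => pot f a s - M * s + κ * s ^ 2) (Set.Ici 0) := by
    refine antitoneOn_of_deriv_nonpos (convex_Ici 0)
      (fun s _ => (hd s).continuousAt.continuousWithinAt)
      (fun s _ => (hd s).differentiableAt.differentiableWithinAt) fun s hs => ?_
    rw [interior_Ici] at hs
    rw [(hd s).deriv]
    linarith [H.right s (le_of_lt hs)]
  have := hanti (Set.mem_Ici.2 hy) (Set.mem_Ici.2 (add_nonneg hy ht)) (by linarith : y ≤ y + t)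
  have h2 := mul_nonneg H.rate_pos.le (mul_nonneg hy ht)
  dsimp only at this
  nlinarith

theorem quadratic_le (t : ℝ) : M * t - κ * t ^ 2 ≤ M ^ 2 / (2 * κ) + -(κ / 2) * t ^ 2 := by
  have hκ := H.rate_pos
  have : M ^ 2 / (2 * κ) + -(κ / 2) * t ^ 2 - (M * t - κ * t ^ 2) =
      (M - κ * t) ^ 2 / (2 * κ) := by field_simp; ring
  have : 0 ≤ (M - κ * t) ^ 2 / (2 * κ) := by positivity
  linarith

theorem dens_add_le {y t : ℝ} (hy : 0 ≤ y) (ht : 0 ≤ t) :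
    Real.exp (-pot f a y) * dens f a (y + t) ≤
      gaussConst c₁ M κ * Real.exp (-(κ / 2) * t ^ 2) := by
  have h1 : Real.exp (-pot f a y) * Real.exp (pot f a (y + t)) ≤
      Real.exp (M ^ 2 / (2 * κ)) * Real.exp (-(κ / 2) * t ^ 2) := by
    rw [← Real.exp_add, ← Real.exp_add]
    exact Real.exp_le_exp.2 (by linarith [H.pot_add_le hy ht, H.quadratic_le t])
  rw [dens, gaussConst, mul_div_assoc', div_mul_eq_mul_div]
  exact div_le_div₀ (by positivity) h1 H.lower_pos (H.lower _)

theorem dens_le (y : ℝ) : dens f a y ≤ gaussConst c₁ M κ * Real.exp (-(κ / 2) * y ^ 2) := by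
  rcases le_total 0 y with hy | hy
  · simpa [pot] using H.dens_add_le le_rfl hy
  · have := H.reflect.dens_add_le le_rfl (neg_nonneg.2 hy)
    simpa [pot, dens_comp_neg] using this

theorem gaussConst_pos : 0 < gaussConst c₁ M κ := div_pos (Real.exp_pos _) H.lower_pos

theorem integrable_pow_mul_dens (k : ℕ) : Integrable fun y => |y| ^ k * dens f a y := by
  have := continuous_dens H.cont_f H.cont_a H.pos
  refine ((integrable_pow_mul_gauss H.rate_pos k).const_mul (gaussConst c₁ M κ)).mono'
    (Continuous.aestronglyMeasurable (by fun_prop)) (ae_of_all _ fun y => ?_)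
  rw [Real.norm_of_nonneg (mul_nonneg (by positivity) (dens_pos H.pos y).le), mul_left_comm]
  exact mul_le_mul_of_nonneg_left (H.dens_le y) (by positivity)

theorem integral_pow_mul_dens_le (k : ℕ) : ∫ y, |y| ^ k * dens f a y ≤
    gaussConst c₁ M κ * ∫ y, |y| ^ k * Real.exp (-(κ / 2) * y ^ 2) := by
  rw [← integral_const_mul]
  refine integral_mono (H.integrable_pow_mul_dens k)
    ((integrable_pow_mul_gauss H.rate_pos k).const_mul _) fun y => ?_
  dsimp only
  rw [mul_left_comm]
  exact mul_le_mul_of_nonneg_left (H.dens_le y) (by positivity)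

theorem integrable_dens : Integrable (dens f a) := by
  simpa using H.integrable_pow_mul_dens 0

/-- The interval `[0, 1]` already carries this much mass. The bound involves only the constants of
`Confining`, and so makes normalised moments uniform. -/
theorem le_integral_dens : Real.exp (-M) / c₂ ≤ ∫ y, dens f a y := by
  have hpot : ∀ y ∈ Set.Icc (0 : ℝ) 1, -M ≤ pot f a y := fun y hy => by
    have h1 : ‖∫ s in (0 : ℝ)..y, f s / a s‖ ≤ M * |y - 0| :=
      intervalIntegral.norm_integral_le_of_norm_le_const fun s hs => H.near s <| by
        rw [Set.uIoc_of_le hy.1] at hs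
        rw [abs_of_pos hs.1]; exact hs.2.trans hy.2
    rw [sub_zero, abs_of_nonneg hy.1, Real.norm_eq_abs] at h1
    have := neg_le_of_abs_le h1
    have h2 := mul_le_mul_of_nonneg_left hy.2 H.nonneg_const
    rw [pot]; linarith
  calc Real.exp (-M) / c₂ = ∫ _ in Set.Icc (0 : ℝ) 1, Real.exp (-M) / c₂ := by simp
    _ ≤ ∫ y in Set.Icc (0 : ℝ) 1, dens f a y :=
        setIntegral_mono_on (by simp) H.integrable_dens.integrableOn measurableSet_Icc
          fun y hy => div_le_div₀ (Real.exp_pos _).le (Real.exp_le_exp.2 (hpot y hy)) (H.pos y)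
            (H.upper y)
    _ ≤ ∫ y, dens f a y :=
        setIntegral_le_integral H.integrable_dens (ae_of_all _ fun y => (dens_pos H.pos y).le)

theorem integral_dens_pos : 0 < ∫ y, dens f a y :=
  (div_pos (Real.exp_pos _) H.upper_pos).trans_le H.le_integral_dens

/-- The only invariant probability measure. -/
theorem eq_densMeasure {ρ : Measure ℝ} [IsProbabilityMeasure ρ]
    (hinv : ∀ φ : ℝ → ℝ, ContDiff ℝ (⊤ : ℕ∞) φ → HasCompactSupport φ →
      ∫ y, (f y * deriv φ y + a y * deriv (deriv φ) y) ∂ρ = 0) :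
    ρ = densMeasure f a (∫ y, dens f a y)⁻¹ := by
  have hR : 0 ≤ M / (2 * κ) := div_nonneg H.nonneg_const (by linarith [H.rate_pos])
  have hM : 2 * κ * (M / (2 * κ)) = M := mul_div_cancel₀ _ (by linarith [H.rate_pos])
  have hκ : 0 < 2 * κ := by linarith [H.rate_pos]
  -- Beyond `M / (2 * κ)` the drift points inwards. An arbitrary invariant probability measure comes
  -- without moments, so the integrability criterion for the flux is not at hand.
  have hflux := fun ψ => flux_eq_zero_of_inward H.cont_f H.cont_a (R₀ := M / (2 * κ))
    (fun y => (abs_of_pos (H.pos y)).trans_le (H.upper y))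
    (fun y hy => by
      have h1 := H.right y (hR.trans hy)
      have h2 := mul_le_mul_of_nonneg_left hy hκ.le
      rw [← div_mul_cancel₀ (f y) (H.pos y).ne']
      exact mul_nonpos_of_nonpos_of_nonneg (by linarith) (H.pos y).le)
    (fun y hy => by
      have h1 := H.left y (hy.trans (neg_nonpos.2 hR))
      have h2 := mul_le_mul_of_nonneg_left hy hκ.le
      rw [← div_mul_cancel₀ (f y) (H.pos y).ne']
      exact mul_nonneg (by linarith) (H.pos y).le) hinv (ψ := ψ)
  obtain ⟨c, -, e, -, h1⟩ := exists_eq_densMeasure H.cont_f H.cont_a H.pos hflux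
  rw [e, ← eq_inv_of_mul_eq_one_left h1]

theorem integral_densMeasure_eq (g : ℝ → ℝ) :
    ∫ y, g y ∂(densMeasure f a (∫ y, dens f a y)⁻¹) =
      (∫ y, dens f a y)⁻¹ * ∫ y, g y * dens f a y := by
  rw [integral_densMeasure H.cont_f H.cont_a H.pos (inv_nonneg.2 H.integral_dens_pos.le),
    ← integral_const_mul]
  congr 1; ext y; ring

theorem integrable_densMeasure_iff (g : ℝ → ℝ) :
    Integrable g (densMeasure f a (∫ y, dens f a y)⁻¹) ↔ Integrable fun y => g y * dens f a y := by
  rw [integrable_densMeasure H.cont_f H.cont_a H.pos (inv_nonneg.2 H.integral_dens_pos.le)]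
  simp_rw [mul_left_comm _ (∫ y, dens f a y)⁻¹]
  exact integrable_const_mul_iff (isUnit_iff_ne_zero.2 (inv_ne_zero H.integral_dens_pos.ne')) _

theorem isProbabilityMeasure : IsProbabilityMeasure (densMeasure f a (∫ y, dens f a y)⁻¹) := by
  have h0 := H.integral_dens_pos
  have hi := H.integrable_dens.const_mul (∫ y, dens f a y)⁻¹
  refine ⟨?_⟩
  rw [densMeasure, withDensity_apply _ MeasurableSet.univ, Measure.restrict_univ,
    ← ofReal_integral_eq_lintegral_ofReal hi
      (ae_of_all _ fun y => mul_nonneg (inv_nonneg.2 h0.le) (dens_pos H.pos y).le),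
    integral_const_mul, inv_mul_cancel₀ h0.ne', ENNReal.ofReal_one]

/-- This is the weak equation with `W = φ'`; compact support settles integrability. -/
theorem invariant_densMeasure {φ : ℝ → ℝ} (hφ : ContDiff ℝ (⊤ : ℕ∞) φ)
    (hc : HasCompactSupport φ) :
    ∫ y, (f y * deriv φ y + a y * deriv (deriv φ) y)
      ∂(densMeasure f a (∫ y, dens f a y)⁻¹) = 0 := by
  have := H.isProbabilityMeasure
  have h1 : ContDiff ℝ (⊤ : ℕ∞) (deriv φ) := (contDiff_infty_iff_deriv.1 hφ).2
  have h2 : Continuous (deriv (deriv φ)) := h1.continuous_deriv (by simp)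
  have hf := H.cont_f
  have ha := H.cont_a
  have h3 := h1.continuous
  refine integral_weak_eq_zero hf ha H.pos (inv_pos.2 H.integral_dens_pos)
    (fun u v => h2.intervalIntegrable u v) (fun y => ?_) ?_ ?_
  · rw [intervalIntegral.integral_eq_sub_of_hasDerivAt
      (fun s _ => (h1.differentiable (by simp) s).hasDerivAt) (h2.intervalIntegrable _ _)]
    ring
  · exact (Continuous.integrable_of_hasCompactSupport (by fun_prop) hc.deriv.mul_left).add
      (Continuous.integrable_of_hasCompactSupport (by fun_prop) hc.deriv.deriv.mul_left)
  · exact Continuous.integrable_of_hasCompactSupport (by fun_prop) hc.deriv.mul_left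

/-! ### The Poisson equation -/

variable {g : ℝ → ℝ}

theorem integrable_mul_dens (hg : Continuous g) (gg : UnifPolyGrowth fun _ : Unit => g) :
    Integrable fun y => g y * dens f a y := by
  rw [← H.integrable_densMeasure_iff]
  refine FiniteMoments.integrable_of_growth (fun k => ?_) gg () hg.measurable
  rw [H.integrable_densMeasure_iff]
  exact H.integrable_pow_mul_dens k

/-- After the shift `s = y + t` the prefactor turns the density into one bounded by a Gaussian in
`t`, uniformly in `y`, and the polynomial weight at `y + t` splits into a product of weights at `y`
and `t`. -/
theorem tail_growth {C : ℝ} {k : ℕ} (hC0 : 0 ≤ C)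
    (hC : ∀ y, |g y| ≤ C * (1 + |y| ^ k)) :
    ∃ C', ∀ y, 0 ≤ y →
      |Real.exp (-pot f a y) * ∫ s in Set.Ioi y, g s * dens f a s| ≤ C' * (1 + |y| ^ k) := by
  set L := gaussConst c₁ M κ with hL
  have hLp : 0 < L := H.gaussConst_pos
  set γ : ℝ → ℝ := fun t => Real.exp (-(κ / 2) * t ^ 2) with hγ
  have hi : ∀ k : ℕ, Integrable fun t => |t| ^ k * γ t := integrable_pow_mul_gauss H.rate_pos
  have hi0 : Integrable γ := by simpa using hi 0
  set B : ℝ := ∫ t, (1 + |t| ^ k) * γ t with hB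
  have hiB : Integrable fun t => (1 + |t| ^ k) * γ t := by
    refine (hi0.add (hi k)).congr (ae_of_all _ fun t => ?_)
    simp only [Pi.add_apply]; ring
  refine ⟨C * 2 ^ k * L * B, fun y hy => ?_⟩
  have e : ∫ s in Set.Ioi y, g s * dens f a s = ∫ t in Set.Ioi 0, g (y + t) * dens f a (y + t) := by
    have := (measurePreserving_add_left volume y).setIntegral_preimage_emb
      (measurableEmbedding_addLeft y) (fun s => g s * dens f a s) (Set.Ioi y)
    rw [← this]
    simp
  rw [e, ← integral_const_mul, ← Real.norm_eq_abs]
  have hb : ∀ t ∈ Set.Ioi (0 : ℝ), ‖Real.exp (-pot f a y) * (g (y + t) * dens f a (y + t))‖ ≤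
      C * 2 ^ k * L * (1 + |y| ^ k) * ((1 + |t| ^ k) * γ t) := fun t ht => by
    have ht : 0 ≤ t := le_of_lt ht
    rw [mul_left_comm, norm_mul, Real.norm_of_nonneg
      (mul_nonneg (Real.exp_pos _).le (dens_pos H.pos _).le)]
    have h1 : 1 + |y + t| ^ k ≤ 2 ^ k * ((1 + |y| ^ k) * (1 + |t| ^ k)) := by
      have h2 : (y + t) ^ k ≤ 2 ^ (k - 1) * (y ^ k + t ^ k) := add_pow_le hy ht k
      have h3 : (2 : ℝ) ^ (k - 1) ≤ 2 ^ k := pow_le_pow_right₀ (by norm_num) (Nat.sub_le _ _)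
      have h4 : (1 : ℝ) ≤ 2 ^ k := one_le_pow₀ (by norm_num)
      rw [abs_of_nonneg (add_nonneg hy ht), abs_of_nonneg hy, abs_of_nonneg ht]
      have h5 : 0 ≤ y ^ k := by positivity
      have h6 : 0 ≤ t ^ k := by positivity
      have h7 := mul_le_mul_of_nonneg_right h3 (add_nonneg h5 h6)
      have h8 : 0 ≤ (2 : ℝ) ^ k * (y ^ k * t ^ k) := by positivity
      nlinarith
    calc ‖g (y + t)‖ * (Real.exp (-pot f a y) * dens f a (y + t))
        ≤ (C * (2 ^ k * ((1 + |y| ^ k) * (1 + |t| ^ k)))) * (L * γ t) :=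
          mul_le_mul ((hC _).trans (mul_le_mul_of_nonneg_left h1 hC0)) (H.dens_add_le hy ht)
            (mul_nonneg (Real.exp_pos _).le (dens_pos H.pos _).le) (by positivity)
      _ = _ := by ring
  calc _ ≤ ∫ t in Set.Ioi (0 : ℝ), C * 2 ^ k * L * (1 + |y| ^ k) * ((1 + |t| ^ k) * γ t) :=
        norm_integral_le_of_norm_le (hiB.const_mul _).integrableOn
          (ae_restrict_of_forall_mem measurableSet_Ioi hb)
    _ ≤ ∫ t, C * 2 ^ k * L * (1 + |y| ^ k) * ((1 + |t| ^ k) * γ t) :=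
        setIntegral_le_integral (hiB.const_mul _) (ae_of_all _ fun t => by positivity)
    _ = _ := by rw [integral_const_mul]; ring

/-- The polynomially growing solution of `f W + a W' = g` for `g` with vanishing mean. -/
theorem exists_first_order_solution (hg : Continuous g) (gg : UnifPolyGrowth fun _ : Unit => g)
    (h0 : ∫ y, g y * dens f a y = 0) :
    ∃ W : ℝ → ℝ, (UnifPolyGrowth fun _ : Unit => W) ∧
      ∀ y, HasDerivAt W ((g y - f y * W y) / a y) y := by
  have hi := H.integrable_mul_dens hg gg
  obtain ⟨C, k, hC0, hC⟩ := gg.nonneg_const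
  have hq := continuous_dens H.cont_f H.cont_a H.pos
  have hgq : Continuous fun y => g y * dens f a y := hg.mul hq
  -- Vanishing mean lets the solution be written with either tail. On each half-line the outer tail
  -- is used, since only that one compensates `exp (-pot)`.
  have hsplit : ∀ y, ∫ s in Set.Iic y, g s * dens f a s = -∫ s in Set.Ioi y, g s * dens f a s :=
    fun y => by
      have := integral_add_compl (measurableSet_Iic (a := y)) hi
      rw [h0, Set.compl_Iic] at this
      linarith
  set W : ℝ → ℝ := fun y => Real.exp (-pot f a y) * ∫ s in Set.Iic y, g s * dens f a s with hW
  refine ⟨W, ?_, fun y => ?_⟩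
  · obtain ⟨C₁, h₁⟩ := H.tail_growth hC0 (hC ())
    obtain ⟨C₂, h₂⟩ := H.reflect.tail_growth (g := fun y => g (-y)) hC0
      (fun y => by simpa using hC () (-y))
    refine ⟨max C₁ C₂, k, fun _ y => ?_⟩
    rcases le_total 0 y with hy | hy
    · rw [hW]; simp only
      rw [hsplit, mul_neg, abs_neg]
      exact (h₁ y hy).trans (mul_le_mul_of_nonneg_right (le_max_left _ _) (by positivity))
    · have := h₂ (-y) (neg_nonneg.2 hy)
      simp only [dens_comp_neg, pot_comp_neg, neg_neg, abs_neg] at this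
      rw [integral_comp_neg_Ioi (-y) fun s => g s * dens f a s, neg_neg] at this
      exact this.trans (mul_le_mul_of_nonneg_right (le_max_right _ _) (by positivity))
  · have hP : HasDerivAt (fun y => ∫ s in Set.Iic y, g s * dens f a s) (g y * dens f a y) y := by
      have e : (fun y => ∫ s in Set.Iic y, g s * dens f a s) = fun y =>
          (∫ s in Set.Iic 0, g s * dens f a s) + ∫ s in (0 : ℝ)..y, g s * dens f a s := by
        ext y
        rw [← intervalIntegral.integral_Iic_sub_Iic hi.integrableOn hi.integrableOn]
        ring
      rw [e]
      exact (hgq.integral_hasStrictDerivAt 0 y).hasDerivAt.const_add _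
    refine HasDerivAt.congr_deriv
      (((hasDerivAt_pot H.cont_f H.cont_a H.pos y).neg.exp).mul hP) ?_
    simp only [dens, hW, Pi.neg_apply]
    have := (H.pos y).ne'
    have e : Real.exp (-pot f a y) * Real.exp (pot f a y) = 1 := by
      rw [← Real.exp_add]; simp
    field_simp
    linear_combination (g y) * e

/-- The solution is a primitive of the first order solution `W`. Growth of the second derivative is
read off from the equation, using the lower bound on `a`. -/
theorem exists_poisson_solution (gf : UnifPolyGrowth fun _ : Unit => f) (hg : Continuous g)
    (gg : UnifPolyGrowth fun _ : Unit => g) (h0 : ∫ y, g y * dens f a y = 0) :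
    ∃ v : ℝ → ℝ, ContDiff ℝ 2 v ∧
      (∃ (C : ℝ) (k : ℕ), ∀ y, |deriv v y| ≤ C * (1 + |y| ^ k) ∧
        |deriv (deriv v) y| ≤ C * (1 + |y| ^ k)) ∧
      ∀ y, f y * deriv v y + a y * deriv (deriv v) y = g y := by
  obtain ⟨W, gW, hW⟩ := H.exists_first_order_solution hg gg h0
  have hWc : Continuous W := continuous_iff_continuousAt.2 fun y => (hW y).continuousAt
  have e1 : deriv (fun y => ∫ s in (0 : ℝ)..y, W s) = W :=
    funext fun y => (hWc.integral_hasStrictDerivAt 0 y).hasDerivAt.deriv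
  have e2 : deriv W = fun y => (g y - f y * W y) / a y := funext fun y => (hW y).deriv
  have hW1 : ContDiff ℝ 1 W := by
    rw [show (1 : WithTop ℕ∞) = 0 + 1 by simp, contDiff_succ_iff_deriv]
    refine ⟨fun y => (hW y).differentiableAt, by simp, contDiff_zero.2 ?_⟩
    rw [e2]
    exact (hg.sub (H.cont_f.mul hWc)).div₀ H.cont_a fun y => (H.pos y).ne'
  refine ⟨fun y => ∫ s in (0 : ℝ)..y, W s, ?_, ?_, fun y => ?_⟩
  · rw [show (2 : WithTop ℕ∞) = 1 + 1 by norm_num, contDiff_succ_iff_deriv]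
    refine ⟨fun y => (hWc.integral_hasStrictDerivAt 0 y).hasDerivAt.differentiableAt, by simp, ?_⟩
    rwa [e1]
  · have ga : UnifPolyGrowth fun (_ : Unit) y => (a y)⁻¹ := ⟨c₁⁻¹, 0, fun _ y => by
      rw [abs_of_pos (inv_pos.2 (H.pos y))]
      refine (inv_anti₀ H.lower_pos (H.lower y)).trans ?_
      exact le_mul_of_one_le_right (inv_nonneg.2 H.lower_pos.le) (by simp)⟩
    have gW' := (gg.sub (gf.mul gW)).mul ga
    obtain ⟨C, k, h⟩ := gW.abs.add gW'.abs
    refine ⟨C, k, fun y => ?_⟩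
    rw [e1, e2]
    have := le_of_abs_le (h () y)
    simp only [div_eq_mul_inv]
    constructor
    · exact (le_add_of_nonneg_right (abs_nonneg _)).trans this
    · exact (le_add_of_nonneg_left (abs_nonneg _)).trans this
  · rw [e1, e2]
    have := (H.pos y).ne'
    field_simp; ring

end Confining

/-! ### Elliptic and dissipative coefficients -/

section Dissipative

variable {f a : ℝ → ℝ → P2 → ℝ}

theorem exists_confining (hf : ∀ x μ, Continuous fun y => f x y μ)
    (ha : ∀ x μ, Continuous fun y => a x y μ) (gf : PolyGrowth f) (he : UniformlyElliptic a)
    (hd : Dissipative f) :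
    ∃ c₁ c₂ M κ : ℝ, ∀ x μ, Confining c₁ c₂ M κ (fun y => f x y μ) fun y => a x y μ := by
  obtain ⟨c₁, c₂, h1, hc⟩ := he
  obtain ⟨b, C, hb, hC⟩ := hd
  obtain ⟨K, k, hK0, hK⟩ := gf.unif.nonneg_const
  have hc2 : ∀ x y μ, 0 < a x y μ := fun x y μ => h1.trans_le (hc x y μ).1
  have hbd : ∀ x y μ, |y| ≤ 1 → |f x y μ| ≤ 2 * K := fun x y μ hy => by
    have := pow_le_one₀ (n := k) (abs_nonneg y) hy
    refine (hK (x, μ) y).trans ?_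
    nlinarith
  -- Dissipativity bounds `f` only after division by `y`, hence for `|y| ≥ 1`. Near the origin the
  -- growth bound `2 * K` takes over, and `b` absorbs `b * |y|` there.
  set N : ℝ := 2 * K + |C| + b with hN
  have hN0 : 0 ≤ N := by positivity
  have hright : ∀ x y μ, 0 ≤ y → f x y μ ≤ N - b * y := fun x y μ hy => by
    rcases le_total y 1 with h | h
    · have := le_of_abs_le (hbd x y μ (by rwa [abs_of_nonneg hy]))
      nlinarith [abs_nonneg C]
    · have := hC x y μ
      have h2 : (f x y μ + b * y) * y ≤ |C| * y := by nlinarith [le_abs_self C, abs_nonneg C]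
      have := le_of_mul_le_mul_right h2 (by linarith)
      linarith
  have hleft : ∀ x y μ, y ≤ 0 → -N - b * y ≤ f x y μ := fun x y μ hy => by
    rcases le_total (-1) y with h | h
    · have := neg_le_of_abs_le (hbd x y μ (by rw [abs_of_nonpos hy]; linarith))
      nlinarith [abs_nonneg C]
    · have := hC x y μ
      have h2 : (-f x y μ - b * y) * (-y) ≤ |C| * (-y) := by
        nlinarith [le_abs_self C, abs_nonneg C]
      have := le_of_mul_le_mul_right h2 (by linarith)
      linarith
  have hdivN : ∀ x y μ, N / a x y μ ≤ N / c₁ := fun x y μ =>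
    div_le_div_of_nonneg_left hN0 h1 (hc x y μ).1
  have hdivb : ∀ x y μ t, 0 ≤ t → b / c₂ * t ≤ b * t / a x y μ := fun x y μ t ht => by
    rw [div_mul_eq_mul_div]
    exact div_le_div_of_nonneg_left (by positivity) (hc2 x y μ) (hc x y μ).2
  -- Division by `a` uses the lower bound for the constant `N` and the upper bound for the confining
  -- term; the last `2` matches the factor in `2 * κ`.
  refine ⟨c₁, c₂, N / c₁, b / c₂ / 2, fun x μ => ⟨hf x μ, ha x μ, h1, ?_, fun y => (hc x y μ).1,
    fun y => (hc x y μ).2, fun y hy => ?_, fun y hy => ?_, fun y hy => ?_⟩⟩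
  · exact half_pos (div_pos hb ((hc2 x 0 μ).trans_le (hc x 0 μ).2))
  · rw [abs_div, abs_of_pos (hc2 x y μ)]
    refine div_le_div₀ hN0 ((hbd x y μ hy).trans ?_) h1 (hc x y μ).1
    linarith [abs_nonneg C]
  · have := div_le_div_of_nonneg_right (hright x y μ hy) (hc2 x y μ).le
    rw [sub_div] at this
    linarith [hdivN x y μ, hdivb x y μ y hy]
  · have := div_le_div_of_nonneg_right (hleft x y μ hy) (hc2 x y μ).le
    rw [sub_div, neg_div] at this
    have h2 := hdivb x y μ (-y) (by linarith)
    rw [mul_neg, mul_neg, neg_div] at h2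
    linarith [hdivN x y μ]

theorem existsUnique_invariant {c₁ c₂ M κ : ℝ}
    (H : ∀ x μ, Confining c₁ c₂ M κ (fun y => f x y μ) fun y => a x y μ) (x : ℝ) (μ : P2) :
    ∃! ρ : Measure ℝ, IsInvariantProb f a x μ ρ := by
  refine ⟨_, ⟨(H x μ).isProbabilityMeasure, fun φ => (H x μ).invariant_densMeasure⟩,
    fun ρ hρ => ?_⟩
  have := hρ.1
  exact (H x μ).eq_densMeasure hρ.2

theorem uniformMoments_of_confining {c₁ c₂ M κ : ℝ}
    (H : ∀ x μ, Confining c₁ c₂ M κ (fun y => f x y μ) fun y => a x y μ)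
    {π : ℝ → P2 → Measure ℝ} (hinv : ∀ x μ, IsInvariantProb f a x μ (π x μ)) :
    UniformMoments π := by
  -- The Gaussian moment divided by the lower bound for the normalising integral; neither depends on
  -- `(x, μ)`.
  refine fun k => ⟨(Real.exp (-M) / c₂)⁻¹ *
    (gaussConst c₁ M κ * ∫ y, |y| ^ k * Real.exp (-(κ / 2) * y ^ 2)), fun x μ => ?_⟩
  have := (hinv x μ).1
  rw [(H x μ).eq_densMeasure (hinv x μ).2, (H x μ).integrable_densMeasure_iff,
    (H x μ).integral_densMeasure_eq]
  have hp := div_pos (Real.exp_pos (-M)) (H x μ).upper_pos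
  exact ⟨(H x μ).integrable_pow_mul_dens k, mul_le_mul (inv_anti₀ hp (H x μ).le_integral_dens)
    ((H x μ).integral_pow_mul_dens_le k)
    (integral_nonneg fun y => mul_nonneg (by positivity) (dens_pos (H x μ).pos y).le)
    (inv_nonneg.2 hp.le)⟩

theorem exists_isPoissonSol {c₁ c₂ M κ : ℝ}
    (H : ∀ x μ, Confining c₁ c₂ M κ (fun y => f x y μ) fun y => a x y μ) (gf : PolyGrowth f)
    {h : ℝ → ℝ → P2 → ℝ} (hh : ∀ x μ, Continuous fun y => h x y μ) (gh : PolyGrowth h)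
    {π : ℝ → P2 → Measure ℝ} (hinv : ∀ x μ, IsInvariantProb f a x μ (π x μ)) :
    ∃ v, IsPoissonSol f a h π v := by
  have key : ∀ x μ, ∃ v : ℝ → ℝ, ContDiff ℝ 2 v ∧
      (∃ (C : ℝ) (k : ℕ), ∀ y, |deriv v y| ≤ C * (1 + |y| ^ k) ∧
        |deriv (deriv v) y| ≤ C * (1 + |y| ^ k)) ∧
      ∀ y, f x y μ * deriv v y + a x y μ * deriv (deriv v) y = h x y μ - avg h π x μ := by
    intro x μ
    have := (hinv x μ).1
    have gh' : UnifPolyGrowth fun _ : Unit => fun y => h x y μ := gh.unif.comp fun _ => (x, μ)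
    refine (H x μ).exists_poisson_solution (gf.unif.comp fun _ => (x, μ))
      ((hh x μ).sub continuous_const) (gh'.sub (UnifPolyGrowth.const (avg h π x μ))) ?_
    have h0 := (H x μ).integral_dens_pos
    -- The average is taken against the normalised density, so `h - avg` satisfies the solvability
    -- condition of the Poisson equation.
    have e : avg h π x μ = (∫ y, dens (fun y => f x y μ) (fun y => a x y μ) y)⁻¹ *
        ∫ y, h x y μ * dens (fun y => f x y μ) (fun y => a x y μ) y := by
      rw [avg, (H x μ).eq_densMeasure (hinv x μ).2, (H x μ).integral_densMeasure_eq]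
    simp_rw [sub_mul]
    rw [integral_sub ((H x μ).integrable_mul_dens (hh x μ) gh')
      ((H x μ).integrable_dens.const_mul _), integral_const_mul, e]
    field_simp
    ring
  choose v h1 h2 h3 using key
  exact ⟨fun x y μ => v x μ y, fun x μ => ⟨h1 x μ, h2 x μ, h3 x μ⟩⟩

end Dissipative

end DerivTransfer

end

/-! ### The theorem -/

theorem lemmaA4
    (f a h : ℝ → ℝ → P2 → ℝ)
    (hf_cont : ∀ x μ, Continuous (fun y => f x y μ))
    (ha_cont : ∀ x μ, Continuous (fun y => a x y μ))
    (ha_pos : ∀ x y μ, 0 < a x y μ)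
    (hf_growth : PolyGrowth f) (ha_growth : PolyGrowth a)
    (hh_cont : ContinuousW2 (fun (q : ℝ × ℝ) μ => h q.1 q.2 μ))
    (hh_growth : PolyGrowth h) :
    -- the transfer formulas
    (∀ (π : ℝ → P2 → Measure ℝ) (v : ℝ → ℝ → P2 → ℝ),
      (∀ x μ, IsInvariantProb f a x μ (π x μ)) → UniformMoments π → IsPoissonSol f a h π v →
      -- differences in the measure argument
      (∀ (x : ℝ) (μ₁ μ₂ : P2),
        Integrable (fun y => h x y μ₁) (π x μ₁) ∧ Integrable (fun y => h x y μ₂) (π x μ₂) ∧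
        Integrable (fun y => h x y μ₁ - h x y μ₂ -
          (gen f a x μ₁ (fun s => v x s μ₂) y - gen f a x μ₂ (fun s => v x s μ₂) y)) (π x μ₁) ∧
        ∫ y, h x y μ₁ ∂(π x μ₁) - ∫ y, h x y μ₂ ∂(π x μ₂) =
          ∫ y, (h x y μ₁ - h x y μ₂ -
            (gen f a x μ₁ (fun s => v x s μ₂) y - gen f a x μ₂ (fun s => v x s μ₂) y))
              ∂(π x μ₁)) ∧
      -- differences in the space argument
      (∀ (x₁ x₂ : ℝ) (μ : P2),
        Integrable (fun y => h x₁ y μ) (π x₁ μ) ∧ Integrable (fun y => h x₂ y μ) (π x₂ μ) ∧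
        Integrable (fun y => h x₁ y μ - h x₂ y μ -
          (gen f a x₁ μ (fun s => v x₂ s μ) y - gen f a x₂ μ (fun s => v x₂ s μ) y)) (π x₁ μ) ∧
        ∫ y, h x₁ y μ ∂(π x₁ μ) - ∫ y, h x₂ y μ ∂(π x₂ μ) =
          ∫ y, (h x₁ y μ - h x₂ y μ -
            (gen f a x₁ μ (fun s => v x₂ s μ) y - gen f a x₂ μ (fun s => v x₂ s μ) y))
              ∂(π x₁ μ)) ∧
      -- mixed derivatives
      (∀ ζ : Set MultiIndex, IsCompleteCollection ζ →
        ContinuousW2 (fun (q : ℝ × ℝ) μ => f q.1 q.2 μ) →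
        ContinuousW2 (fun (q : ℝ × ℝ) μ => a q.1 q.2 μ) →
        ∀ Dh Df Da Dv₁ Dv₂ : (m : MultiIndex) → ℝ → ℝ → P2 → (Fin m.n → ℝ) → ℝ,
          MemMp ζ h Dh → MemMp ζ f Df → MemMp ζ a Da →
          MemMp (removeMax ζ) (dy v) Dv₁ → MemMp (removeMax ζ) (dyy v) Dv₂ →
          (∀ m ∈ ζ, ∀ x μ z,
            Integrable (fun y => transferIntegrand Dh Df Da Dv₁ Dv₂ m x y μ z) (π x μ)) ∧
          IsDerivFamily ζ (avg h π)
            (fun m x μ z => ∫ y, transferIntegrand Dh Df Da Dv₁ Dv₂ m x y μ z ∂(π x μ)))) ∧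
    -- under ellipticity and dissipativity, such `π` and `v` exist
    (UniformlyElliptic a → Dissipative f →
      (∀ x μ, ∃! ρ : Measure ℝ, IsInvariantProb f a x μ ρ) ∧
      ∀ π : ℝ → P2 → Measure ℝ, (∀ x μ, IsInvariantProb f a x μ (π x μ)) →
        UniformMoments π ∧ ∃ v, IsPoissonSol f a h π v) := by
  have hh : ∀ x μ, Continuous fun y => h x y μ := fun x μ =>
    (continuous_of_continuousW2 hh_cont μ).comp (Continuous.prodMk_right x)
  refine ⟨fun π v hinv hπ hv => ⟨fun x μ₁ μ₂ => ?_, fun x₁ x₂ μ => ?_, ?_⟩, fun he hd => ?_⟩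
  · exact integral_sub_integral_eq hf_cont ha_cont ha_pos hf_growth ha_growth hh hh_growth hinv hπ
      hv x x μ₁ μ₂
  · exact integral_sub_integral_eq hf_cont ha_cont ha_pos hf_growth ha_growth hh hh_growth hinv hπ
      hv x₁ x₂ μ μ
  · intro ζ hζ hfc hac Dh Df Da Dv₁ Dv₂ mh mf ma mv₁ mv₂
    have T := transferData_of_invariant hf_cont ha_cont ha_pos hf_growth ha_growth hinv hπ hv hζ
      hfc hac mh mf ma mv₁ mv₂
    exact ⟨fun m hm x μ z => T.integrable hm x μ z, T.isDerivFamily⟩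
  · obtain ⟨c₁, c₂, M, κ, H⟩ := exists_confining hf_cont ha_cont hf_growth he hd
    exact ⟨existsUnique_invariant H, fun π hinv => ⟨uniformMoments_of_confining H hinv,
      exists_isPoissonSol H hf_growth hh hh_growth hinv⟩⟩
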